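/- Let $M$ be a smooth manifold of dimension $m$. A chart $(V,\psi)$, $\psi=(x^i)$, of $M$ induces coordinates $(x^i,\dot x^i)$ on $TM$ and $(x^i,\dot x^i,\ddot x^i)$ on the manifold $T^2M$ of second-order velocities, over the preimages $V^1$, $V^2$ of $V$. Put $\omega^i=dx^i-\dot x^i\,dt$. Let $\varepsilon$ be a smooth autonomous source form on $\mathbb{R}\times T^2M$, that is, a 2-form with a chart expression $\varepsilon=\varepsilon_i(x,\dot x,\ddot x)\,\omega^i\wedge dt$ in every chart. Assume that $\varepsilon$ is locally variational: around every point of $M$ there are a chart $(V,\psi)$ and a smooth function $\mathscr{L}:\mathbb{R}\times V^2\to\mathbb{R}$ with $$\varepsilon_i=\frac{\partial\mathscr{L}}{\partial x^i}-\frac{d}{dt}\frac{\partial\mathscr{L}}{\partial\dot x^i}+\frac{d^2}{dt^2}\frac{\partial\mathscr{L}}{\partial\ddot x^i},\qquad 1\le i\le m .$$ Then in every chart $\varepsilon_i=A_i+B_{ij}\ddot x^j$ with functions $A_i,B_{ij}$ of $(x,\dot x)$ only. Consider in every chart the forms $$\omega=\frac14\Big(\frac{\partial A_i}{\partial\dot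 x^j}-\frac{\partial A_j}{\partial\dot x^i}\Big)_{(x,0)}dx^i\wedge dx^j,\qquad \kappa=-\sum_{l=1}^m\Big(\int_0^{\dot x^l}B_{jl}(x,0,\dots,0,\nu,\dot x^{l+1},\dots,\dot x^m)\,d\nu\Big)dx^j$$ on $V^1$ (with $\nu$ in the $l$-th place), and on $\mathbb{R}\times V^1$ the form $$\mu_0=-\Big(A_i-\frac12\Big(\frac{\partial A_i}{\partial\dot x^j}-\frac{\partial A_j}{\partial\dot x^i}\Big)\dot x^j\Big)t\,dx^i-B_{ij}\dot x^i t\,d\dot x^j .$$ **Theorem.** 1. The chart expressions of $\omega$ and of $\kappa$ agree on chart overlaps. Hence there are a smooth 2-form $\omega$ and a smooth 1-form $\kappa$ on $TM$ with these expressions in every chart, and in every chart $$\omega+d\kappa=\alpha':=\frac14\Big(\frac{\partial A_i}{\partial\dot x^j}-\frac{\partial A_j}{\partial\dot x^i}\Big)dx^i\wedge dx^j+B_{ij}\,dx^i\wedge d\dot x^j .$$ 2. There is a smooth 1-form $\mu_0$ on $\mathbb{R}\times TM$ with the above expression in every chart. There is exactly one Lepage equivalent $\alpha_\varepsilon$ of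 $\varepsilon$, i.e. one smooth closed 2-form on $\mathbb{R}\times TM$ whose 1-contact component is $p_1\alpha_\varepsilon=\varepsilon$, and on $\mathbb{R}\times TM$ $$\alpha_\varepsilon=\omega+d(\mu_0+\kappa),$$ where $\omega$ and $\kappa$ are pulled back along $\mathbb{R}\times TM\to TM$. -/

import Mathlib

open scoped Manifold ContDiff Topology

noncomputable section

namespace VarForms

/-! ## Differential forms on manifolds -/

section Forms

variable {E : Type*} [NormedAddCommGroup E] [NormedSpace ℝ E] {H : Type*} [TopologicalSpace H]
  (I : ModelWithCorners ℝ E H) {N : Type*} [TopologicalSpace N] [ChartedSpace H N]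
  {E' : Type*} [NormedAddCommGroup E'] [NormedSpace ℝ E'] {H' : Type*} [TopologicalSpace H']
  (I' : ModelWithCorners ℝ E' H') {N' : Type*} [TopologicalSpace N'] [ChartedSpace H' N']

/-- (Not necessarily smooth) differential `k`-forms on the manifold `N`. -/
abbrev DForm (N : Type*) [TopologicalSpace N] [ChartedSpace H N] (k : ℕ) : Type _ :=
  ∀ p : N, TangentSpace I p [⋀^Fin k]→L[ℝ] ℝ

variable {I} {k : ℕ}

/-- The representative of a form in the preferred chart at `p`: its pull-back by the inverse of
the chart, a differential form on the model space. -/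
def DForm.localRep (θ : DForm I N k) (p : N) : E → E [⋀^Fin k]→L[ℝ] ℝ := fun y =>
  (θ ((extChartAt I p).symm y)).compContinuousLinearMap
    (mfderivWithin 𝓘(ℝ, E) I (extChartAt I p).symm (Set.range I) y)

/-- Smooth differential forms. -/
def DForm.IsSmooth (θ : DForm I N k) : Prop :=
  ∀ p : N, ContDiffOn ℝ ∞ (DForm.localRep θ p) (extChartAt I p).target

/-- The exterior derivative of a form, computed at `p` in the preferred chart at `p`. -/
def DForm.d (θ : DForm I N k) : DForm I N (k + 1) := fun p =>
  (extDerivWithin (DForm.localRep θ p) (Set.range I) (extChartAt I p p)).compContinuousLinearMap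
    (mfderiv I 𝓘(ℝ, E) (extChartAt I p) p)

/-- The pull-back of a form by a map. -/
def DForm.pullback {I' : ModelWithCorners ℝ E' H'} (f : N → N') (θ : DForm I' N' k) :
    DForm I N k := fun p => (θ (f p)).compContinuousLinearMap (mfderiv I I' f p)

variable (I)

/-- The differential at `p` of a real function, as a covector. -/
def dAt (f : N → ℝ) (p : N) : TangentSpace I p →L[ℝ] ℝ := mfderiv I 𝓘(ℝ, ℝ) f p

/-- The tangent vector `τ ∂/∂t + u` of `ℝ × N` at `(t, p)`. -/
def pairVec (t : ℝ) (p : N) (τ : ℝ) (u : TangentSpace I p) :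
    TangentSpace (𝓘(ℝ, ℝ).prod I) ((t, p) : ℝ × N) := (τ, u)

end Forms

section Algebra

variable {V : Type*} [AddCommGroup V] [Module ℝ V] [TopologicalSpace V]

/-- A covector as an alternating form of degree one. -/
def oneForm (a : V →L[ℝ] ℝ) : V [⋀^Fin 1]→L[ℝ] ℝ :=
  ContinuousAlternatingMap.ofSubsingleton ℝ V ℝ 0 a

/-- The wedge product of two covectors, `(a ∧ b)(u, v) = a u * b v - a v * b u`. -/
def wedge (a b : V →L[ℝ] ℝ) : V [⋀^Fin 2]→L[ℝ] ℝ where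
  toFun v := a (v 0) * b (v 1) - a (v 1) * b (v 0)
  map_update_add' := by
    intro _ v i x y
    fin_cases i <;> simp [Function.update] <;> ring
  map_update_smul' := by
    intro _ v i c x
    fin_cases i <;> simp [Function.update] <;> ring
  cont := by fun_prop
  map_eq_zero_of_eq' := by
    intro v i j h hij
    fin_cases i <;> fin_cases j <;> simp_all

end Algebra

/-! ## Total derivatives and Euler-Lagrange expressions -/

/-- The Euclidean coordinate space `ℝ^m`. -/
abbrev Coord (m : ℕ) : Type := EuclideanSpace ℝ (Fin m)

/-- The `j`-th standard basis vector. -/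
def stdVec {m : ℕ} (j : Fin m) : Coord m := EuclideanSpace.single j 1

/-- The total derivative `d/dt` of a function of `(t, x, x', …, x^(r))`, a function of
`(t, x, x', …, x^(r+1))`. -/
def totalDeriv {m r : ℕ} (f : ℝ × (Fin (r + 1) → Coord m) → ℝ) :
    ℝ × (Fin (r + 2) → Coord m) → ℝ := fun z =>
  fderiv ℝ f (z.1, fun k => z.2 k.castSucc) (1, fun k => z.2 k.succ)

/-- The partial derivative with respect to the `i`-th component of the `k`-th order velocity. -/
def jetPartial {m r : ℕ} (k : Fin (r + 1)) (i : Fin m) (f : ℝ × (Fin (r + 1) → Coord m) → ℝ) :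
    ℝ × (Fin (r + 1) → Coord m) → ℝ := fun z =>
  fderiv ℝ f z (0, Pi.single k (stdVec i))

/-- The Euler-Lagrange expression
`∂L/∂xⁱ - d/dt (∂L/∂ẋⁱ) + d²/dt² (∂L/∂ẍⁱ)` of a second order Lagrange function, a function of
`(t, x, x', x'', x''', x'''')`. -/
def eulerLagrange {m : ℕ} (L : ℝ × (Fin 3 → Coord m) → ℝ) (i : Fin m) :
    ℝ × (Fin 5 → Coord m) → ℝ := fun z =>
  jetPartial 0 i L (z.1, fun k => z.2 (Fin.castLE (by norm_num) k))
    - totalDeriv (jetPartial 1 i L) (z.1, fun k => z.2 (Fin.castLE (by norm_num) k))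
    + totalDeriv (totalDeriv (jetPartial 2 i L)) z

/-! ## Charts, velocities and second order velocities -/

variable {m : ℕ} {M : Type*} [TopologicalSpace M] [ChartedSpace (Coord m) M]

variable (m M) in
/-- The smooth charts of `M` (all members of its maximal smooth atlas). -/
abbrev Chart : Type _ :=
  {φ : OpenPartialHomeomorph M (Coord m) // φ ∈ IsManifold.maximalAtlas (𝓡 m) ∞ M}

/-- The domain `V` of a chart. -/
abbrev Chart.dom (φ : Chart m M) : Set M := φ.1.source

/-- The image of a chart, an open subset of `ℝ^m`. -/
abbrev Chart.img (φ : Chart m M) : Set (Coord m) := φ.1.target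

/-- The coordinate vector field `∂/∂xⁱ` at the point with coordinates `x`. -/
def Chart.vec (φ : Chart m M) (i : Fin m) (x : Coord m) : TangentSpace (𝓡 m) (φ.1.symm x) :=
  mfderiv (𝓡 m) (𝓡 m) φ.1.symm x (stdVec i)

variable [IsManifold (𝓡 m) ∞ M]

variable (m M) in
/-- The tangent bundle of `M`. -/
abbrev TM : Type _ := TangentBundle (𝓡 m) M

/-- The coordinates `x = (xⁱ)` of the base point of a tangent vector. -/
def Chart.pos (φ : Chart m M) (p : TM m M) : Coord m := φ.1 p.proj

/-- The coordinates `ẋ = (ẋⁱ)` of a tangent vector. -/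
def Chart.vel (φ : Chart m M) (p : TM m M) : Coord m := mfderiv (𝓡 m) (𝓡 m) φ.1 p.proj p.2

/-- The inverse of the associated chart `(xⁱ, ẋⁱ)` of the tangent bundle. -/
def Chart.tangentInv (φ : Chart m M) (z : Coord m × Coord m) : TM m M :=
  ⟨φ.1.symm z.1, mfderiv (𝓡 m) (𝓡 m) φ.1.symm z.1 z.2⟩

variable (m M) in
/-- The manifold `T²M` of second order velocities, as the usual subset of `T(TM)`: tangent vectors
`acc` of `TM` at `pt` whose projection by `T(TM) → TM` equals `pt`. The `2`-jet at `0` of a curve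
`ζ` in `M` corresponds to the velocity at `0` of the curve `(ζ, ζ')` in `TM`. -/
structure T2M where
  /-- the underlying point of `TM`, that is the `1`-jet -/
  pt : TM m M
  /-- the tangent vector of `TM` -/
  acc : TangentSpace (𝓡 m).tangent pt
  /-- the second order condition -/
  second_order :
    mfderiv (𝓡 m).tangent (𝓡 m) (fun p : TM m M => p.proj) pt acc = pt.2

/-- The coordinates `ẍ = (ẍⁱ)` of a second order velocity. -/
def Chart.acc (φ : Chart m M) (J : T2M m M) : Coord m :=
  mfderiv (𝓡 m).tangent (𝓡 m) (fun p : TM m M => φ.vel p) J.pt J.acc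

/-- The coordinates `(x, ẋ, ẍ)` of a second order velocity. -/
def Chart.coords (φ : Chart m M) (J : T2M m M) : Coord m × Coord m × Coord m :=
  (φ.pos J.pt, φ.vel J.pt, φ.acc J)

lemma Chart.mdifferentiableAt_tangentInv (φ : Chart m M) {z : Coord m × Coord m}
    (hz : z.1 ∈ φ.img) :
    MDifferentiableAt 𝓘(ℝ, Coord m × Coord m) (𝓡 m).tangent φ.tangentInv z := by
  have h0 : ContMDiffOn (𝓡 m) (𝓡 m) ∞ φ.1.symm φ.img :=
    contMDiffOn_symm_of_mem_maximalAtlas φ.2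
  have hopen : IsOpen φ.img := φ.1.open_target
  have h1 : ContMDiffOn (𝓡 m).tangent (𝓡 m).tangent 1
      (tangentMapWithin (𝓡 m) (𝓡 m) φ.1.symm φ.img)
      ((fun p : TangentBundle (𝓡 m) (Coord m) => p.proj) ⁻¹' φ.img) :=
    h0.contMDiffOn_tangentMapWithin (by norm_cast) hopen.uniqueMDiffOn
  have h2 : ContMDiff 𝓘(ℝ, Coord m × Coord m) (𝓡 m).tangent 1
      (fun z : Coord m × Coord m => (⟨z.1, z.2⟩ : TangentBundle (𝓡 m) (Coord m))) := by
    have := contMDiff_tangentBundleModelSpaceHomeomorph_symm (I := 𝓡 m) (n := 1)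
    rw [modelWithCornersSelf_prod]
    exact this
  have h3 : ContMDiffAt 𝓘(ℝ, Coord m × Coord m) (𝓡 m).tangent 1
      ((tangentMapWithin (𝓡 m) (𝓡 m) φ.1.symm φ.img) ∘
        fun z : Coord m × Coord m => (⟨z.1, z.2⟩ : TangentBundle (𝓡 m) (Coord m))) z := by
    refine ContMDiffAt.comp z (h1.contMDiffAt ?_) h2.contMDiffAt
    refine (hopen.preimage ?_).mem_nhds hz
    exact FiberBundle.continuous_proj (Coord m) (TangentSpace (𝓡 m) : Coord m → Type _)
  refine (h3.mdifferentiableAt one_ne_zero).congr_of_eventuallyEq ?_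
  have hz' : ∀ᶠ y : Coord m × Coord m in 𝓝 z, y.1 ∈ φ.img :=
    (hopen.preimage continuous_fst).mem_nhds hz
  filter_upwards [hz'] with y hy
  simp only [Chart.tangentInv, Function.comp, tangentMapWithin]
  rw [mfderivWithin_of_isOpen hopen hy]

lemma Chart.mfderiv_proj_tangentInv (φ : Chart m M) {x : Coord m} (hx : x ∈ φ.img)
    (v a : Coord m) :
    mfderiv (𝓡 m).tangent (𝓡 m) (fun p : TM m M => p.proj) (φ.tangentInv (x, v))
      (mfderiv 𝓘(ℝ, Coord m × Coord m) (𝓡 m).tangent φ.tangentInv (x, v) (v, a))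
      = (φ.tangentInv (x, v)).2 := by
  have h1 := φ.mdifferentiableAt_tangentInv (z := (x, v)) hx
  have h2 : MDifferentiableAt (𝓡 m).tangent (𝓡 m) (fun p : TM m M => p.proj)
      (φ.tangentInv (x, v)) :=
    (Bundle.contMDiff_proj (TangentSpace (𝓡 m) : M → Type _) (IB := 𝓡 m) (n := 1)
      ).mdifferentiableAt one_ne_zero
  have h3 : MDifferentiableAt (𝓡 m) (𝓡 m) φ.1.symm x :=
    ((contMDiffOn_symm_of_mem_maximalAtlas φ.2).contMDiffAt
      (φ.1.open_target.mem_nhds hx)).mdifferentiableAt (by simp)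
  have h4 := mfderiv_comp (x, v) h2 h1
  have h5 : (fun p : TM m M => p.proj) ∘ φ.tangentInv = φ.1.symm ∘ Prod.fst := rfl
  have h6 : MDifferentiableAt 𝓘(ℝ, Coord m × Coord m) (𝓡 m)
      (Prod.fst : Coord m × Coord m → Coord m) (x, v) :=
    differentiableAt_fst.mdifferentiableAt
  have h7 := mfderiv_comp (x, v) (g := φ.1.symm) h3 h6
  rw [h5, h7] at h4
  have h8 := DFunLike.congr_fun h4 ((v, a) : Coord m × Coord m)
  rw [mfderiv_eq_fderiv, fderiv_fst] at h8
  exact h8.symm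

/-- The second order velocity with given coordinates `(x, ẋ, ẍ) = (x, v, a)`. -/
def Chart.jet (φ : Chart m M) {x : Coord m} (hx : x ∈ φ.img) (v a : Coord m) : T2M m M where
  pt := φ.tangentInv (x, v)
  acc := mfderiv 𝓘(ℝ, Coord m × Coord m) (𝓡 m).tangent φ.tangentInv (x, v) (v, a)
  second_order := φ.mfderiv_proj_tangentInv hx v a

/-! ## Source forms and local variationality -/

variable (m M) in
/-- Horizontal `2`-forms on `ℝ × T²M` with respect to the projection onto `ℝ × M`: at a point
`(t, J)` over `(t, x)` such a form is an alternating form on the tangent space of `ℝ × M` at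
`(t, x)`. -/
abbrev HForm : Type _ :=
  ∀ (t : ℝ) (J : T2M m M),
    TangentSpace (𝓘(ℝ, ℝ).prod (𝓡 m)) ((t, J.pt.proj) : ℝ × M) [⋀^Fin 2]→L[ℝ] ℝ

/-- The covector `dt` on `ℝ × M`. -/
def dtM (q : ℝ × M) : TangentSpace (𝓘(ℝ, ℝ).prod (𝓡 m)) q →L[ℝ] ℝ :=
  dAt (𝓘(ℝ, ℝ).prod (𝓡 m)) (fun q : ℝ × M => q.1) q

/-- The contact form `ωⁱ = dxⁱ - ẋⁱ dt` at `(t, J)`. -/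
def Chart.contact (φ : Chart m M) (i : Fin m) (t : ℝ) (J : T2M m M) :
    TangentSpace (𝓘(ℝ, ℝ).prod (𝓡 m)) ((t, J.pt.proj) : ℝ × M) →L[ℝ] ℝ :=
  dAt (𝓘(ℝ, ℝ).prod (𝓡 m)) (fun q : ℝ × M => φ.1 q.2 i) (t, J.pt.proj)
    - φ.vel J.pt i • dtM (t, J.pt.proj)

open Classical in
/-- The coefficient `εᵢ(x, ẋ, ẍ)` of an autonomous horizontal `2`-form, its value on
`(∂/∂xⁱ, ∂/∂t)`. -/
def HForm.coeff (ε : HForm m M) (φ : Chart m M) (i : Fin m)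
    (z : Coord m × Coord m × Coord m) : ℝ :=
  if hx : z.1 ∈ φ.img then
    ε 0 (φ.jet hx z.2.1 z.2.2)
      ![pairVec (𝓡 m) 0 (φ.1.symm z.1) 0 (φ.vec i z.1), pairVec (𝓡 m) 0 (φ.1.symm z.1) 1 0]
  else 0

variable (m M) in
/-- Smooth autonomous source forms: horizontal `1`-contact `2`-forms on `ℝ × T²M` with an
expression `εᵢ(x, ẋ, ẍ) ωⁱ ∧ dt` in every chart. -/
structure SourceForm where
  /-- the underlying horizontal `2`-form -/
  form : HForm m M
  /-- smoothness of the coefficients -/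
  smooth : ∀ (φ : Chart m M) (i : Fin m),
    ContDiffOn ℝ ∞ (HForm.coeff form φ i) (φ.img ×ˢ Set.univ)
  /-- the local expression -/
  expression : ∀ (φ : Chart m M) (t : ℝ) (J : T2M m M), J.pt.proj ∈ φ.dom →
    form t J = ∑ i, HForm.coeff form φ i (φ.coords J) •
      wedge (φ.contact i t J) (dtM (t, J.pt.proj))

namespace SourceForm

variable (ε : SourceForm m M) (φ : Chart m M)

/-- The coefficients `εᵢ` of a source form in a chart. -/
def coeff (i : Fin m) (z : Coord m × Coord m × Coord m) : ℝ := HForm.coeff ε.form φ i z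

/-- Local variationality: around every point of `M` there is a chart `(V, φ)` and a Lagrange
function on `ℝ × V²` whose Euler-Lagrange expressions are the coefficients of `ε`. -/
def IsLocallyVariational : Prop :=
  ∀ x : M, ∃ φ : Chart m M, x ∈ φ.dom ∧
    ∃ L : ℝ × (Fin 3 → Coord m) → ℝ, ContDiffOn ℝ ∞ L {z | z.2 0 ∈ φ.img} ∧
      ∀ z : ℝ × (Fin 5 → Coord m), z.2 0 ∈ φ.img →
        ∀ i, ε.coeff φ i (z.2 0, z.2 1, z.2 2) = eulerLagrange L i z

/-- The function `Aᵢ(x, ẋ)` in `εᵢ = Aᵢ + Bᵢⱼ ẍʲ`. -/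
def A (i : Fin m) (x v : Coord m) : ℝ := ε.coeff φ i (x, v, 0)

/-- The function `Bᵢⱼ(x, ẋ)` in `εᵢ = Aᵢ + Bᵢⱼ ẍʲ`. -/
def B (i j : Fin m) (x v : Coord m) : ℝ :=
  fderiv ℝ (fun a => ε.coeff φ i (x, v, a)) 0 (stdVec j)

/-- `∂Aᵢ/∂ẋʲ - ∂Aⱼ/∂ẋⁱ` at `(x, v)`. -/
def curlA (i j : Fin m) (x v : Coord m) : ℝ :=
  fderiv ℝ (fun w => ε.A φ i x w) v (stdVec j) - fderiv ℝ (fun w => ε.A φ j x w) v (stdVec i)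

end SourceForm

/-! ## The chart expressions -/

/-- `dxⁱ` on `TM`. -/
def Chart.dx (φ : Chart m M) (i : Fin m) (p : TM m M) : TangentSpace (𝓡 m).tangent p →L[ℝ] ℝ :=
  dAt (𝓡 m).tangent (fun p : TM m M => φ.pos p i) p

/-- `dẋⁱ` on `TM`. -/
def Chart.dv (φ : Chart m M) (i : Fin m) (p : TM m M) : TangentSpace (𝓡 m).tangent p →L[ℝ] ℝ :=
  dAt (𝓡 m).tangent (fun p : TM m M => φ.vel p i) p

variable (m) in
/-- The model of the manifold `ℝ × TM`. -/
abbrev RTMModel : ModelWithCorners ℝ (ℝ × (Coord m × Coord m))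
    (ModelProd ℝ (ModelProd (Coord m) (Coord m))) :=
  𝓘(ℝ, ℝ).prod (𝓡 m).tangent

/-- `dxⁱ` on `ℝ × TM`. -/
def Chart.dxR (φ : Chart m M) (i : Fin m) (q : ℝ × TM m M) : TangentSpace (RTMModel m) q →L[ℝ] ℝ :=
  dAt (RTMModel m) (fun q : ℝ × TM m M => φ.pos q.2 i) q

/-- `dẋⁱ` on `ℝ × TM`. -/
def Chart.dvR (φ : Chart m M) (i : Fin m) (q : ℝ × TM m M) : TangentSpace (RTMModel m) q →L[ℝ] ℝ :=
  dAt (RTMModel m) (fun q : ℝ × TM m M => φ.vel q.2 i) q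

/-- The vector `(0, …, 0, ν, vˡ⁺¹, …, vᵐ)` with `ν` in position `l`. -/
def stair (l : Fin m) (ν : ℝ) (v : Coord m) : Coord m :=
  WithLp.toLp 2 fun k => if k < l then 0 else if k = l then ν else v k

namespace SourceForm

variable (ε : SourceForm m M) (φ : Chart m M)

/-- The chart expression
`ω = ¼ (∂Aᵢ/∂ẋʲ - ∂Aⱼ/∂ẋⁱ)(x, 0) dxⁱ ∧ dxʲ`. -/
def omegaChart (p : TM m M) : TangentSpace (𝓡 m).tangent p [⋀^Fin 2]→L[ℝ] ℝ :=
  ∑ i, ∑ j, (1 / 4 * ε.curlA φ i j (φ.pos p) 0) • wedge (φ.dx i p) (φ.dx j p)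

/-- The chart expression
`κ = - ∑ₗ (∫₀^{ẋˡ} Bⱼₗ(x, 0, …, 0, ν, ẋˡ⁺¹, …, ẋᵐ) dν) dxʲ`. -/
def kappaChart (p : TM m M) : TangentSpace (𝓡 m).tangent p [⋀^Fin 1]→L[ℝ] ℝ :=
  - ∑ l, ∑ j, (∫ ν in (0 : ℝ)..(φ.vel p l), ε.B φ j l (φ.pos p) (stair l ν (φ.vel p))) •
    oneForm (φ.dx j p)

/-- The chart expression
`α' = ¼ (∂Aᵢ/∂ẋʲ - ∂Aⱼ/∂ẋⁱ) dxⁱ ∧ dxʲ + Bᵢⱼ dxⁱ ∧ dẋʲ`. -/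
def alphaPrimeChart (p : TM m M) : TangentSpace (𝓡 m).tangent p [⋀^Fin 2]→L[ℝ] ℝ :=
  ∑ i, ∑ j, ((1 / 4 * ε.curlA φ i j (φ.pos p) (φ.vel p)) • wedge (φ.dx i p) (φ.dx j p)
    + ε.B φ i j (φ.pos p) (φ.vel p) • wedge (φ.dx i p) (φ.dv j p))

/-- The chart expression
`μ₀ = - (Aᵢ - ½ (∂Aᵢ/∂ẋʲ - ∂Aⱼ/∂ẋⁱ) ẋʲ) t dxⁱ - Bᵢⱼ ẋⁱ t dẋʲ` on `ℝ × TM`. -/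
def mu0Chart (q : ℝ × TM m M) : TangentSpace (RTMModel m) q [⋀^Fin 1]→L[ℝ] ℝ :=
  - (∑ i, ((ε.A φ i (φ.pos q.2) (φ.vel q.2)
        - 1 / 2 * ∑ j, ε.curlA φ i j (φ.pos q.2) (φ.vel q.2) * φ.vel q.2 j) * q.1) •
      oneForm (φ.dxR i q))
  - ∑ i, ∑ j, (ε.B φ i j (φ.pos q.2) (φ.vel q.2) * φ.vel q.2 i * q.1) • oneForm (φ.dvR j q)

end SourceForm

/-! ## The Lepage equivalent -/

/-- The horizontal part `hξ = dt(ξ) D_J` of a tangent vector `ξ` of `ℝ × TM` at `(t, J.pt)`, with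
`D_J = (∂/∂t, J) = ∂/∂t + ẋⁱ ∂/∂xⁱ + ẍⁱ ∂/∂ẋⁱ`. -/
def horPart (t : ℝ) (J : T2M m M) (ξ : TangentSpace (RTMModel m) ((t, J.pt) : ℝ × TM m M)) :
    TangentSpace (RTMModel m) ((t, J.pt) : ℝ × TM m M) :=
  (dAt (RTMModel m) (fun q : ℝ × TM m M => q.1) (t, J.pt) ξ) •
    pairVec (𝓡 m).tangent t J.pt 1 J.acc

/-- The `1`-contact component `p₁α` at `(t, J)` of (the pull-back to `ℝ × T²M` of) a `2`-form
`α` on `ℝ × TM`: `p₁α(ξ, η) = α(hξ, η - hη) + α(ξ - hξ, hη)`. -/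
def p1 (α : DForm (RTMModel m) (ℝ × TM m M) 2) (t : ℝ) (J : T2M m M)
    (ξ η : TangentSpace (RTMModel m) ((t, J.pt) : ℝ × TM m M)) : ℝ :=
  α (t, J.pt) ![horPart t J ξ, η - horPart t J η]
    + α (t, J.pt) ![ξ - horPart t J ξ, horPart t J η]

/-- `α` is a Lepage equivalent of `ε`: a smooth closed `2`-form on `ℝ × TM` with `p₁α = ε`. -/
def SourceForm.IsLepageEquivalent (ε : SourceForm m M)
    (α : DForm (RTMModel m) (ℝ × TM m M) 2) : Prop :=
  DForm.IsSmooth α ∧ DForm.d α = 0 ∧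
    ∀ (t : ℝ) (J : T2M m M) (ξ η : TangentSpace (RTMModel m) ((t, J.pt) : ℝ × TM m M)),
      p1 α t J ξ η =
        ε.form t J
          ![mfderiv (RTMModel m) (𝓘(ℝ, ℝ).prod (𝓡 m))
              (fun q : ℝ × TM m M => ((q.1, q.2.proj) : ℝ × M)) (t, J.pt) ξ,
            mfderiv (RTMModel m) (𝓘(ℝ, ℝ).prod (𝓡 m))
              (fun q : ℝ × TM m M => ((q.1, q.2.proj) : ℝ × M)) (t, J.pt) η]

/-- A form on `TM` regarded as a form on `ℝ × TM`, by pull-back along the projection. -/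
def liftForm {k : ℕ} (θ : DForm (𝓡 m).tangent (TM m M) k) :
    DForm (RTMModel m) (ℝ × TM m M) k :=
  DForm.pullback (fun q : ℝ × TM m M => q.2) θ

end VarForms

end

/-! Write `D_a = ∂/∂t + ẋ ∂/∂x + a ∂/∂ẋ`. Over a chart, `p₁α = ε` says that `α(u ∂/∂x, D_a) = εᵢ(x,
ẋ, a) uⁱ` and `α(w ∂/∂ẋ, D_a) = 0` for every acceleration `a` (`SourceForm.hasContactPart_iff`). A
closed `α` with this property is determined by `ε`. Varying `a` shows that `α` vanishes on vertical
pairs, that `ε` is affine in `a`, and that the mixed components of `α` are the `Bᵢⱼ`.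
Differentiating the two conditions along the fibre and using `dα = 0` shows that `B` is symmetric
and that twice the horizontal component is the curl of `A` (`ClosedRep.two_mul_hor_hor`). The
components containing `dt` follow by linearity. This gives uniqueness, and `α` does not depend on
`t` (`ClosedRep.eq_of_closedRep`).

For existence, the Euler-Lagrange expressions of a local Lagrange function `L` contain no velocities
of order three or four. Absence of order four makes `L` affine in `ẍ` (`IsLagrangian.eq_affine`);
absence of order three makes the fibre derivative of the coefficient of `ẍ` symmetric. These two
facts are what is needed for the exterior derivative of the Poincaré-Cartan form to live on `ℝ × TM`
and have contact component `ε` (`IsLagrangian.closedRep`). By uniqueness the local forms agree on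
overlaps, so they glue.

For the decomposition, time independence gives `α = α' + dt ∧ θ` with `θ` the contraction of `α`
with `∂/∂t`; closedness of `α` gives `dα' = 0` and `dθ = 0`, so `dt ∧ θ = d(tθ)`, and `tθ` is `μ₀`.
The form `α'` on `TM` is closed and vanishes on vertical pairs; the homotopy `(x, ẋ) ↦ (x, s ẋ)`
writes it as its pull-back along `TM → M → TM` (projection, then zero section) plus an exact form
(`LagrangianRep.extDeriv_fiberPotential`). The first term is `ω`. The homotopy potential is `κ`: the
mixed components of `α'` are a fibre gradient, so integrating them along a staircase or along a ray
gives the same result (`LagrangianRep.sum_integral_stair`).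

In this form independence of the chart is visible: transition maps of `TM` are linear in the fibres,
hence preserve the zero section and commute with the dilations, and on `ℝ × TM` they preserve `t`
and `∂/∂t`. -/

open scoped Manifold ContDiff Topology

noncomputable section

namespace VarForms

/-! ### Smoothness of maps into spaces of alternating forms -/

section AlternatingSmooth

variable {E F G : Type*} [NormedAddCommGroup E] [NormedSpace ℝ E] [FiniteDimensional ℝ E]
  [NormedAddCommGroup F] [NormedSpace ℝ F] [NormedAddCommGroup G] [NormedSpace ℝ G] {k : ℕ}

/-- On a finite dimensional space, alternating forms are a continuous linear function of finitely
many of their values. -/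
lemma exists_clm_of_values (k : ℕ) : ∃ (n : ℕ) (w : (Fin k → Fin n) → Fin k → E)
    (Λ : ((Fin k → Fin n) → ℝ) →L[ℝ] (E [⋀^Fin k]→L[ℝ] ℝ)),
    ∀ θ : E [⋀^Fin k]→L[ℝ] ℝ, Λ (fun s => θ (w s)) = θ := by
  let b := Module.finBasis ℝ E
  let ev : (E [⋀^Fin k]→L[ℝ] ℝ) →ₗ[ℝ] ((Fin k → Fin (Module.finrank ℝ E)) → ℝ) :=
    { toFun := fun θ s => θ fun i => b (s i)
      map_add' := fun _ _ => rfl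
      map_smul' := fun _ _ => rfl }
  have hinj : LinearMap.ker ev = ⊥ := by
    rw [LinearMap.ker_eq_bot]
    intro θ η h
    apply ContinuousAlternatingMap.toAlternatingMap_injective
    exact Module.Basis.ext_alternating b fun v _ => congrFun h v
  obtain ⟨g, hg⟩ := LinearMap.exists_leftInverse_of_injective ev hinj
  exact ⟨_, fun s i => b (s i), LinearMap.toContinuousLinearMap g,
    fun θ => LinearMap.congr_fun hg θ⟩

/-- A form on a finite dimensional space is a fixed continuous linear function of finitely many of
its values, so smoothness may be tested value by value. -/
lemma contDiffWithinAt_alternating_iff {n : ℕ∞ω} {f : F → E [⋀^Fin k]→L[ℝ] ℝ} {s : Set F} {x : F} :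
    ContDiffWithinAt ℝ n f s x ↔ ∀ v, ContDiffWithinAt ℝ n (fun y => f y v) s x := by
  constructor
  · intro h v
    exact (ContinuousAlternatingMap.apply ℝ E ℝ v).contDiff.comp_contDiffWithinAt h
  · intro h
    obtain ⟨N, w, Λ, hΛ⟩ := exists_clm_of_values (E := E) k
    have : f = fun y => Λ (fun s => f y (w s)) := funext fun y => (hΛ _).symm
    rw [this]
    exact Λ.contDiff.comp_contDiffWithinAt (contDiffWithinAt_pi.2 fun s => h (w s))

lemma contDiffOn_alternating_iff {n : ℕ∞ω} {f : F → E [⋀^Fin k]→L[ℝ] ℝ} {s : Set F} :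
    ContDiffOn ℝ n f s ↔ ∀ v, ContDiffOn ℝ n (fun y => f y v) s :=
  ⟨fun h v y hy => contDiffWithinAt_alternating_iff.1 (h y hy) v,
    fun h y hy => contDiffWithinAt_alternating_iff.2 fun v => h v y hy⟩

/-- The pull-back is linear in the form and polynomial in the linear map: `C` below is the
continuous multilinear map sending a tuple of linear maps to pull-back by that tuple, evaluated on
the diagonal. -/
lemma contDiffAt_compContinuousLinearMap {n : ℕ∞ω} {f : F → G [⋀^Fin k]→L[ℝ] ℝ}
    {g : F → E →L[ℝ] G} {x : F} (hf : ContDiffAt ℝ n f x) (hg : ContDiffAt ℝ n g x) :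
    ContDiffAt ℝ n (fun y => (f y).compContinuousLinearMap (g y)) x := by
  refine contDiffWithinAt_alternating_iff.2 fun v => ?_
  let C := ContinuousMultilinearMap.compContinuousLinearMapContinuousMultilinear ℝ
    (fun _ : Fin k => E) (fun _ => G) ℝ
  have hC : ContDiff ℝ n (fun G => C G) :=
    ContinuousMultilinearMap.contDiff (𝕜 := ℝ) (E := fun _ : Fin k => E →L[ℝ] G)
      (F := (ContinuousMultilinearMap ℝ (fun _ : Fin k => G) ℝ) →L[ℝ]
        ContinuousMultilinearMap ℝ (fun _ : Fin k => E) ℝ) C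
  have h1 : ContDiffAt ℝ n (fun y => C (fun _ => g y)) x :=
    hC.contDiffAt.comp x (contDiffAt_pi.2 fun _ => hg)
  have h2 : ContDiffAt ℝ n (fun y => (f y).toContinuousMultilinearMap) x :=
    ContDiffAt.comp (g := fun a : G [⋀^Fin k]→L[ℝ] ℝ => a.toContinuousMultilinearMap) x
      (ContinuousAlternatingMap.toContinuousMultilinearMapCLM (𝕜 := ℝ) (E := G) (F := ℝ)
        (ι := Fin k) ℝ).contDiff.contDiffAt hf
  exact (ContinuousMultilinearMap.apply ℝ (fun _ : Fin k => E) ℝ v).contDiff.contDiffAt.comp x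
    (h1.clm_apply h2)

end AlternatingSmooth

/-! ### Coordinate systems, coordinate expressions of forms, change of coordinates -/

section Coordinates

variable {E : Type*} [NormedAddCommGroup E] [NormedSpace ℝ E]
  {H : Type*} [TopologicalSpace H] (I : ModelWithCorners ℝ E H)
  (N : Type*) [TopologicalSpace N] [ChartedSpace H N]

/-- A smooth local coordinate system with values in the model vector space. -/
structure SmoothCoord extends PartialEquiv N E where
  open_source : IsOpen source
  open_target : IsOpen target
  smooth : ContMDiffOn I 𝓘(ℝ, E) ∞ toFun source
  smooth_symm : ContMDiffOn 𝓘(ℝ, E) I ∞ invFun target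

variable {I N}

/-- The preferred coordinates at a point of a manifold without boundary. -/
def extCoord [I.Boundaryless] [IsManifold I ∞ N] (p : N) : SmoothCoord I N where
  toPartialEquiv := extChartAt I p
  open_source := isOpen_extChartAt_source p
  open_target := isOpen_extChartAt_target p
  smooth := by rw [extChartAt_source]; exact contMDiffOn_extChartAt
  smooth_symm := contMDiffOn_extChartAt_symm p

namespace SmoothCoord

variable (c c' : SmoothCoord I N) {k : ℕ}

lemma contMDiffAt {p : N} (hp : p ∈ c.source) : ContMDiffAt I 𝓘(ℝ, E) ∞ c.toFun p :=
  c.smooth.contMDiffAt (c.open_source.mem_nhds hp)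

lemma contMDiffAt_symm {y : E} (hy : y ∈ c.target) : ContMDiffAt 𝓘(ℝ, E) I ∞ c.invFun y :=
  c.smooth_symm.contMDiffAt (c.open_target.mem_nhds hy)

lemma mdiffAt {p : N} (hp : p ∈ c.source) : MDifferentiableAt I 𝓘(ℝ, E) c.toFun p :=
  (c.contMDiffAt hp).mdifferentiableAt (by simp)

lemma mdiffAt_symm {y : E} (hy : y ∈ c.target) : MDifferentiableAt 𝓘(ℝ, E) I c.invFun y :=
  (c.contMDiffAt_symm hy).mdifferentiableAt (by simp)

lemma invFun_mem {y : E} (hy : y ∈ c.target) : c.invFun y ∈ c.source := c.map_target' hy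

lemma invFun_toFun {p : N} (hp : p ∈ c.source) : c.invFun (c.toFun p) = p := c.left_inv' hp

lemma toFun_invFun {y : E} (hy : y ∈ c.target) : c.toFun (c.invFun y) = y := c.right_inv' hy

/-- The inverse coordinate map, as a linear map of the tangent spaces. -/
def frame (y : E) : E →L[ℝ] TangentSpace I (c.invFun y) := mfderiv 𝓘(ℝ, E) I c.invFun y

/-- The differential of the coordinate map. -/
def coframe (p : N) : TangentSpace I p →L[ℝ] E := mfderiv I 𝓘(ℝ, E) c.toFun p

lemma coframe_comp_frame {y : E} (hy : y ∈ c.target) :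
    (c.coframe (c.invFun y)).comp (c.frame y) = ContinuousLinearMap.id ℝ E := by
  have h := mfderiv_comp y (c.mdiffAt (c.invFun_mem hy)) (c.mdiffAt_symm hy)
  have h2 : (c.toFun ∘ c.invFun) =ᶠ[𝓝 y] id := by
    filter_upwards [c.open_target.mem_nhds hy] with z hz using c.toFun_invFun hz
  rw [h2.mfderiv_eq, mfderiv_id] at h
  exact h.symm

lemma frame_comp_coframe {p : N} (hp : p ∈ c.source) (ξ : TangentSpace I p) :
    (mfderiv 𝓘(ℝ, E) I c.invFun (c.toFun p) (c.coframe p ξ) : E) = ξ := by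
  have hy : c.toFun p ∈ c.target := c.map_source' hp
  have h := mfderiv_comp p (g := c.invFun) (c.mdiffAt_symm hy) (c.mdiffAt hp)
  have h2 : (c.invFun ∘ c.toFun) =ᶠ[𝓝 p] id := by
    filter_upwards [c.open_source.mem_nhds hp] with z hz using c.invFun_toFun hz
  rw [h2.mfderiv_eq, mfderiv_id] at h
  exact (DFunLike.congr_fun h ξ).symm

lemma coframe_frame {y : E} (hy : y ∈ c.target) (u : E) :
    c.coframe (c.invFun y) (c.frame y u) = u :=
  DFunLike.congr_fun (c.coframe_comp_frame hy) u

lemma frame_coframe {y : E} (hy : y ∈ c.target) (ξ : TangentSpace I (c.invFun y)) :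
    c.frame y (c.coframe (c.invFun y) ξ) = ξ := by
  have h := c.frame_comp_coframe (c.invFun_mem hy) ξ
  rw [c.toFun_invFun hy] at h
  exact h

/-- The expression of a differential form in the coordinates `c`. -/
def rep (θ : DForm I N k) (y : E) : E [⋀^Fin k]→L[ℝ] ℝ :=
  (θ (c.invFun y)).compContinuousLinearMap (c.frame y)

/-- The differential form with a given expression in the coordinates `c`. -/
def lift (a : E → E [⋀^Fin k]→L[ℝ] ℝ) : DForm I N k := fun p =>
  (a (c.toFun p)).compContinuousLinearMap (c.coframe p)

lemma rep_add (θ η : DForm I N k) (y : E) : c.rep (θ + η) y = c.rep θ y + c.rep η y := rfl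

lemma rep_lift (a : E → E [⋀^Fin k]→L[ℝ] ℝ) {y : E} (hy : y ∈ c.target) :
    c.rep (c.lift a) y = a y := by
  ext v
  change a (c.toFun (c.invFun y)) (fun i => c.coframe (c.invFun y) (c.frame y (v i))) = a y v
  simp_rw [c.coframe_frame hy, c.toFun_invFun hy]

lemma lift_rep (θ : DForm I N k) {p : N} (hp : p ∈ c.source) : c.lift (c.rep θ) p = θ p := by
  ext v
  change θ (c.invFun (c.toFun p)) (fun i => mfderiv 𝓘(ℝ, E) I c.invFun (c.toFun p)
    (c.coframe p (v i))) = θ p v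
  -- The point `c.invFun (c.toFun p)` equals `p` only propositionally, but every tangent space is
  -- the model space `E`, so values of `θ` can be compared on the same vectors of `E`.
  have h : ∀ (q : N) (hq : q = p) (w : Fin k → E), (θ q : E [⋀^Fin k]→L[ℝ] ℝ) w
    = (θ p : E [⋀^Fin k]→L[ℝ] ℝ) w := by rintro q rfl w; rfl
  refine (h _ (c.invFun_toFun hp) _).trans (congrArg (θ p) ?_)
  funext i
  exact c.frame_comp_coframe hp (v i)

lemma eq_of_rep_eq {θ η : DForm I N k} {p : N} (hp : p ∈ c.source)
    (h : c.rep θ (c.toFun p) = c.rep η (c.toFun p)) : θ p = η p := by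
  rw [← c.lift_rep θ hp, ← c.lift_rep η hp, lift, lift, h]

/-- The domain of the change of coordinates from `c` to `c'`. -/
def overlap : Set E := c.target ∩ c.invFun ⁻¹' c'.source

lemma isOpen_overlap : IsOpen (c.overlap c') :=
  c.smooth_symm.continuousOn.isOpen_inter_preimage c.open_target c'.open_source

lemma toFun_mem_overlap {p : N} (hp : p ∈ c.source) (hp' : p ∈ c'.source) :
    c.toFun p ∈ c.overlap c' :=
  ⟨c.map_source' hp, by
    change c.invFun (c.toFun p) ∈ c'.source; rw [c.invFun_toFun hp]; exact hp'⟩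

/-- The change of coordinates from `c` to `c'`. -/
def trans (y : E) : E := c'.toFun (c.invFun y)

lemma contDiffAt_trans {y : E} (hy : y ∈ c.overlap c') : ContDiffAt ℝ ∞ (c.trans c') y :=
  ((c'.contMDiffAt hy.2).comp y (c.contMDiffAt_symm hy.1)).contDiffAt

lemma fderiv_trans {y : E} (hy : y ∈ c.overlap c') :
    fderiv ℝ (c.trans c') y = (c'.coframe (c.invFun y)).comp (c.frame y) := by
  rw [← mfderiv_eq_fderiv]
  exact mfderiv_comp y (c'.mdiffAt hy.2) (c.mdiffAt_symm hy.1)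

lemma rep_eq_pullback (θ : DForm I N k) {y : E} (hy : y ∈ c.overlap c') :
    c.rep θ y = (c'.rep θ (c.trans c' y)).compContinuousLinearMap (fderiv ℝ (c.trans c') y) := by
  rw [c.fderiv_trans c' hy]
  have h := c'.lift_rep θ hy.2
  rw [rep, ← h]
  rfl

/-- Smoothness may be checked near each point in any coordinates available there, because
expressions are related by pull-back along smooth transition maps. -/
lemma contDiffOn_rep_of {θ : DForm I N k} [FiniteDimensional ℝ E]
    (h : ∀ p ∈ c.source, ∃ c' : SmoothCoord I N, p ∈ c'.source ∧
      ContDiffAt ℝ ∞ (c'.rep θ) (c'.toFun p)) : ContDiffOn ℝ ∞ (c.rep θ) c.target := by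
  intro y hy
  refine ContDiffAt.contDiffWithinAt ?_
  obtain ⟨c', hp, h'⟩ := h (c.invFun y) (c.invFun_mem hy)
  have hy' : y ∈ c.overlap c' := ⟨hy, hp⟩
  have ht := c.contDiffAt_trans c' hy'
  have h1 : ContDiffAt ℝ ∞ (fun z => (c'.rep θ (c.trans c' z)).compContinuousLinearMap
      (fderiv ℝ (c.trans c') z)) y :=
    contDiffAt_compContinuousLinearMap (ContDiffAt.comp (g := c'.rep θ) y h' ht)
      (ht.fderiv_right (by simp))
  refine h1.congr_of_eventuallyEq ?_
  filter_upwards [(c.isOpen_overlap c').mem_nhds hy'] with z hz using c.rep_eq_pullback c' θ hz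

variable [I.Boundaryless] [IsManifold I ∞ N]

lemma localRep_eq (θ : DForm I N k) (p : N) : DForm.localRep θ p = (extCoord p).rep θ := by
  funext y
  rw [DForm.localRep, I.range_eq_univ, mfderivWithin_univ]
  rfl

lemma mem_extCoord (p : N) : p ∈ (extCoord (I := I) p).toPartialEquiv.source :=
  mem_extChartAt_source p

lemma isSmooth_of [FiniteDimensional ℝ E] {θ : DForm I N k}
    (h : ∀ p : N, ∃ c : SmoothCoord I N, p ∈ c.source ∧
      ContDiffAt ℝ ∞ (c.rep θ) (c.toFun p)) : θ.IsSmooth := by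
  intro p
  rw [localRep_eq]
  exact (extCoord p).contDiffOn_rep_of fun q _ => h q

lemma _root_.VarForms.DForm.IsSmooth.contDiffOn_rep [FiniteDimensional ℝ E] {θ : DForm I N k}
    (h : θ.IsSmooth) (c : SmoothCoord I N) : ContDiffOn ℝ ∞ (c.rep θ) c.target :=
  c.contDiffOn_rep_of fun p _ => ⟨extCoord p, mem_extCoord p, by
    rw [← localRep_eq]
    exact (h p).contDiffAt ((extCoord p).open_target.mem_nhds
      ((extCoord p).map_source' (mem_extCoord p)))⟩

/-- The exterior derivative may be computed in arbitrary coordinates. -/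
lemma rep_d (θ : DForm I N k) {y : E} (hy : y ∈ c.target)
    (hθ : DifferentiableAt ℝ (c.rep θ) y) : c.rep θ.d y = extDeriv (c.rep θ) y := by
  set q := c.invFun y with hq
  let e : SmoothCoord I N := extCoord q
  have hqe : q ∈ e.toPartialEquiv.source := mem_extCoord (I := I) q
  have hqt : e.toFun q ∈ e.target := e.map_source' hqe
  have hqi : e.invFun (e.toFun q) = q := e.invFun_toFun hqe
  have hov : e.toFun q ∈ e.overlap c := ⟨hqt, by
    change e.invFun (e.toFun q) ∈ c.source; rw [hqi]; exact c.invFun_mem hy⟩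
  have htr : e.trans c (e.toFun q) = y := by
    rw [trans, hqi]; exact c.toFun_invFun hy
  -- The derivative `θ.d` is defined at `q` by the preferred coordinates `e`; naturality of the
  -- exterior derivative under the transition from `e` to `c` carries it over.
  have h1 : extDeriv (e.rep θ) (e.toFun q) =
      (extDeriv (c.rep θ) (e.trans c (e.toFun q))).compContinuousLinearMap
        (fderiv ℝ (e.trans c) (e.toFun q)) := by
    rw [← extDeriv_pullback (r := ∞) (by rw [htr]; exact hθ) (e.contDiffAt_trans c hov)
      (by simp only [minSmoothness_of_isRCLikeNormedField]; exact WithTop.coe_le_coe.2 le_top)]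
    apply Filter.EventuallyEq.extDeriv_eq
    filter_upwards [(e.isOpen_overlap c).mem_nhds hov] with z hz using e.rep_eq_pullback c θ hz
  have h2 : θ.d q = e.lift (extDeriv (e.rep θ)) q := by
    rw [DForm.d, localRep_eq, I.range_eq_univ, extDerivWithin_univ]
    rfl
  have hoc : y ∈ c.overlap e := ⟨hy, hqe⟩
  have h3 : c.rep θ.d y = (extDeriv (e.rep θ) (e.toFun q)).compContinuousLinearMap
      (fderiv ℝ (c.trans e) y) := by
    rw [c.fderiv_trans e hoc, rep, ← hq, h2]
    rfl
  -- The two transition maps are mutually inverse near `y`, so by the chain rule the two pull-backs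
  -- accumulated in `h3` and `h1` cancel.
  have h4 : (e.trans c) ∘ (c.trans e) =ᶠ[𝓝 y] id := by
    filter_upwards [(c.isOpen_overlap e).mem_nhds hoc] with z hz
    change c.toFun (e.invFun (e.toFun (c.invFun z))) = z
    rw [e.invFun_toFun hz.2, c.toFun_invFun hz.1]
  have h5 := fderiv_comp y (g := e.trans c) (f := c.trans e)
    ((e.contDiffAt_trans c hov).differentiableAt (by simp))
    ((c.contDiffAt_trans e hoc).differentiableAt (by simp))
  rw [h4.fderiv_eq, fderiv_id] at h5
  rw [h3, h1, htr]
  ext v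
  simp only [ContinuousAlternatingMap.compContinuousLinearMap_apply]
  congr 1
  funext i
  exact (DFunLike.congr_fun h5 (v i)).symm

end SmoothCoord

end Coordinates

/-! ### Differentials of functions in coordinates, and coordinates on `ℝ × N` -/

namespace SmoothCoord

variable {E : Type*} [NormedAddCommGroup E] [NormedSpace ℝ E]
  {H : Type*} [TopologicalSpace H] {I : ModelWithCorners ℝ E H}
  {N : Type*} [TopologicalSpace N] [ChartedSpace H N] (c : SmoothCoord I N)

/-- Chain rule, with `coframe` and `frame` cancelling. It evaluates `dt`, `dxⁱ`, `dẋⁱ` on coordinate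
vectors, where `g` is a linear projection. -/
lemma mfderiv_frame {F : Type*} [NormedAddCommGroup F] [NormedSpace ℝ F] {f : N → F} {g : E → F}
    (hfg : ∀ p ∈ c.source, f p = g (c.toFun p)) {y : E} (hy : y ∈ c.target)
    (hg : DifferentiableAt ℝ g y) (u : E) :
    mfderiv I 𝓘(ℝ, F) f (c.invFun y) (c.frame y u) = fderiv ℝ g y u := by
  have hc := c.mdiffAt (c.invFun_mem hy)
  have hg' : MDifferentiableAt 𝓘(ℝ, E) 𝓘(ℝ, F) g (c.toFun (c.invFun y)) := by
    rw [c.toFun_invFun hy]; exact hg.mdifferentiableAt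
  have h1 : f =ᶠ[𝓝 (c.invFun y)] g ∘ c.toFun := by
    filter_upwards [c.open_source.mem_nhds (c.invFun_mem hy)] with p hp using hfg p hp
  have h2 := mfderiv_comp (c.invFun y) hg' hc
  rw [h1.mfderiv_eq, h2]
  change mfderiv 𝓘(ℝ, E) 𝓘(ℝ, F) g (c.toFun (c.invFun y)) (c.coframe _ (c.frame y u)) = _
  rw [c.coframe_frame hy, c.toFun_invFun hy, mfderiv_eq_fderiv]
  rfl

lemma dAt_frame {f : N → ℝ} {g : E → ℝ} (hfg : ∀ p ∈ c.source, f p = g (c.toFun p)) {y : E}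
    (hy : y ∈ c.target) (hg : DifferentiableAt ℝ g y) (u : E) :
    dAt I f (c.invFun y) (c.frame y u) = fderiv ℝ g y u :=
  c.mfderiv_frame hfg hy hg u

/-- The coordinates on `ℝ × N` induced by coordinates on `N`. -/
def prodReal : SmoothCoord (𝓘(ℝ, ℝ).prod I) (ℝ × N) where
  toFun q := (q.1, c.toFun q.2)
  invFun z := (z.1, c.invFun z.2)
  source := Prod.snd ⁻¹' c.source
  target := Prod.snd ⁻¹' c.target
  map_source' _ := fun hq => c.map_source' hq
  map_target' _ := fun hz => c.map_target' hz
  left_inv' _ hq := Prod.ext rfl (c.left_inv' hq)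
  right_inv' _ hz := Prod.ext rfl (c.right_inv' hz)
  open_source := c.open_source.preimage continuous_snd
  open_target := c.open_target.preimage continuous_snd
  smooth := contMDiff_fst.contMDiffOn.prodMk_space
    (c.smooth.comp contMDiff_snd.contMDiffOn fun _ h => h)
  smooth_symm := ContMDiffOn.prodMk contDiff_fst.contMDiff.contMDiffOn
    (c.smooth_symm.comp contDiff_snd.contMDiff.contMDiffOn fun _ h => h)

lemma prodReal_frame {z : ℝ × E} (hz : z.2 ∈ c.target) (w : ℝ × E) :
    c.prodReal.frame z w = pairVec I z.1 (c.invFun z.2) w.1 (c.frame z.2 w.2) := by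
  have h1 : MDifferentiableAt 𝓘(ℝ, ℝ × E) 𝓘(ℝ, ℝ) (fun z : ℝ × E => z.1) z :=
    differentiableAt_fst.mdifferentiableAt
  have h2 : MDifferentiableAt 𝓘(ℝ, ℝ × E) 𝓘(ℝ, E) (fun z : ℝ × E => z.2) z :=
    differentiableAt_snd.mdifferentiableAt
  have h3 : MDifferentiableAt 𝓘(ℝ, ℝ × E) I (c.invFun ∘ fun z : ℝ × E => z.2) z :=
    (c.mdiffAt_symm hz).comp z h2
  have h4 := mfderiv_prodMk h1 h3
  have h5 := mfderiv_comp z (c.mdiffAt_symm hz) h2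
  rw [h5, mfderiv_eq_fderiv, mfderiv_eq_fderiv] at h4
  have h6 := DFunLike.congr_fun h4 w
  rw [show fderiv ℝ (fun z : ℝ × E => z.1) z = _ from fderiv_fst,
    show fderiv ℝ (fun z : ℝ × E => z.2) z = _ from fderiv_snd] at h6
  exact h6

end SmoothCoord

/-! ### Charts of `M`, `TM` and `ℝ × TM` as coordinate systems -/

variable {m : ℕ} {M : Type*} [TopologicalSpace M] [ChartedSpace (Coord m) M]

/-- A chart of `M` as a coordinate system. -/
def Chart.base (φ : Chart m M) : SmoothCoord (𝓡 m) M where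
  toPartialEquiv := φ.1.toPartialEquiv
  open_source := φ.1.open_source
  open_target := φ.1.open_target
  smooth := contMDiffOn_of_mem_maximalAtlas φ.2
  smooth_symm := contMDiffOn_symm_of_mem_maximalAtlas φ.2

variable [IsManifold (𝓡 m) ∞ M] (φ : Chart m M)

omit [IsManifold (𝓡 m) ∞ M] in
lemma tangent_mk_eq {p q : M} (h : p = q) (v : Coord m) :
    (⟨p, (v : TangentSpace (𝓡 m) p)⟩ : TM m M) = ⟨q, (v : TangentSpace (𝓡 m) q)⟩ := by
  subst h; rfl

omit [IsManifold (𝓡 m) ∞ M] in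
lemma Chart.tangentInv_left {p : TM m M} (hp : p.proj ∈ φ.dom) :
    φ.tangentInv (φ.pos p, φ.vel p) = p := by
  have h := φ.base.frame_comp_coframe hp p.2
  have h2 : φ.1.symm (φ.1 p.proj) = p.proj := φ.1.left_inv hp
  calc φ.tangentInv (φ.pos p, φ.vel p)
      = (⟨φ.1.symm (φ.1 p.proj), (p.2 : Coord m)⟩ : TM m M) := by
        rw [Chart.tangentInv]; congr 1
    _ = p := tangent_mk_eq h2 p.2

omit [IsManifold (𝓡 m) ∞ M] in
lemma Chart.tangentInv_pos {z : Coord m × Coord m} (hz : z.1 ∈ φ.img) :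
    φ.pos (φ.tangentInv z) = z.1 := φ.1.right_inv hz

omit [IsManifold (𝓡 m) ∞ M] in
lemma Chart.tangentInv_vel {z : Coord m × Coord m} (hz : z.1 ∈ φ.img) :
    φ.vel (φ.tangentInv z) = z.2 := φ.base.coframe_frame hz z.2

/-- The coordinates `(x, ẋ)` are the tangent map of the chart, followed by the identification of the
tangent bundle of `ℝ^m` with a product. -/
lemma Chart.contMDiffOn_pos_vel : ContMDiffOn (𝓡 m).tangent 𝓘(ℝ, Coord m × Coord m) ∞
    (fun p : TM m M => (φ.pos p, φ.vel p)) (Bundle.TotalSpace.proj ⁻¹' φ.dom) := by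
  have h0 : ContMDiffOn (𝓡 m) (𝓡 m) ∞ φ.1 φ.dom := contMDiffOn_of_mem_maximalAtlas φ.2
  have h1 : ContMDiffOn (𝓡 m).tangent (𝓡 m).tangent ∞ (tangentMapWithin (𝓡 m) (𝓡 m) φ.1 φ.dom)
      (Bundle.TotalSpace.proj ⁻¹' φ.dom) :=
    h0.contMDiffOn_tangentMapWithin (by simp) φ.1.open_source.uniqueMDiffOn
  have h2 : ContMDiff (𝓡 m).tangent 𝓘(ℝ, Coord m × Coord m) ∞
      (fun p : TangentBundle (𝓡 m) (Coord m) => ((p.1, p.2) : Coord m × Coord m)) := by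
    have := contMDiff_tangentBundleModelSpaceHomeomorph (I := 𝓡 m) (n := ∞)
    rw [modelWithCornersSelf_prod]
    exact this
  refine (h2.comp_contMDiffOn h1).congr fun p hp => ?_
  simp only [Function.comp, tangentMapWithin]
  rw [mfderivWithin_of_isOpen φ.1.open_source hp]
  rfl

lemma Chart.contMDiffOn_tangentInv : ContMDiffOn 𝓘(ℝ, Coord m × Coord m) (𝓡 m).tangent ∞
    φ.tangentInv (Prod.fst ⁻¹' φ.img) := by
  have h0 : ContMDiffOn (𝓡 m) (𝓡 m) ∞ φ.1.symm φ.img :=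
    contMDiffOn_symm_of_mem_maximalAtlas φ.2
  have hopen : IsOpen φ.img := φ.1.open_target
  have h1 : ContMDiffOn (𝓡 m).tangent (𝓡 m).tangent ∞
      (tangentMapWithin (𝓡 m) (𝓡 m) φ.1.symm φ.img) (Bundle.TotalSpace.proj ⁻¹' φ.img) :=
    h0.contMDiffOn_tangentMapWithin (by simp) hopen.uniqueMDiffOn
  have h2 : ContMDiff 𝓘(ℝ, Coord m × Coord m) (𝓡 m).tangent ∞
      (fun z : Coord m × Coord m => (⟨z.1, z.2⟩ : TangentBundle (𝓡 m) (Coord m))) := by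
    have := contMDiff_tangentBundleModelSpaceHomeomorph_symm (I := 𝓡 m) (n := ∞)
    rw [modelWithCornersSelf_prod]
    exact this
  refine (h1.comp h2.contMDiffOn fun _ h => h).congr fun z hz => ?_
  simp only [Chart.tangentInv, Function.comp, tangentMapWithin]
  rw [mfderivWithin_of_isOpen hopen hz]

/-- The coordinates `(x, ẋ)` of `TM`. -/
def Chart.tangent : SmoothCoord (𝓡 m).tangent (TM m M) where
  toFun p := (φ.pos p, φ.vel p)
  invFun := φ.tangentInv
  source := Bundle.TotalSpace.proj ⁻¹' φ.dom
  target := Prod.fst ⁻¹' φ.img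
  map_source' _ hp := φ.1.map_source hp
  map_target' _ hz := φ.1.map_target hz
  left_inv' _ hp := φ.tangentInv_left hp
  right_inv' _ hz := Prod.ext (φ.tangentInv_pos hz) (φ.tangentInv_vel hz)
  open_source := φ.1.open_source.preimage
    (FiberBundle.continuous_proj (Coord m) (TangentSpace (𝓡 m) : M → Type _))
  open_target := φ.1.open_target.preimage continuous_fst
  smooth := φ.contMDiffOn_pos_vel
  smooth_symm := φ.contMDiffOn_tangentInv

/-- The coordinates `(t, x, ẋ)` of `ℝ × TM`. -/
def Chart.evolution : SmoothCoord (RTMModel m) (ℝ × TM m M) := φ.tangent.prodReal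

lemma fderiv_coordinate {F : Type*} [NormedAddCommGroup F] [NormedSpace ℝ F]
    (ℓ : F →L[ℝ] Coord m) (i : Fin m) (y w : F) : fderiv ℝ (fun y => ℓ y i) y w = ℓ w i := by
  have : (fun y => ℓ y i) = ⇑((EuclideanSpace.proj i : Coord m →L[ℝ] ℝ).comp ℓ) := rfl
  rw [this, ContinuousLinearMap.fderiv]
  rfl

lemma differentiable_coordinate {F : Type*} [NormedAddCommGroup F] [NormedSpace ℝ F]
    (ℓ : F →L[ℝ] Coord m) (i : Fin m) : Differentiable ℝ (fun y => ℓ y i) :=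
  ((EuclideanSpace.proj i : Coord m →L[ℝ] ℝ).comp ℓ).differentiable

lemma Chart.dx_frame (i : Fin m) {y : Coord m × Coord m} (hy : y.1 ∈ φ.img)
    (w : Coord m × Coord m) : φ.dx i (φ.tangentInv y) (φ.tangent.frame y w) = w.1 i :=
  (φ.tangent.dAt_frame (g := fun y => y.1 i) (fun _ _ => rfl) hy
    (differentiable_coordinate (.fst ℝ _ _) i y) w).trans
    (fderiv_coordinate (.fst ℝ _ _) i y w)

lemma Chart.dv_frame (i : Fin m) {y : Coord m × Coord m} (hy : y.1 ∈ φ.img)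
    (w : Coord m × Coord m) : φ.dv i (φ.tangentInv y) (φ.tangent.frame y w) = w.2 i :=
  (φ.tangent.dAt_frame (g := fun y => y.2 i) (fun _ _ => rfl) hy
    (differentiable_coordinate (.snd ℝ _ _) i y) w).trans
    (fderiv_coordinate (.snd ℝ _ _) i y w)

lemma Chart.dxR_frame (i : Fin m) {y : ℝ × Coord m × Coord m} (hy : y.2.1 ∈ φ.img)
    (w : ℝ × Coord m × Coord m) :
    φ.dxR i (φ.evolution.invFun y) (φ.evolution.frame y w) = w.2.1 i :=
  (φ.evolution.dAt_frame (g := fun y => y.2.1 i) (fun _ _ => rfl) hy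
    (differentiable_coordinate ((ContinuousLinearMap.fst ℝ (Coord m) (Coord m)).comp
      (.snd ℝ ℝ (Coord m × Coord m))) i y) w).trans
    (fderiv_coordinate ((ContinuousLinearMap.fst ℝ (Coord m) (Coord m)).comp
      (.snd ℝ ℝ (Coord m × Coord m))) i y w)

lemma Chart.dvR_frame (i : Fin m) {y : ℝ × Coord m × Coord m} (hy : y.2.1 ∈ φ.img)
    (w : ℝ × Coord m × Coord m) :
    φ.dvR i (φ.evolution.invFun y) (φ.evolution.frame y w) = w.2.2 i :=
  (φ.evolution.dAt_frame (g := fun y => y.2.2 i) (fun _ _ => rfl) hy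
    (differentiable_coordinate ((ContinuousLinearMap.snd ℝ (Coord m) (Coord m)).comp
      (.snd ℝ ℝ (Coord m × Coord m))) i y) w).trans
    (fderiv_coordinate ((ContinuousLinearMap.snd ℝ (Coord m) (Coord m)).comp
      (.snd ℝ ℝ (Coord m × Coord m))) i y w)

lemma Chart.dt_frame {y : ℝ × Coord m × Coord m} (hy : y.2.1 ∈ φ.img)
    (w : ℝ × Coord m × Coord m) :
    dAt (RTMModel m) (fun q : ℝ × TM m M => q.1) (φ.evolution.invFun y) (φ.evolution.frame y w)
      = w.1 :=
  (φ.evolution.dAt_frame (g := fun y => y.1) (fun _ _ => rfl) hy differentiableAt_fst w).trans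
    (DFunLike.congr_fun fderiv_fst w)

lemma rep_liftForm {k : ℕ} (θ : DForm (𝓡 m).tangent (TM m M) k) {y : ℝ × Coord m × Coord m}
    (hy : y.2.1 ∈ φ.img) : φ.evolution.rep (liftForm θ) y =
      (φ.tangent.rep θ y.2).compContinuousLinearMap (.snd ℝ ℝ (Coord m × Coord m)) := by
  ext w
  change θ (φ.tangentInv y.2) (fun i => mfderiv (RTMModel m) (𝓡 m).tangent
    (fun q : ℝ × TM m M => q.2) (φ.evolution.invFun y) (φ.evolution.frame y (w i))) =
    θ (φ.tangentInv y.2) (fun i => φ.tangent.frame y.2 (w i).2)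
  congr 1
  funext i
  have h1 : mfderiv (RTMModel m) (𝓡 m).tangent (fun q : ℝ × TM m M => q.2) (φ.evolution.invFun y)
    = _ := mfderiv_snd
  rw [h1, Chart.evolution, φ.tangent.prodReal_frame hy]
  rfl

/-! ### Two-forms evaluated on pairs of vectors -/

section Pairs

variable {V : Type*} [AddCommGroup V] [Module ℝ V] [TopologicalSpace V]

omit [AddCommGroup V] [Module ℝ V] [TopologicalSpace V] in
lemma vec_update_zero (u v w : V) : Function.update ![u, w] 0 v = ![v, w] := by
  funext i; fin_cases i <;> rfl

omit [AddCommGroup V] [Module ℝ V] [TopologicalSpace V] in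
lemma vec_update_one (u v w : V) : Function.update ![u, w] 1 v = ![u, v] := by
  funext i; fin_cases i <;> rfl

variable (a : V [⋀^Fin 2]→L[ℝ] ℝ)

lemma alt_add_left (u u' w : V) : a ![u + u', w] = a ![u, w] + a ![u', w] := by
  have := a.map_update_add ![0, w] 0 u u'
  rwa [vec_update_zero, vec_update_zero, vec_update_zero] at this

lemma alt_smul_left (r : ℝ) (u w : V) : a ![r • u, w] = r * a ![u, w] := by
  have := a.map_update_smul ![0, w] 0 r u
  rwa [vec_update_zero, vec_update_zero] at this

lemma alt_self (u : V) : a ![u, u] = 0 :=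
  a.map_eq_zero_of_eq ![u, u] (i := 0) (j := 1) rfl (by simp)

lemma alt_add_right (u w w' : V) : a ![u, w + w'] = a ![u, w] + a ![u, w'] := by
  have := a.map_update_add ![u, 0] 1 w w'
  rwa [vec_update_one, vec_update_one, vec_update_one] at this

lemma alt_smul_right (r : ℝ) (u w : V) : a ![u, r • w] = r * a ![u, w] := by
  have := a.map_update_smul ![u, 0] 1 r w
  rwa [vec_update_one, vec_update_one] at this

lemma alt_swap (u w : V) : a ![u, w] = -a ![w, u] := by
  have h := alt_self a (u + w)
  rw [alt_add_left, alt_add_right, alt_add_right, alt_self, alt_self] at h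
  linarith

lemma alt_sub_left (u u' w : V) : a ![u - u', w] = a ![u, w] - a ![u', w] := by
  have h := alt_add_left a (u - u') u' w
  rw [sub_add_cancel] at h
  linarith

lemma alt_sub_right (u w w' : V) : a ![u, w - w'] = a ![u, w] - a ![u, w'] := by
  have h := alt_add_right a u (w - w') w'
  rw [sub_add_cancel] at h
  linarith

lemma sum_smul_wedge_apply {ι : Type*} [Fintype ι] (r : ι → ℝ) (f : ι → V →L[ℝ] ℝ) (g : V →L[ℝ] ℝ)
    (v : Fin 2 → V) : (∑ i, r i • wedge (f i) g) v =
      ∑ i, r i * (f i (v 0) * g (v 1) - f i (v 1) * g (v 0)) := by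
  rw [ContinuousAlternatingMap.sum_apply]
  rfl

end Pairs

/-! ### Second order velocities and the contact condition in coordinates -/

variable {m : ℕ} {M : Type*} [TopologicalSpace M] [ChartedSpace (Coord m) M]
  [IsManifold (𝓡 m) ∞ M] (φ : Chart m M)

lemma Chart.jet_acc {x : Coord m} (hx : x ∈ φ.img) (v a : Coord m) :
    φ.acc (φ.jet hx v a) = a :=
  (φ.tangent.mfderiv_frame (f := fun p => φ.vel p) (g := fun y => y.2) (fun _ _ => rfl)
    (y := (x, v)) hx differentiableAt_snd (v, a)).trans (DFunLike.congr_fun fderiv_snd (v, a))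

lemma Chart.coords_jet {x : Coord m} (hx : x ∈ φ.img) (v a : Coord m) :
    φ.coords (φ.jet hx v a) = (x, v, a) :=
  Prod.ext (φ.tangentInv_pos (z := (x, v)) hx)
    (Prod.ext (φ.tangentInv_vel (z := (x, v)) hx) (φ.jet_acc hx v a))

lemma Chart.proj_frame {y : Coord m × Coord m} (hy : y.1 ∈ φ.img) (w : Coord m × Coord m) :
    mfderiv (𝓡 m).tangent (𝓡 m) (fun p : TM m M => p.proj) (φ.tangentInv y) (φ.tangent.frame y w)
      = φ.base.frame y.1 w.1 := by
  have h1 := φ.tangent.mdiffAt_symm (y := y) hy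
  have h2 : MDifferentiableAt (𝓡 m).tangent (𝓡 m) (fun p : TM m M => p.proj) (φ.tangentInv y) :=
    (Bundle.contMDiff_proj (TangentSpace (𝓡 m) : M → Type _) (IB := 𝓡 m) (n := 1)
      ).mdifferentiableAt one_ne_zero
  have h3 := φ.base.mdiffAt_symm (y := y.1) hy
  have h4 := mfderiv_comp y h2 h1
  have h5 : (fun p : TM m M => p.proj) ∘ φ.tangentInv = φ.base.invFun ∘ Prod.fst := rfl
  have h6 : MDifferentiableAt 𝓘(ℝ, Coord m × Coord m) (𝓡 m)
      (Prod.fst : Coord m × Coord m → Coord m) y := differentiableAt_fst.mdifferentiableAt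
  have h7 := mfderiv_comp y (g := φ.base.invFun) h3 h6
  rw [h5, h7] at h4
  have h8 := DFunLike.congr_fun h4 w
  rw [mfderiv_eq_fderiv, fderiv_fst] at h8
  exact h8.symm

/-- A tangent vector of `TM` at `(x, v)` has coordinates `(u, a)`, and the second order condition
forces `u = v`. -/
lemma Chart.exists_jet {J : T2M m M} (hJ : J.pt.proj ∈ φ.dom) :
    ∃ (x : Coord m) (hx : x ∈ φ.img) (v a : Coord m), J = φ.jet hx v a := by
  obtain ⟨pt, acc, h2⟩ := J
  obtain ⟨x, v, hx, rfl⟩ : ∃ x v, x ∈ φ.img ∧ pt = φ.tangentInv (x, v) :=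
    ⟨_, _, φ.1.map_source hJ, (φ.tangentInv_left hJ).symm⟩
  obtain ⟨w, rfl⟩ : ∃ w, acc = φ.tangent.frame (x, v) w :=
    ⟨_, (φ.tangent.frame_coframe (y := (x, v)) hx acc).symm⟩
  rw [φ.proj_frame (y := (x, v)) hx] at h2
  have h3 : φ.base.frame x w.1 = φ.base.frame x v := h2
  have h4 := congrArg (φ.base.coframe (φ.base.invFun x)) h3
  rw [φ.base.coframe_frame hx, φ.base.coframe_frame hx] at h4
  obtain ⟨u, a⟩ := w
  obtain rfl : u = v := h4
  exact ⟨x, hx, u, a, rfl⟩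

/-- The tangent vector `∂/∂t + v ∂/∂x + a ∂/∂ẋ` in coordinates. -/
def curveVec (v a : Coord m) : ℝ × Coord m × Coord m := (1, v, a)

/-- The term `ẋⁱ dt` of the contact form disappears on wedging with `dt`, so `ε` is evaluated as `εᵢ
dxⁱ ∧ dt`. -/
lemma Chart.form_jet (ε : SourceForm m M) (t : ℝ) {x : Coord m} (hx : x ∈ φ.img) (v a : Coord m)
    (w : Fin 2 → ℝ × Coord m) :
    ε.form t (φ.jet hx v a) (fun k => φ.base.prodReal.frame (t, x) (w k)) =
      ∑ i, ε.coeff φ i (x, v, a) * ((w 0).2 i * (w 1).1 - (w 1).2 i * (w 0).1) := by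
  have h1 : ∀ w : ℝ × Coord m, dtM (m := m) (t, φ.1.symm x) (φ.base.prodReal.frame (t, x) w) =
      w.1 :=
    fun w => (φ.base.prodReal.dAt_frame (g := fun y => y.1) (fun _ _ => rfl) (y := (t, x)) hx
      differentiableAt_fst w).trans (DFunLike.congr_fun fderiv_fst w)
  have h2 : ∀ (w : ℝ × Coord m) (i : Fin m), φ.contact i t (φ.jet hx v a)
      (φ.base.prodReal.frame (t, x) w) = w.2 i - v i * w.1 := by
    intro w i
    have h3 := (φ.base.prodReal.dAt_frame (f := fun q : ℝ × M => φ.1 q.2 i) (g := fun y => y.2 i)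
      (fun _ _ => rfl) (y := (t, x)) hx
      (differentiable_coordinate (.snd ℝ ℝ (Coord m)) i _) w).trans
      (fderiv_coordinate (.snd ℝ ℝ (Coord m)) i _ w)
    have h4 : φ.vel (φ.jet hx v a).pt = v := φ.tangentInv_vel (z := (x, v)) hx
    rw [Chart.contact, h4]
    exact congrArg₂ (fun a b => a - v i * b) h3 (h1 w)
  rw [ε.expression φ t _ (φ.1.map_target hx), φ.coords_jet]
  refine (sum_smul_wedge_apply _ _ _ _).trans (Finset.sum_congr rfl fun i _ => ?_)
  have h3 := (congrArg₂ (· * ·) (h2 (w 0) i) (h1 (w 1)))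
  have h4 := (congrArg₂ (· * ·) (h2 (w 1) i) (h1 (w 0)))
  refine congrArg (ε.coeff φ i (x, v, a) * ·) ((congrArg₂ (· - ·) h3 h4).trans ?_)
  ring

/-- The condition `p₁α = ε` on the value `α` at `(t, x, v)` of a form in coordinates. -/
def SourceForm.Represents (ε : SourceForm m M) (φ : Chart m M) (x v : Coord m)
    (α : (ℝ × Coord m × Coord m) [⋀^Fin 2]→L[ℝ] ℝ) : Prop :=
  ∀ a : Coord m, (∀ u : Coord m, α ![(0, u, 0), curveVec v a] = ∑ i, ε.coeff φ i (x, v, a) * u i) ∧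
    ∀ w : Coord m, α ![(0, 0, w), curveVec v a] = 0

/-- The condition `p₁α = ε` at `(t, J)`. -/
def SourceForm.HasContactPart (ε : SourceForm m M) (α : DForm (RTMModel m) (ℝ × TM m M) 2)
    (t : ℝ) (J : T2M m M) : Prop :=
  ∀ ξ η : TangentSpace (RTMModel m) ((t, J.pt) : ℝ × TM m M),
      p1 α t J ξ η =
        ε.form t J
          ![mfderiv (RTMModel m) (𝓘(ℝ, ℝ).prod (𝓡 m))
              (fun q : ℝ × TM m M => ((q.1, q.2.proj) : ℝ × M)) (t, J.pt) ξ,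
            mfderiv (RTMModel m) (𝓘(ℝ, ℝ).prod (𝓡 m))
              (fun q : ℝ × TM m M => ((q.1, q.2.proj) : ℝ × M)) (t, J.pt) η]

lemma Chart.base_frame {y : ℝ × Coord m × Coord m} (hy : y.2.1 ∈ φ.img)
    (w : ℝ × Coord m × Coord m) :
    mfderiv (RTMModel m) (𝓘(ℝ, ℝ).prod (𝓡 m)) (fun q : ℝ × TM m M => ((q.1, q.2.proj) : ℝ × M))
      (φ.evolution.invFun y) (φ.evolution.frame y w) =
      φ.base.prodReal.frame (y.1, y.2.1) (w.1, w.2.1) := by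
  have h1 := φ.evolution.mdiffAt_symm (y := y) hy
  have h2 : MDifferentiableAt (RTMModel m) (𝓘(ℝ, ℝ).prod (𝓡 m))
      (fun q : ℝ × TM m M => ((q.1, q.2.proj) : ℝ × M)) (φ.evolution.invFun y) := by
    have : ContMDiff (RTMModel m) (𝓘(ℝ, ℝ).prod (𝓡 m)) 1
        (fun q : ℝ × TM m M => ((q.1, q.2.proj) : ℝ × M)) :=
      contMDiff_fst.prodMk ((Bundle.contMDiff_proj (TangentSpace (𝓡 m) : M → Type _)).comp
        contMDiff_snd)
    exact this.mdifferentiableAt one_ne_zero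
  let ℓ : ℝ × Coord m × Coord m →L[ℝ] ℝ × Coord m :=
    (ContinuousLinearMap.id ℝ ℝ).prodMap (.fst ℝ (Coord m) (Coord m))
  have h3 := φ.base.prodReal.mdiffAt_symm (y := ℓ y) hy
  have h4 := mfderiv_comp y h2 h1
  have h6 : MDifferentiableAt 𝓘(ℝ, ℝ × Coord m × Coord m) 𝓘(ℝ, ℝ × Coord m) ℓ y :=
    ℓ.differentiableAt.mdifferentiableAt
  have h7 := mfderiv_comp y (g := φ.base.prodReal.invFun) h3 h6
  have h8 := DFunLike.congr_fun (h4.symm.trans h7) w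
  rw [mfderiv_eq_fderiv, ℓ.fderiv] at h8
  exact h8

/-- Since `hξ = dt(ξ) D_a`, the value of `p₁α` on `(w, w')` is `w.1 α(D_a, w') + w'.1 α(w, D_a)`.
The condition `p₁α = ε` therefore concerns only the contraction of `α` with `D_a`; pairing with `(1,
0, 0)` recovers that contraction on the vectors with vanishing `dt`. -/
lemma SourceForm.hasContactPart_iff (ε : SourceForm m M)
    (α : DForm (RTMModel m) (ℝ × TM m M) 2) (t : ℝ) {x : Coord m} (hx : x ∈ φ.img)
    (v : Coord m) : (∀ a, ε.HasContactPart α t (φ.jet hx v a)) ↔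
      ε.Represents φ x v (φ.evolution.rep α (t, x, v)) := by
  set α' := φ.evolution.rep α (t, x, v) with hα'
  have hor : ∀ (a : Coord m) (w : ℝ × Coord m × Coord m),
      horPart t (φ.jet hx v a) (φ.evolution.frame (t, x, v) w) =
        φ.evolution.frame (t, x, v) (w.1 • curveVec v a) := by
    intro a w
    have h1 := φ.dt_frame (y := (t, x, v)) hx w
    have h2 := φ.tangent.prodReal_frame (z := (t, x, v)) hx (curveVec v a)
    rw [map_smul]
    exact congrArg₂ (fun (r : ℝ) (ξ : TangentSpace (RTMModel m)
      ((t, φ.tangentInv (x, v)) : ℝ × TM m M)) => r • ξ) h1 h2.symm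
  have hp1 : ∀ (a : Coord m) (w w' : ℝ × Coord m × Coord m),
      p1 α t (φ.jet hx v a) (φ.evolution.frame (t, x, v) w) (φ.evolution.frame (t, x, v) w') =
      w.1 * α' ![curveVec v a, w'] + w'.1 * α' ![w, curveVec v a] := by
    intro a w w'
    have h0 : ∀ w w', α (t, φ.tangentInv (x, v)) ![φ.evolution.frame (t, x, v) w,
        φ.evolution.frame (t, x, v) w'] = α' ![w, w'] := by
      intro w w'
      refine congrArg (α (t, φ.tangentInv (x, v))) ?_
      funext i; fin_cases i <;> rfl
    have h1 := congrArg₂ (fun X X' : TangentSpace (RTMModel m) (φ.evolution.invFun (t, x, v)) =>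
      α (φ.evolution.invFun (t, x, v)) ![X, φ.evolution.frame (t, x, v) w' - X'] +
      α (φ.evolution.invFun (t, x, v)) ![φ.evolution.frame (t, x, v) w - X, X'])
        (hor a w) (hor a w')
    refine h1.trans ((congrArg₂ (· + ·) ?_ ?_).trans (?_ :
      α' ![w.1 • curveVec v a, w' - w'.1 • curveVec v a] +
      α' ![w - w.1 • curveVec v a, w'.1 • curveVec v a] = _))
    · rw [← h0, map_sub]; rfl
    · rw [← h0, map_sub]; rfl
    · simp only [alt_sub_left, alt_sub_right, alt_smul_left, alt_smul_right, alt_self]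
      ring
  have hform : ∀ (a : Coord m) (w w' : ℝ × Coord m × Coord m),
      ε.form t (φ.jet hx v a)
          ![mfderiv (RTMModel m) (𝓘(ℝ, ℝ).prod (𝓡 m))
              (fun q : ℝ × TM m M => ((q.1, q.2.proj) : ℝ × M)) (t, φ.tangentInv (x, v))
              (φ.evolution.frame (t, x, v) w),
            mfderiv (RTMModel m) (𝓘(ℝ, ℝ).prod (𝓡 m))
              (fun q : ℝ × TM m M => ((q.1, q.2.proj) : ℝ × M)) (t, φ.tangentInv (x, v))
              (φ.evolution.frame (t, x, v) w')] =
      ∑ i, ε.coeff φ i (x, v, a) * (w.2.1 i * w'.1 - w'.2.1 i * w.1) := by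
    intro a w w'
    have h1 := φ.base_frame (y := (t, x, v)) hx
    refine Eq.trans (congrArg (ε.form t (φ.jet hx v a)) ?_)
      (φ.form_jet ε t hx v a ![(w.1, w.2.1), (w'.1, w'.2.1)])
    funext i
    fin_cases i
    · exact h1 w
    · exact h1 w'
  constructor
  · intro h a
    have h' : ∀ w w' : ℝ × Coord m × Coord m, _ = _ := fun w w' =>
      ((hp1 a w w').symm.trans (h a (φ.evolution.frame (t, x, v) w)
        (φ.evolution.frame (t, x, v) w'))).trans (hform a w w')
    refine ⟨fun u => ?_, fun w => ?_⟩
    · simpa using h' (0, u, 0) (1, 0, 0)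
    · simpa using h' (0, 0, w) (1, 0, 0)
  · intro h a ξ η
    obtain ⟨w, rfl⟩ : ∃ w, ξ = φ.evolution.frame (t, x, v) w :=
      ⟨_, (φ.evolution.frame_coframe (y := (t, x, v)) hx ξ).symm⟩
    obtain ⟨w', rfl⟩ : ∃ w, η = φ.evolution.frame (t, x, v) w :=
      ⟨_, (φ.evolution.frame_coframe (y := (t, x, v)) hx η).symm⟩
    refine ((hp1 a w w').trans ?_).trans (hform a w w').symm
    -- The vector `w - dt(w) D_a` has no time component, and `α(D_a, D_a) = 0`, so the two defining
    -- conditions determine the whole contraction.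
    have key : ∀ w : ℝ × Coord m × Coord m, α' ![w, curveVec v a] =
        ∑ i, ε.coeff φ i (x, v, a) * (w.2.1 i - w.1 * v i) := by
      intro w
      have e : w = w.1 • curveVec v a + (((0, w.2.1 - w.1 • v, 0) : ℝ × Coord m × Coord m) +
          (0, 0, w.2.2 - w.1 • a)) := by
        simp [curveVec]
      rw [e, alt_add_left, alt_add_left, alt_smul_left, alt_self, (h a).1, (h a).2]
      simp [curveVec]
    rw [alt_swap α' (curveVec v a), key, key, mul_neg, Finset.mul_sum, Finset.mul_sum,
      ← Finset.sum_neg_distrib, ← Finset.sum_add_distrib]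
    refine Finset.sum_congr rfl fun i _ => ?_
    ring

/-! ### Exterior derivatives of one- and two-forms on explicit vectors -/

section ExteriorDerivative

variable {E : Type*} [NormedAddCommGroup E] [NormedSpace ℝ E]

lemma extDeriv_oneForm_apply {θ : E → E [⋀^Fin 1]→L[ℝ] ℝ} {z : E} (h : DifferentiableAt ℝ θ z)
    (u v : E) : extDeriv θ z ![u, v] =
      fderiv ℝ (fun y => θ y ![v]) z u - fderiv ℝ (fun y => θ y ![u]) z v := by
  have h0 : (0 : Fin 2).removeNth ![u, v] = ![v] := by funext i; fin_cases i; rfl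
  have h1 : (1 : Fin 2).removeNth ![u, v] = ![u] := by funext i; fin_cases i; rfl
  rw [extDeriv_apply h, Fin.sum_univ_two, h0, h1]
  simp [sub_eq_add_neg]

lemma extDeriv_twoForm_apply {θ : E → E [⋀^Fin 2]→L[ℝ] ℝ} {z : E} (h : DifferentiableAt ℝ θ z)
    (u v w : E) : extDeriv θ z ![u, v, w] =
      fderiv ℝ (fun y => θ y ![v, w]) z u - fderiv ℝ (fun y => θ y ![u, w]) z v
        + fderiv ℝ (fun y => θ y ![u, v]) z w := by
  have h0 : (0 : Fin 3).removeNth ![u, v, w] = ![v, w] := by funext i; fin_cases i <;> rfl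
  have h1 : (1 : Fin 3).removeNth ![u, v, w] = ![u, w] := by funext i; fin_cases i <;> rfl
  have h2 : (2 : Fin 3).removeNth ![u, v, w] = ![u, v] := by funext i; fin_cases i <;> rfl
  rw [extDeriv_apply h, Fin.sum_univ_three, h0, h1, h2]
  simp [sub_eq_add_neg]

lemma alternating_two_ext {a b : E [⋀^Fin 2]→L[ℝ] ℝ} (h : ∀ u v, a ![u, v] = b ![u, v]) :
    a = b := by
  ext v
  have : v = ![v 0, v 1] := by funext i; fin_cases i <;> rfl
  rw [this]
  exact h _ _

lemma alternating_one_ext {a b : E [⋀^Fin 1]→L[ℝ] ℝ} (h : ∀ u, a ![u] = b ![u]) : a = b := by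
  ext v
  have : v = ![v 0] := by funext i; fin_cases i; rfl
  rw [this]
  exact h _

lemma differentiableAt_apply_const {k : ℕ} {θ : E → E [⋀^Fin k]→L[ℝ] ℝ} {z : E}
    (h : DifferentiableAt ℝ θ z) (v : Fin k → E) : DifferentiableAt ℝ (fun y => θ y v) z :=
  h.continuousAlternatingMap_apply_const v

lemma hasDerivAt_line {f : E → ℝ} {z : E} (h : DifferentiableAt ℝ f z) (d : E) :
    HasDerivAt (fun s : ℝ => f (z + s • d)) (fderiv ℝ f z d) 0 := by
  have h1 : HasDerivAt (fun s : ℝ => z + s • d) d 0 := by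
    simpa using ((hasDerivAt_id (0 : ℝ)).smul_const d).const_add z
  have h2 : HasFDerivAt f (fderiv ℝ f z) (z + (0 : ℝ) • d) := by simpa using h.hasFDerivAt
  exact h2.comp_hasDerivAt 0 h1

lemma eventually_line {S : Set E} (hS : IsOpen S) {z : E} (hz : z ∈ S) (d : E) :
    ∀ᶠ s : ℝ in 𝓝 0, z + s • d ∈ S := by
  have h1 : Continuous (fun s : ℝ => z + s • d) := by fun_prop
  exact (hS.preimage h1).mem_nhds (by simpa using hz)

end ExteriorDerivative

/-! ## Closed forms with a given contact component, in coordinates -/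

section Closed

variable {X : Type*} [NormedAddCommGroup X] [NormedSpace ℝ X]

/-- `∂/∂t` -/
def tVec : ℝ × X × X := (1, 0, 0)

/-- The vector `u ∂/∂x`. -/
def hVec (u : X) : ℝ × X × X := (0, u, 0)

/-- The vector `w ∂/∂ẋ`. -/
def vVec (w : X) : ℝ × X × X := (0, 0, w)

/-- The points of `ℝ × X × X` lying over `U`. -/
def tube (U : Set X) : Set (ℝ × X × X) := {z | z.2.1 ∈ U}

omit [NormedSpace ℝ X] in
lemma isOpen_tube {U : Set X} (hU : IsOpen U) : IsOpen (tube U) :=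
  hU.preimage (continuous_fst.comp continuous_snd)

lemma decomp (w : ℝ × X × X) : w = w.1 • tVec + (hVec w.2.1 + vVec w.2.2) := by
  ext <;> simp [tVec, hVec, vVec]

/-- A smooth closed form over `U` whose contraction with `∂/∂t + v ∂/∂x + a ∂/∂ẋ` is horizontal and
given by `e (x, v, a)`. -/
structure ClosedRep (U : Set X) (e : X → X → X → X → ℝ)
    (α : ℝ × X × X → (ℝ × X × X) [⋀^Fin 2]→L[ℝ] ℝ) : Prop where
  isOpen : IsOpen U
  smooth : ContDiffOn ℝ ∞ α (tube U)
  closed : ∀ z ∈ tube U, extDeriv α z = 0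
  horizontal : ∀ z ∈ tube U, ∀ a u, α z ![hVec u, (1, z.2.2, a)] = e z.2.1 z.2.2 a u
  vertical : ∀ z ∈ tube U, ∀ a w, α z ![vVec w, (1, z.2.2, a)] = 0
  diff : ∀ x ∈ U, ∀ v u, DifferentiableAt ℝ (fun v => e x v 0 u) v

namespace ClosedRep

variable {U : Set X} {e : X → X → X → X → ℝ} {α : ℝ × X × X → (ℝ × X × X) [⋀^Fin 2]→L[ℝ] ℝ}
  (h : ClosedRep U e α) {z : ℝ × X × X} (hz : z ∈ tube U)

omit [NormedSpace ℝ X] in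
lemma curve_eq (v a : X) : ((1, v, a) : ℝ × X × X) = tVec + (hVec v + vVec a) := by
  simp [tVec, hVec, vVec]

include h hz

lemma contDiffAt : ContDiffAt ℝ ∞ α z :=
  h.smooth.contDiffAt ((isOpen_tube h.isOpen).mem_nhds hz)

lemma differentiableAt : DifferentiableAt ℝ α z := (h.contDiffAt hz).differentiableAt (by simp)

lemma diffAt (p q : ℝ × X × X) : DifferentiableAt ℝ (fun y => α y ![p, q]) z :=
  differentiableAt_apply_const (h.differentiableAt hz) _

lemma eventually_mem : ∀ᶠ y in 𝓝 z, y ∈ tube U := (isOpen_tube h.isOpen).mem_nhds hz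

lemma closed_apply (p q r : ℝ × X × X) : fderiv ℝ (fun y => α y ![q, r]) z p
    - fderiv ℝ (fun y => α y ![p, r]) z q + fderiv ℝ (fun y => α y ![p, q]) z r = 0 := by
  rw [← extDeriv_twoForm_apply (h.differentiableAt hz), h.closed z hz]; rfl

/-- The vertical condition holds for all accelerations; subtracting the case `a = 0` leaves the
pairing with `a ∂/∂ẋ`. -/
lemma vert_vert (w a : X) : α z ![vVec w, vVec a] = 0 := by
  have h1 := h.vertical z hz a w
  have h2 := h.vertical z hz 0 w
  rw [curve_eq, alt_add_right, alt_add_right] at h1 h2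
  have h3 : (vVec 0 : ℝ × X × X) = 0 := rfl
  have h4 : α z ![vVec w, 0] = 0 := by simpa using alt_smul_right (α z) 0 (vVec w) 0
  rw [h3, h4] at h2
  linarith

/-- Same subtraction in the horizontal condition. As the left side is linear in `a`, this forces `e`
to be affine in the acceleration. -/
lemma hor_vert (u a : X) :
    α z ![hVec u, vVec a] = e z.2.1 z.2.2 a u - e z.2.1 z.2.2 0 u := by
  rw [← h.horizontal z hz, ← h.horizontal z hz, ← alt_sub_right]
  congr 2
  simp [vVec]

lemma vert_time (w : X) : α z ![vVec w, tVec] = α z ![hVec z.2.2, vVec w] := by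
  have h1 := h.vertical z hz 0 w
  rw [curve_eq, alt_add_right, alt_add_right, h.vert_vert hz, alt_swap (α z) (vVec w) (hVec _)]
    at h1
  linarith

lemma hor_time (u : X) :
    α z ![hVec u, tVec] = e z.2.1 z.2.2 0 u - α z ![hVec u, hVec z.2.2] := by
  have h1 := h.horizontal z hz 0 u
  rw [curve_eq, alt_add_right, alt_add_right, h.hor_vert hz] at h1
  linarith

omit h in
lemma add_smul_vVec_mem (s : ℝ) (w : X) : z + s • vVec w ∈ tube U := by
  change z.2.1 + s • (0 : X) ∈ U
  rw [smul_zero, add_zero]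
  exact hz

/-- Differentiate `α(w ∂/∂ẋ, D₀) = 0` along `u ∂/∂ẋ`. Since `D₀` moves by `u ∂/∂x`, the mixed
component becomes the derivative of `α(w ∂/∂ẋ, ·)` on the vector `D₀` frozen at `z`. Closedness on
`(u ∂/∂ẋ, w ∂/∂ẋ, D₀)`, together with the vanishing on vertical pairs, makes this derivative
symmetric in `u` and `w`. -/
lemma symm_hor_vert (u w : X) : α z ![hVec u, vVec w] = α z ![hVec w, vVec u] := by
  have key : ∀ u w : X, α z ![hVec u, vVec w] =
      fderiv ℝ (fun y => α y ![vVec w, (1, z.2.2, 0)]) z (vVec u) := by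
    intro u w
    have h1 := hasDerivAt_line (h.diffAt hz (vVec w) (1, z.2.2, 0)) (vVec u)
    have h2 := (hasDerivAt_id (0 : ℝ)).mul
      (hasDerivAt_line (h.diffAt hz (vVec w) (hVec u)) (vVec u))
    have h3 : (fun s : ℝ => α (z + s • vVec u) ![vVec w, (1, z.2.2, 0)]) +
        (id * fun s : ℝ => α (z + s • vVec u) ![vVec w, hVec u]) = fun _ => 0 := by
      funext s
      have h4 := h.vertical _ (add_smul_vVec_mem hz s u) 0 w
      have h5 : ((1, (z + s • vVec u).2.2, 0) : ℝ × X × X) = (1, z.2.2, 0) + s • hVec u := by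
        simp [vVec, hVec]
      rw [h5, alt_add_right, alt_smul_right] at h4
      exact h4
    have h6 := h1.add h2
    rw [h3] at h6
    have h7 := h6.unique (hasDerivAt_const 0 0)
    rw [alt_swap]
    simp at h7
    linarith
  rw [key, key]
  have h1 := h.closed_apply hz (vVec u) (vVec w) (1, z.2.2, 0)
  have h2 : (fun y => α y ![vVec u, vVec w]) =ᶠ[𝓝 z] fun _ => 0 := by
    filter_upwards [h.eventually_mem hz] with y hy using h.vert_vert hy u w
  rw [h2.fderiv_eq] at h1
  simp at h1
  linarith

/-- Differentiate the horizontal condition at `a = 0` along `u' ∂/∂ẋ`: the motion of `D₀`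
contributes `α(u ∂/∂x, u' ∂/∂x)`, and closedness trades the derivative with `D₀` frozen for the
derivative of a mixed component along `D₀`. -/
lemma fderiv_e (u u' : X) : fderiv ℝ (fun v => e z.2.1 v 0 u) z.2.2 u' =
    fderiv ℝ (fun y => α y ![hVec u, vVec u']) z (1, z.2.2, 0) + α z ![hVec u, hVec u'] := by
  have h1 := hasDerivAt_line (h.diffAt hz (hVec u) (1, z.2.2, 0)) (vVec u')
  have h2 := (hasDerivAt_id (0 : ℝ)).mul
    (hasDerivAt_line (h.diffAt hz (hVec u) (hVec u')) (vVec u'))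
  have h3 : (fun s : ℝ => α (z + s • vVec u') ![hVec u, (1, z.2.2, 0)]) +
      (id * fun s : ℝ => α (z + s • vVec u') ![hVec u, hVec u']) =
      fun s : ℝ => e z.2.1 (z.2.2 + s • u') 0 u := by
    funext s
    have h4 := h.horizontal _ (add_smul_vVec_mem hz s u') 0 u
    have h5 : ((1, (z + s • vVec u').2.2, 0) : ℝ × X × X) = (1, z.2.2, 0) + s • hVec u' := by
      simp [vVec, hVec]
    rw [h5, alt_add_right, alt_smul_right] at h4
    refine h4.trans ?_
    simp [vVec]
  have h6 := h1.add h2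
  rw [h3] at h6
  have h7 := h6.unique (hasDerivAt_line (h.diff _ hz z.2.2 u) u')
  have h8 := h.closed_apply hz (vVec u') (hVec u) (1, z.2.2, 0)
  -- A horizontal displacement keeps the velocity, so the frozen vector remains `D₀` along the line
  -- and the vertical condition applies at every point of it.
  have h9 : fderiv ℝ (fun y => α y ![vVec u', (1, z.2.2, 0)]) z (hVec u) = 0 := by
    refine (hasDerivAt_line (h.diffAt hz (vVec u') (1, z.2.2, 0)) (hVec u)).unique
      ((hasDerivAt_const (0 : ℝ) (0 : ℝ)).congr_of_eventuallyEq ?_)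
    filter_upwards [eventually_line (isOpen_tube h.isOpen) hz (hVec u)] with s hs
    have h4 := h.vertical _ hs 0 u'
    simpa [hVec] using h4
  have h10 : (fun y => α y ![vVec u', hVec u]) = fun y => -α y ![hVec u, vVec u'] :=
    funext fun y => alt_swap _ _ _
  rw [h9, h10, fderiv_fun_neg] at h8
  simp at h7 h8
  linarith

/-- Antisymmetrising `fderiv_e` removes the derivative along `D₀`, because the mixed components are
symmetric. What remains expresses the horizontal component by the curl of `e` at zero acceleration.
-/
lemma two_mul_hor_hor (u u' : X) : 2 * α z ![hVec u, hVec u'] =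
    fderiv ℝ (fun v => e z.2.1 v 0 u) z.2.2 u' - fderiv ℝ (fun v => e z.2.1 v 0 u') z.2.2 u := by
  rw [h.fderiv_e hz, h.fderiv_e hz, alt_swap (α z) (hVec u') (hVec u)]
  have h1 : (fun y => α y ![hVec u, vVec u']) =ᶠ[𝓝 z] fun y => α y ![hVec u', vVec u] := by
    filter_upwards [h.eventually_mem hz] with y hy using h.symm_hor_vert hy u u'
  rw [h1.fderiv_eq]
  ring

omit h hz

lemma ext_of_components {a b : (ℝ × X × X) [⋀^Fin 2]→L[ℝ] ℝ}
    (hh : ∀ u u', a ![hVec u, hVec u'] = b ![hVec u, hVec u'])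
    (hv : ∀ u w, a ![hVec u, vVec w] = b ![hVec u, vVec w])
    (vv : ∀ w w', a ![vVec w, vVec w'] = b ![vVec w, vVec w'])
    (ht : ∀ u, a ![hVec u, tVec] = b ![hVec u, tVec])
    (vt : ∀ w, a ![vVec w, tVec] = b ![vVec w, tVec]) : a = b := by
  refine alternating_two_ext fun p q => ?_
  have th : ∀ (a : (ℝ × X × X) [⋀^Fin 2]→L[ℝ] ℝ) u, a ![tVec, hVec u] = -a ![hVec u, tVec] :=
    fun a u => alt_swap a _ _
  have tv : ∀ (a : (ℝ × X × X) [⋀^Fin 2]→L[ℝ] ℝ) u, a ![tVec, vVec u] = -a ![vVec u, tVec] :=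
    fun a u => alt_swap a _ _
  have vh : ∀ (a : (ℝ × X × X) [⋀^Fin 2]→L[ℝ] ℝ) u w,
      a ![vVec w, hVec u] = -a ![hVec u, vVec w] := fun a u w => alt_swap a _ _
  rw [decomp p, decomp q]
  simp only [alt_add_left, alt_add_right, alt_smul_left, alt_smul_right, alt_self,
    th, tv, vh, hh, hv, vv, ht, vt]

/-- A closed form is determined by its contact component. -/
lemma eq_of_closedRep {U' : Set X} {e' : X → X → X → X → ℝ}
    {β : ℝ × X × X → (ℝ × X × X) [⋀^Fin 2]→L[ℝ] ℝ} (h : ClosedRep U e α)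
    (h' : ClosedRep U' e' β) {z z' : ℝ × X × X} (hz : z ∈ tube U) (hz' : z' ∈ tube U')
    (hzz : z.2 = z'.2) (he : ∀ v a u, e z.2.1 v a u = e' z.2.1 v a u) : α z = β z' := by
  have hh : ∀ u u', α z ![hVec u, hVec u'] = β z' ![hVec u, hVec u'] := by
    intro u u'
    have h1 := h.two_mul_hor_hor hz u u'
    have h2 := h'.two_mul_hor_hor hz' u u'
    rw [← hzz] at h2
    simp only [he] at h1
    linarith
  have hv : ∀ u w, α z ![hVec u, vVec w] = β z' ![hVec u, vVec w] := by
    intro u w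
    rw [h.hor_vert hz, h'.hor_vert hz', ← hzz, he, he]
  refine ext_of_components hh hv ?_ ?_ ?_
  · intro w w'
    rw [h.vert_vert hz, h'.vert_vert hz']
  · intro u
    rw [h.hor_time hz, h'.hor_time hz', ← hzz, he, hh]
  · intro w
    rw [h.vert_time hz, h'.vert_time hz', ← hzz, hv]

/-- Uniqueness applied to `α` against itself at two times: `e` does not contain `t`, hence neither
does `α`. -/
lemma eq_time (h : ClosedRep U e α) (hz : z ∈ tube U) : α z = α (0, z.2) :=
  h.eq_of_closedRep h hz hz rfl fun _ _ _ => rfl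

end ClosedRep

end Closed

/-! ## Integrals depending on parameters -/

section ParametricIntegral

universe u

variable {E F : Type u} [NormedAddCommGroup E] [NormedSpace ℝ E]
  [NormedAddCommGroup F] [NormedSpace ℝ F] {U : Set E} {f : E → ℝ → F}

lemma fderiv_left_eq (hU : IsOpen U) (hf : ContDiffOn ℝ 1 (fun p : E × ℝ => f p.1 p.2)
    (U ×ˢ Set.univ)) {x : E} (hx : x ∈ U) (s : ℝ) :
    HasFDerivAt (fun x => f x s)
      ((fderiv ℝ (fun p : E × ℝ => f p.1 p.2) (x, s)).comp (.inl ℝ E ℝ)) x := by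
  have h1 : HasFDerivAt (fun p : E × ℝ => f p.1 p.2) _ (x, s) :=
    ((hf.contDiffAt ((hU.prod isOpen_univ).mem_nhds ⟨hx, trivial⟩)).differentiableAt
      one_ne_zero).hasFDerivAt
  have h2 : HasFDerivAt (fun y : E => (y, s)) (.inl ℝ E ℝ) x := hasFDerivAt_prodMk_left x s
  exact HasFDerivAt.comp (g := fun p : E × ℝ => f p.1 p.2) x h1 h2

lemma contDiffOn_fderiv_left {n : ℕ} (hU : IsOpen U)
    (hf : ContDiffOn ℝ (n + 1) (fun p : E × ℝ => f p.1 p.2) (U ×ˢ Set.univ)) :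
    ContDiffOn ℝ n (fun p : E × ℝ => fderiv ℝ (fun x => f x p.2) p.1) (U ×ˢ Set.univ) := by
  have h1 : ContDiffOn ℝ n (fun p : E × ℝ =>
      (fderiv ℝ (fun p : E × ℝ => f p.1 p.2) p).comp (.inl ℝ E ℝ)) (U ×ˢ Set.univ) :=
    (hf.fderiv_of_isOpen (hU.prod isOpen_univ) le_rfl).clm_comp contDiffOn_const
  refine h1.congr fun p hp => ?_
  exact (fderiv_left_eq hU (hf.of_le (by simp)) hp.1 p.2).fderiv

variable [FiniteDimensional ℝ E] [CompleteSpace F]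

-- Differentiation under the integral sign. The constant bound comes from continuity of the
-- derivative on the compact product of a small closed ball with `[0, 1]`, which is where finite
-- dimension enters.
omit [CompleteSpace F] in
lemma hasFDerivAt_parametric_integral (hU : IsOpen U)
    (hf : ContDiffOn ℝ 1 (fun p : E × ℝ => f p.1 p.2) (U ×ˢ Set.univ)) {x : E} (hx : x ∈ U) :
    HasFDerivAt (fun x => ∫ s in (0 : ℝ)..1, f x s)
      (∫ s in (0 : ℝ)..1, fderiv ℝ (fun x => f x s) x) x := by
  have : ProperSpace E := FiniteDimensional.proper ℝ E
  have hf' : ContinuousOn (fun p : E × ℝ => fderiv ℝ (fun x => f x p.2) p.1) (U ×ˢ Set.univ) :=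
    (contDiffOn_fderiv_left (n := 0) hU (by simpa using hf)).continuousOn
  have hc : ∀ y ∈ U, Continuous (f y) := fun y hy =>
    hf.continuousOn.comp_continuous (f := fun s : ℝ => (y, s)) (by fun_prop) fun s => ⟨hy, trivial⟩
  have hc' : Continuous (fun s => fderiv ℝ (fun x => f x s) x) :=
    hf'.comp_continuous (f := fun s : ℝ => (x, s)) (by fun_prop) fun s => ⟨hx, trivial⟩
  obtain ⟨r, hr, hball⟩ := Metric.nhds_basis_closedBall.mem_iff.1 (hU.mem_nhds hx)
  have hcomp : IsCompact (Metric.closedBall x r ×ˢ Set.uIcc (0 : ℝ) 1) :=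
    (isCompact_closedBall x r).prod isCompact_uIcc
  obtain ⟨C, hC⟩ := hcomp.exists_bound_of_continuousOn
    (hf'.mono (Set.prod_mono hball (Set.subset_univ _)))
  refine intervalIntegral.hasFDerivAt_integral_of_dominated_of_fderiv_le (bound := fun _ => C)
    (F' := fun y s => fderiv ℝ (fun x => f x s) y)
    (Metric.closedBall_mem_nhds x hr) ?_ ((hc x hx).intervalIntegrable _ _)
    hc'.aestronglyMeasurable ?_ intervalIntegrable_const ?_
  · filter_upwards [hU.mem_nhds hx] with y hy using (hc y hy).aestronglyMeasurable
  · exact Filter.Eventually.of_forall fun s hs y hy =>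
      hC (y, s) ⟨hy, Set.uIoc_subset_uIcc hs⟩
  · refine Filter.Eventually.of_forall fun s _ y hy => ?_
    have := fderiv_left_eq hU hf (hball hy) s
    rwa [← this.fderiv] at this

omit [FiniteDimensional ℝ E] [CompleteSpace F] in
lemma continuous_fderiv_left (hU : IsOpen U)
    (hf : ContDiffOn ℝ 1 (fun p : E × ℝ => f p.1 p.2) (U ×ˢ Set.univ)) {x : E} (hx : x ∈ U) :
    Continuous (fun s => fderiv ℝ (fun x => f x s) x) :=
  (contDiffOn_fderiv_left (n := 0) hU (by simpa using hf)).continuousOn.comp_continuous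
    (f := fun s : ℝ => (x, s)) (by fun_prop) fun _ => ⟨hx, trivial⟩

/-- Induction on `n`, with `F` general because the derivative takes values in `E →L[ℝ] F`; this is
why `E` and `F` share a universe. The integrand is asked for one derivative more than the integral
gets, which costs nothing at order `∞`. -/
lemma contDiffOn_parametric_integral_nat (n : ℕ) : ∀ {F : Type u} [NormedAddCommGroup F]
    [NormedSpace ℝ F] [CompleteSpace F] {f : E → ℝ → F}, IsOpen U →
    ContDiffOn ℝ (n + 1) (fun p : E × ℝ => f p.1 p.2) (U ×ˢ Set.univ) →
    ContDiffOn ℝ n (fun x => ∫ s in (0 : ℝ)..1, f x s) U := by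
  induction n with
  | zero =>
    intro F _ _ _ f hU hf
    refine contDiffOn_zero.2 fun x hx => ?_
    exact (hasFDerivAt_parametric_integral hU (by simpa using hf)
      hx).continuousAt.continuousWithinAt
  | succ n ih =>
    intro F _ _ _ f hU hf
    have hf1 : ContDiffOn ℝ 1 (fun p : E × ℝ => f p.1 p.2) (U ×ˢ Set.univ) :=
      hf.of_le (by simp)
    have hd := fun x hx => hasFDerivAt_parametric_integral hU hf1 (x := x) hx
    push_cast
    rw [contDiffOn_succ_iff_fderiv_of_isOpen hU]
    refine ⟨fun x hx => (hd x hx).differentiableAt.differentiableWithinAt, by simp, ?_⟩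
    refine (ih (f := fun x s => fderiv ℝ (fun x => f x s) x) hU ?_).congr
      fun x hx => (hd x hx).fderiv
    have := contDiffOn_fderiv_left (n := n + 1) hU (by exact_mod_cast hf)
    exact_mod_cast this

lemma contDiffOn_parametric_integral (hU : IsOpen U)
    (hf : ContDiffOn ℝ ∞ (fun p : E × ℝ => f p.1 p.2) (U ×ˢ Set.univ)) :
    ContDiffOn ℝ ∞ (fun x => ∫ s in (0 : ℝ)..1, f x s) U :=
  contDiffOn_infty.2 fun n => contDiffOn_parametric_integral_nat n hU
    (hf.of_le (by exact_mod_cast le_top))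

end ParametricIntegral

/-! ## The fibre homotopy -/

section Homotopy

variable {X : Type} [NormedAddCommGroup X] [NormedSpace ℝ X]

/-- A smooth closed two-form over `U` vanishing on pairs of vertical vectors. -/
structure LagrangianRep (U : Set X) (σ : X × X → (X × X) [⋀^Fin 2]→L[ℝ] ℝ) : Prop where
  isOpen : IsOpen U
  smooth : ContDiffOn ℝ ∞ σ (Prod.fst ⁻¹' U)
  closed : ∀ y, y.1 ∈ U → extDeriv σ y = 0
  vert_vert : ∀ y, y.1 ∈ U → ∀ p q, σ y ![(0, p), (0, q)] = 0

/-- The integrand of `fiberPotential`. -/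
def fiberIntegrand (σ : X × X → (X × X) [⋀^Fin 2]→L[ℝ] ℝ) (y : X × X) (s : ℝ) :
    (X × X) [⋀^Fin 1]→L[ℝ] ℝ :=
  ((σ (y.1, s • y.2)).curryLeft (0, y.2)).compContinuousLinearMap
    ((ContinuousLinearMap.inl ℝ X X).comp (.fst ℝ X X))

/-- The contraction of `σ` with the fibre homotopy `(x, v) ↦ (x, s v)`, integrated over `[0, 1]`. -/
def fiberPotential (σ : X × X → (X × X) [⋀^Fin 2]→L[ℝ] ℝ) (y : X × X) :
    (X × X) [⋀^Fin 1]→L[ℝ] ℝ := ∫ s in (0 : ℝ)..1, fiberIntegrand σ y s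

lemma fiberIntegrand_apply (σ : X × X → (X × X) [⋀^Fin 2]→L[ℝ] ℝ) (y : X × X) (s : ℝ) (w : X × X) :
    fiberIntegrand σ y s ![w] = σ (y.1, s • y.2) ![(0, y.2), (w.1, 0)] := by
  rw [fiberIntegrand, ContinuousAlternatingMap.compContinuousLinearMap_apply,
    ContinuousAlternatingMap.curryLeft_apply_apply]
  congr 1
  funext i
  fin_cases i <;> rfl

/-- The value on `(p, q)` is the value on the standard basis of the pull-back along the linear map
`ℝ × ℝ → E` sending that basis to `p` and `q`. -/
lemma contDiffAt_apply_pair {F E : Type*} [NormedAddCommGroup F] [NormedSpace ℝ F]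
    [NormedAddCommGroup E] [NormedSpace ℝ E] {n : ℕ∞ω} {f : F → E [⋀^Fin 2]→L[ℝ] ℝ} {p q : F → E}
    {x : F} (hf : ContDiffAt ℝ n f x) (hp : ContDiffAt ℝ n p x) (hq : ContDiffAt ℝ n q x) :
    ContDiffAt ℝ n (fun y => f y ![p y, q y]) x := by
  let L : F → ℝ × ℝ →L[ℝ] E := fun y =>
    (ContinuousLinearMap.fst ℝ ℝ ℝ).smulRight (p y) +
      (ContinuousLinearMap.snd ℝ ℝ ℝ).smulRight (q y)
  have hL : ContDiffAt ℝ n L x :=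
    (contDiffAt_const.smulRight hp).add (contDiffAt_const.smulRight hq)
  have h1 := contDiffWithinAt_alternating_iff.1
    (contDiffAt_compContinuousLinearMap hf hL) ![(1, 0), (0, 1)]
  refine ContDiffWithinAt.congr_of_mem h1 (fun y _ => ?_) (Set.mem_univ x)
  rw [ContinuousAlternatingMap.compContinuousLinearMap_apply]
  congr 1
  funext i
  fin_cases i <;> simp [L]

namespace LagrangianRep

variable {U : Set X} {σ : X × X → (X × X) [⋀^Fin 2]→L[ℝ] ℝ} (h : LagrangianRep U σ)

include h

lemma isOpen' : IsOpen (Prod.fst ⁻¹' U : Set (X × X)) := h.isOpen.preimage continuous_fst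

lemma contDiffAt {y : X × X} (hy : y.1 ∈ U) : ContDiffAt ℝ ∞ σ y :=
  h.smooth.contDiffAt (h.isOpen'.mem_nhds hy)

lemma diffAt {y : X × X} (hy : y.1 ∈ U) (p q : X × X) :
    DifferentiableAt ℝ (fun y => σ y ![p, q]) y :=
  differentiableAt_apply_const ((h.contDiffAt hy).differentiableAt (by simp)) _

lemma closed_apply {y : X × X} (hy : y.1 ∈ U) (p q r : X × X) :
    fderiv ℝ (fun y => σ y ![q, r]) y p - fderiv ℝ (fun y => σ y ![p, r]) y q
      + fderiv ℝ (fun y => σ y ![p, q]) y r = 0 := by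
  rw [← extDeriv_twoForm_apply ((h.contDiffAt hy).differentiableAt (by simp)), h.closed y hy]; rfl

/-- Against a vertical vector only the base component counts. This is why fibre components can be
ignored both in `fiberIntegrand` and under changes of chart. -/
lemma apply_vert_left {y : X × X} (hy : y.1 ∈ U) (p : X) (w : X × X) :
    σ y ![(0, p), w] = σ y ![(0, p), (w.1, 0)] := by
  have : w = (w.1, 0) + (0, w.2) := by simp
  rw [this, alt_add_right, h.vert_vert y hy]
  simp

variable [FiniteDimensional ℝ X]

lemma contDiffOn_fiberIntegrand :
    ContDiffOn ℝ ∞ (fun p : (X × X) × ℝ => fiberIntegrand σ p.1 p.2)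
      ((Prod.fst ⁻¹' U) ×ˢ Set.univ) := by
  intro p hp
  refine ContDiffAt.contDiffWithinAt ?_
  have h1 : ContDiffAt ℝ ∞ (fun p : (X × X) × ℝ => σ (p.1.1, p.2 • p.1.2)) p := by
    refine ContDiffAt.comp (g := σ) p (h.contDiffAt (y := (p.1.1, p.2 • p.1.2)) hp.1) ?_
    fun_prop
  refine contDiffWithinAt_alternating_iff.2 fun v => ?_
  have hv : v = ![v 0] := by funext i; fin_cases i; rfl
  rw [hv]
  simp only [fiberIntegrand_apply]
  exact contDiffAt_apply_pair h1 (by fun_prop) contDiffAt_const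

lemma contDiffOn_fiberIntegrand_apply (w : X × X) :
    ContDiffOn ℝ ∞ (fun p : (X × X) × ℝ => fiberIntegrand σ p.1 p.2 ![w])
      ((Prod.fst ⁻¹' U) ×ˢ Set.univ) :=
  contDiffOn_alternating_iff.1 h.contDiffOn_fiberIntegrand _

lemma contDiffOn_fiberPotential : ContDiffOn ℝ ∞ (fiberPotential σ) (Prod.fst ⁻¹' U) :=
  contDiffOn_parametric_integral h.isOpen' h.contDiffOn_fiberIntegrand

lemma continuous_fiberIntegrand {y : X × X} (hy : y.1 ∈ U) : Continuous (fiberIntegrand σ y) :=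
  h.contDiffOn_fiberIntegrand.continuousOn.comp_continuous (f := fun s : ℝ => (y, s))
    (by fun_prop) fun _ => ⟨hy, trivial⟩

lemma fiberPotential_apply {y : X × X} (hy : y.1 ∈ U) (w : X × X) :
    fiberPotential σ y ![w] = ∫ s in (0 : ℝ)..1, σ (y.1, s • y.2) ![(0, y.2), (w.1, 0)] := by
  have := (ContinuousAlternatingMap.apply ℝ (X × X) ℝ ![w]).intervalIntegral_comp_comm
    ((h.continuous_fiberIntegrand hy).intervalIntegrable (μ := MeasureTheory.volume) 0 1)
  refine this.symm.trans (intervalIntegral.integral_congr fun s _ => ?_)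
  exact fiberIntegrand_apply σ y s w

/-- Product rule: `y` enters through the point `(y.1, s • y.2)` and, linearly, through the
contracted vector `(0, y.2)`. -/
lemma fderiv_fiberIntegrand {y : X × X} (hy : y.1 ∈ U) (s : ℝ) (w w' : X × X) :
    fderiv ℝ (fun y => fiberIntegrand σ y s ![w']) y w =
      fderiv ℝ (fun z => σ z ![(0, y.2), (w'.1, 0)]) (y.1, s • y.2) (w.1, s • w.2) +
        σ (y.1, s • y.2) ![(0, w.2), (w'.1, 0)] := by
  have hd : DifferentiableAt ℝ (fun y => fiberIntegrand σ y s ![w']) y :=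
    (fderiv_left_eq (f := fun y s => fiberIntegrand σ y s ![w']) h.isOpen'
      ((h.contDiffOn_fiberIntegrand_apply w').of_le (by exact_mod_cast le_top))
      hy s).differentiableAt
  refine (hasDerivAt_line hd w).unique ?_
  have hz : (y.1, s • y.2).1 ∈ U := hy
  have h1 := hasDerivAt_line (h.diffAt hz (0, y.2) (w'.1, 0)) (w.1, s • w.2)
  have h2 := (hasDerivAt_id (0 : ℝ)).mul
    (hasDerivAt_line (h.diffAt hz (0, w.2) (w'.1, 0)) (w.1, s • w.2))
  convert! h1.add h2 using 1
  · funext r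
    rw [fiberIntegrand_apply]
    have e1 : ((y + r • w).1, s • (y + r • w).2) = (y.1, s • y.2) + r • (w.1, s • w.2) := by
      ext <;> simp [smul_smul, mul_comm]
    have e2 : ((0, (y + r • w).2) : X × X) = (0, y.2) + r • (0, w.2) := by ext <;> simp
    rw [e1, e2, alt_add_left, alt_smul_left]
    rfl
  · simp

/-- Cartan's formula for the dilations `(x, v) ↦ (x, s v)`: since `σ` is closed, the `s`-derivative
of its pull-back is the exterior derivative of the contraction with `(0, y.2)`, that is, of
`fiberIntegrand`. -/
lemma hasDerivAt_dilation {y : X × X} (hy : y.1 ∈ U) (s : ℝ) (w w' : X × X) :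
    HasDerivAt (fun s : ℝ => σ (y.1, s • y.2) ![(w.1, s • w.2), (w'.1, s • w'.2)])
      (fderiv ℝ (fun y => fiberIntegrand σ y s ![w']) y w -
        fderiv ℝ (fun y => fiberIntegrand σ y s ![w]) y w') s := by
  have hz : (y.1, s • y.2).1 ∈ U := hy
  set z : X × X := (y.1, s • y.2) with hzdef
  have hl := fun p q : X × X => hasDerivAt_line (h.diffAt hz p q) (0, y.2)
  have h1 := hl (w.1, s • w.2) (w'.1, s • w'.2)
  have h2 := (hasDerivAt_id (0 : ℝ)).mul (hl (0, w.2) (w'.1, s • w'.2))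
  have h3 := (hasDerivAt_id (0 : ℝ)).mul (hl (w.1, s • w.2) (0, w'.2))
  -- Shift the parameter to differentiate at `r = 0`. Expanding both arguments in `r`, the quadratic
  -- term pairs two vertical vectors and vanishes, leaving a frozen derivative and two linear terms.
  have key : HasDerivAt (fun r : ℝ => σ (y.1, (s + r) • y.2)
      ![(w.1, (s + r) • w.2), (w'.1, (s + r) • w'.2)])
      (fderiv ℝ (fun y => fiberIntegrand σ y s ![w']) y w -
        fderiv ℝ (fun y => fiberIntegrand σ y s ![w]) y w') 0 := by
    convert! (h1.add h2).add h3 using 1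
    · funext r
      have e1 : (y.1, (s + r) • y.2) = z + r • ((0, y.2) : X × X) := by
        ext <;> simp [hzdef, add_smul]
      have e2 : ∀ w : X × X, (w.1, (s + r) • w.2) = (w.1, s • w.2) + r • ((0, w.2) : X × X) := by
        intro w; ext <;> simp [add_smul]
      have hr : (z + r • ((0, y.2) : X × X)).1 ∈ U := by simpa using hz
      rw [e1, e2, e2, alt_add_left, alt_add_right, alt_add_right, alt_smul_left, alt_smul_left,
        alt_smul_right, alt_smul_right, h.vert_vert _ hr]
      simp only [Pi.add_apply, Pi.mul_apply, id]
      ring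
    · rw [h.fderiv_fiberIntegrand hy, h.fderiv_fiberIntegrand hy]
      have hc := h.closed_apply hz (0, y.2) (w.1, s • w.2) (w'.1, s • w'.2)
      have e3 : ∀ w : X × X, (fun z => σ z ![(0, y.2), (w.1, s • w.2)]) =ᶠ[𝓝 z]
          fun z => σ z ![(0, y.2), (w.1, 0)] := by
        intro w
        filter_upwards [h.isOpen'.mem_nhds hz] with z hz using h.apply_vert_left hz _ _
      rw [(e3 w).fderiv_eq, (e3 w').fderiv_eq] at hc
      have e4 := h.apply_vert_left hz w.2 (w'.1, s • w'.2)
      have e5 := h.apply_vert_left hz w'.2 (w.1, s • w.2)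
      have e6 := alt_swap (σ z) (w.1, s • w.2) (0, w'.2)
      simp only [id, zero_smul, add_zero, one_mul, zero_mul]
      rw [← hzdef, e4, e6, e5]
      linarith
  rw [← sub_self s] at key
  simpa using key.comp_sub_const s s

/-- Poincaré lemma along the fibres: integrate `hasDerivAt_dilation` over `[0, 1]`. The dilation is
the identity at `s = 1` and collapses onto the zero section at `s = 0`. -/
lemma extDeriv_fiberPotential {y : X × X} (hy : y.1 ∈ U) (w w' : X × X) :
    extDeriv (fiberPotential σ) y ![w, w'] =
      σ y ![w, w'] - σ (y.1, 0) ![(w.1, 0), (w'.1, 0)] := by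
  have hsm : ∀ w, ContDiffOn ℝ 1 (fun p : (X × X) × ℝ => fiberIntegrand σ p.1 p.2 ![w])
      ((Prod.fst ⁻¹' U) ×ˢ Set.univ) := fun w =>
    (h.contDiffOn_fiberIntegrand_apply w).of_le (by exact_mod_cast le_top)
  have hcont : ∀ w w', Continuous fun s => fderiv ℝ (fun y => fiberIntegrand σ y s ![w']) y w :=
    fun w w' => (continuous_fderiv_left (f := fun y s => fiberIntegrand σ y s ![w']) h.isOpen'
      (hsm w') hy).clm_apply continuous_const
  have hfd : ∀ w w', fderiv ℝ (fun y => fiberPotential σ y ![w']) y w =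
      ∫ s in (0 : ℝ)..1, fderiv ℝ (fun y => fiberIntegrand σ y s ![w']) y w := by
    intro w w'
    have h1 := hasFDerivAt_parametric_integral (f := fun y s => fiberIntegrand σ y s ![w'])
      h.isOpen' (hsm w') (x := y) hy
    have h2 : (fun y => fiberPotential σ y ![w']) =ᶠ[𝓝 y]
        fun y => ∫ s in (0 : ℝ)..1, fiberIntegrand σ y s ![w'] := by
      filter_upwards [h.isOpen'.mem_nhds hy] with z hz
      rw [h.fiberPotential_apply hz]
      exact intervalIntegral.integral_congr fun s _ => (fiberIntegrand_apply σ z s w').symm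
    rw [h2.fderiv_eq, h1.fderiv]
    exact ContinuousLinearMap.intervalIntegral_apply
      ((continuous_fderiv_left (f := fun y s => fiberIntegrand σ y s ![w']) h.isOpen'
      (hsm w') hy).intervalIntegrable _ _) w
  have hdiff : DifferentiableAt ℝ (fiberPotential σ) y :=
    (h.contDiffOn_fiberPotential.contDiffAt (h.isOpen'.mem_nhds hy)).differentiableAt (by simp)
  rw [extDeriv_oneForm_apply hdiff, hfd, hfd, ← intervalIntegral.integral_sub
    ((hcont _ _).intervalIntegrable _ _) ((hcont _ _).intervalIntegrable _ _),
    intervalIntegral.integral_eq_sub_of_hasDerivAt (fun s _ => h.hasDerivAt_dilation hy s w w')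
      (((hcont _ _).sub (hcont _ _)).intervalIntegrable _ _)]
  simp

end LagrangianRep

end Homotopy

/-! ## Lagrange functions with Euler-Lagrange expressions of second order -/

section Lagrangian

variable {m : ℕ}

/-- The projection `(t, x, v, …) ↦ (t, x, v)`. -/
def jetProj {n : ℕ} [NeZero n] : ℝ × (Fin n → Coord m) →L[ℝ] ℝ × Coord m × Coord m :=
  (ContinuousLinearMap.fst ℝ ℝ (Fin n → Coord m)).prod
    (((ContinuousLinearMap.proj 0).comp (.snd ℝ ℝ (Fin n → Coord m))).prod
      ((ContinuousLinearMap.proj 1).comp (.snd ℝ ℝ (Fin n → Coord m))))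

lemma jetProj_apply {n : ℕ} [NeZero n] (z : ℝ × (Fin n → Coord m)) :
    jetProj z = (z.1, z.2 0, z.2 1) := rfl

/-- The direction `∂/∂ẍ`. -/
def accDir : Coord m →L[ℝ] ℝ × (Fin 3 → Coord m) :=
  (ContinuousLinearMap.inr ℝ ℝ (Fin 3 → Coord m)).comp
    (ContinuousLinearMap.single ℝ (fun _ => Coord m) 2)

lemma accDir_apply (u : Coord m) : accDir u = (0, Pi.single 2 u) := rfl

lemma jetProj_accDir (u : Coord m) : jetProj (accDir u) = 0 := by
  refine Prod.ext rfl (Prod.ext ?_ ?_)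
  · change (Pi.single 2 u : Fin 3 → Coord m) 0 = 0
    rw [Pi.single_eq_of_ne (by decide)]
  · change (Pi.single 2 u : Fin 3 → Coord m) 1 = 0
    rw [Pi.single_eq_of_ne (by decide)]

/-- The inclusion `(t, x, v) ↦ (t, x, v, 0)`. -/
def jetIncl (w : ℝ × Coord m × Coord m) : ℝ × (Fin 3 → Coord m) := (w.1, ![w.2.1, w.2.2, 0])

lemma contDiff_jetIncl : ContDiff ℝ ∞ (jetIncl (m := m)) := by
  refine contDiff_fst.prodMk (contDiff_pi.2 fun i => ?_)
  fin_cases i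
  · exact contDiff_fst.comp contDiff_snd
  · exact contDiff_snd.comp contDiff_snd
  · exact contDiff_const

lemma jet_eq (z : ℝ × (Fin 3 → Coord m)) :
    z = jetIncl (jetProj z) + (1 : ℝ) • accDir (z.2 2) := by
  refine Prod.ext (by simp [jetIncl, jetProj_apply, accDir_apply]) ?_
  rw [one_smul]
  funext k
  fin_cases k
  · change z.2 0 = z.2 0 + (Pi.single 2 (z.2 2) : Fin 3 → Coord m) 0
    rw [Pi.single_eq_of_ne (by decide), add_zero]
  · change z.2 1 = z.2 1 + (Pi.single 2 (z.2 2) : Fin 3 → Coord m) 1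
    rw [Pi.single_eq_of_ne (by decide), add_zero]
  · change z.2 2 = 0 + (Pi.single 2 (z.2 2) : Fin 3 → Coord m) 2
    rw [Pi.single_eq_same, zero_add]

/-- The jets over `U`. -/
def jetTube (n : ℕ) [NeZero n] (U : Set (Coord m)) : Set (ℝ × (Fin n → Coord m)) :=
  {z | z.2 0 ∈ U}

variable {U : Set (Coord m)}

lemma isOpen_jetTube (n : ℕ) [NeZero n] (hU : IsOpen U) : IsOpen (jetTube n U) :=
  hU.preimage ((continuous_apply 0).comp continuous_snd)

/-- Functions affine in the accelerations. -/
lemma hasFDerivAt_affine {F : ℝ × (Fin 3 → Coord m) → ℝ} {A : ℝ × Coord m × Coord m → ℝ}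
    {B : ℝ × Coord m × Coord m → Coord m →L[ℝ] ℝ} (hU : IsOpen U)
    (hF : ∀ z ∈ jetTube 3 U, F z = A (jetProj z) + B (jetProj z) (z.2 2))
    {z : ℝ × (Fin 3 → Coord m)} (hz : z ∈ jetTube 3 U)
    (hA : DifferentiableAt ℝ A (jetProj z)) (hB : DifferentiableAt ℝ B (jetProj z))
    (ζ : ℝ × (Fin 3 → Coord m)) :
    fderiv ℝ F z ζ = fderiv ℝ A (jetProj z) (jetProj ζ) +
      fderiv ℝ B (jetProj z) (jetProj ζ) (z.2 2) + B (jetProj z) (ζ.2 2) := by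
  have h1 : F =ᶠ[𝓝 z] fun z => A (jetProj z) + B (jetProj z) (z.2 2) := by
    filter_upwards [(isOpen_jetTube 3 hU).mem_nhds hz] with y hy using hF y hy
  have h2 : HasFDerivAt (fun z : ℝ × (Fin 3 → Coord m) => z.2 2)
    ((ContinuousLinearMap.proj 2).comp (.snd ℝ ℝ (Fin 3 → Coord m))) z :=
    ((ContinuousLinearMap.proj (R := ℝ) (φ := fun _ : Fin 3 => Coord m) 2).comp
      (.snd ℝ ℝ (Fin 3 → Coord m))).hasFDerivAt
  have h3 := (hA.hasFDerivAt.comp z jetProj.hasFDerivAt).add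
    ((hB.hasFDerivAt.comp z jetProj.hasFDerivAt).clm_apply h2)
  rw [h1.fderiv_eq]
  refine (DFunLike.congr_fun h3.fderiv ζ).trans ?_
  simp
  ring

variable {r : ℕ}

lemma contDiffOn_totalDeriv (hU : IsOpen U) {f : ℝ × (Fin (r + 1) → Coord m) → ℝ}
    (hf : ContDiffOn ℝ ∞ f (jetTube (r + 1) U)) :
    ContDiffOn ℝ ∞ (totalDeriv f) (jetTube (r + 2) U) := by
  have h1 : ContDiffOn ℝ ∞ (fderiv ℝ f) (jetTube (r + 1) U) :=
    hf.fderiv_of_isOpen (isOpen_jetTube _ hU) (by simp)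
  have h2 : ContDiff ℝ ∞ (fun z : ℝ × (Fin (r + 2) → Coord m) =>
      ((z.1, fun k => z.2 k.castSucc) : ℝ × (Fin (r + 1) → Coord m))) := by fun_prop
  have h3 : ContDiff ℝ ∞ (fun z : ℝ × (Fin (r + 2) → Coord m) =>
      ((1, fun k => z.2 k.succ) : ℝ × (Fin (r + 1) → Coord m))) := by fun_prop
  exact (h1.comp h2.contDiffOn fun z hz => hz).clm_apply h3.contDiffOn

/-- The highest velocity enters `df/dt` only through the direction of differentiation, hence
affinely, with coefficient the derivative of `f` in its own highest velocity. -/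
lemma fderiv_totalDeriv_last (hU : IsOpen U) {f : ℝ × (Fin (r + 1) → Coord m) → ℝ}
    (hf : ContDiffOn ℝ ∞ f (jetTube (r + 1) U)) {z : ℝ × (Fin (r + 2) → Coord m)}
    (hz : z ∈ jetTube (r + 2) U) (w : Coord m) :
    fderiv ℝ (totalDeriv f) z (0, Pi.single (Fin.last (r + 1)) w) =
      fderiv ℝ f (z.1, fun k => z.2 k.castSucc) (0, Pi.single (Fin.last r) w) := by
  have hd : DifferentiableAt ℝ (totalDeriv f) z :=
    ((contDiffOn_totalDeriv hU hf).contDiffAt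
      ((isOpen_jetTube _ hU).mem_nhds hz)).differentiableAt (by simp)
  refine (hasDerivAt_line hd _).unique ?_
  have h1 := ((hasDerivAt_id (0 : ℝ)).mul_const (fderiv ℝ f (z.1, fun k => z.2 k.castSucc)
    (0, Pi.single (Fin.last r) w))).const_add (totalDeriv f z)
  convert! h1 using 1
  · funext s
    rw [totalDeriv, totalDeriv]
    have e1 : (((z + s • ((0, Pi.single (Fin.last (r + 1)) w) :
        ℝ × (Fin (r + 2) → Coord m))).1, fun k => (z + s • ((0, Pi.single (Fin.last (r + 1)) w) :
        ℝ × (Fin (r + 2) → Coord m))).2 k.castSucc) : ℝ × (Fin (r + 1) → Coord m)) =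
        (z.1, fun k => z.2 k.castSucc) := by
      refine Prod.ext (by simp) (funext fun k => ?_)
      simp [(Fin.castSucc_lt_last k).ne]
    have e2 : ((1, fun k => (z + s • ((0, Pi.single (Fin.last (r + 1)) w) :
        ℝ × (Fin (r + 2) → Coord m))).2 k.succ) : ℝ × (Fin (r + 1) → Coord m)) =
        (1, fun k => z.2 k.succ) + s • (0, Pi.single (Fin.last r) w) := by
      refine Prod.ext (by simp) (funext fun k => ?_)
      simp [Pi.single_apply, ← Fin.succ_last]
    rw [e1, e2, map_add, map_smul]
    rfl
  · simp

/-- Isolates the dependence of `d²f/dt²` on its highest velocity; for `f = ∂L/∂ẍⁱ` this is the whole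
fourth order dependence of the Euler-Lagrange expression. -/
lemma totalDeriv_totalDeriv_sub (hU : IsOpen U) {f : ℝ × (Fin (r + 1) → Coord m) → ℝ}
    (hf : ContDiffOn ℝ ∞ f (jetTube (r + 1) U)) {z z' : ℝ × (Fin (r + 3) → Coord m)}
    (hz : z ∈ jetTube (r + 3) U) (h0 : z'.1 = z.1)
    (h1 : ∀ k : Fin (r + 2), z'.2 k.castSucc = z.2 k.castSucc) :
    totalDeriv (totalDeriv f) z' - totalDeriv (totalDeriv f) z =
      fderiv ℝ f (z.1, fun k => z.2 k.castSucc.castSucc)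
        (0, Pi.single (Fin.last r) (z'.2 (Fin.last _) - z.2 (Fin.last _))) := by
  have hz' : ((z.1, fun k => z.2 k.castSucc) : ℝ × (Fin (r + 2) → Coord m)) ∈ jetTube (r + 2) U :=
    hz
  rw [← fderiv_totalDeriv_last hU hf hz', totalDeriv, totalDeriv, h0, funext h1, ← map_sub]
  congr 1
  refine Prod.ext (by simp) (funext fun k => ?_)
  rcases Fin.eq_castSucc_or_eq_last k with ⟨j, rfl⟩ | rfl
  · have := h1 j.succ
    rw [← Fin.succ_castSucc] at this
    simp [this, (Fin.castSucc_lt_last j).ne]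
  · simp

lemma contDiffOn_jetPartial (hU : IsOpen U) {f : ℝ × (Fin (r + 1) → Coord m) → ℝ}
    (hf : ContDiffOn ℝ ∞ f (jetTube (r + 1) U)) (k : Fin (r + 1)) (i : Fin m) :
    ContDiffOn ℝ ∞ (jetPartial k i f) (jetTube (r + 1) U) :=
  (hf.fderiv_of_isOpen (isOpen_jetTube _ hU) (by simp)).clm_apply contDiffOn_const

variable {L : ℝ × (Fin 3 → Coord m) → ℝ} {c : Fin m → Coord m × Coord m × Coord m → ℝ}

/-- `L` is a smooth Lagrange function over `U` with the second order Euler-Lagrange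
expressions `c`. -/
structure IsLagrangian (U : Set (Coord m)) (c : Fin m → Coord m × Coord m × Coord m → ℝ)
    (L : ℝ × (Fin 3 → Coord m) → ℝ) : Prop where
  isOpen : IsOpen U
  smooth : ContDiffOn ℝ ∞ L (jetTube 3 U)
  euler : ∀ z : ℝ × (Fin 5 → Coord m), z.2 0 ∈ U → ∀ i,
    c i (z.2 0, z.2 1, z.2 2) = eulerLagrange L i z

/-- The coefficient of `ẍ` in a Lagrange function. -/
def accCoeff (L : ℝ × (Fin 3 → Coord m) → ℝ) (w : ℝ × Coord m × Coord m) : Coord m →L[ℝ] ℝ :=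
  (fderiv ℝ L (jetIncl w)).comp accDir

namespace IsLagrangian

variable (h : IsLagrangian U c L)

lemma euler_apply (h : IsLagrangian U c L) (t : ℝ) {x : Coord m} (hx : x ∈ U) (v a b d : Coord m)
    (i : Fin m) : c i (x, v, a) = jetPartial 0 i L (t, ![x, v, a])
      - totalDeriv (jetPartial 1 i L) (t, ![x, v, a, b])
      + totalDeriv (totalDeriv (jetPartial 2 i L)) (t, ![x, v, a, b, d]) := by
  have h1 := h.euler (t, ![x, v, a, b, d]) hx i
  rw [eulerLagrange] at h1
  have e1 : (fun k : Fin 3 => (![x, v, a, b, d] : Fin 5 → Coord m) (Fin.castLE (by norm_num) k)) =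
    ![x, v, a] := by funext k; fin_cases k <;> rfl
  have e2 : (fun k : Fin 4 => (![x, v, a, b, d] : Fin 5 → Coord m) (Fin.castLE (by norm_num) k)) =
    ![x, v, a, b] := by funext k; fin_cases k <;> rfl
  simp only [e1, e2] at h1
  exact h1

lemma eq_vec (z : ℝ × (Fin 3 → Coord m)) : z = (z.1, ![z.2 0, z.2 1, z.2 2]) :=
  Prod.ext rfl (by funext k; fin_cases k <;> rfl)

include h

lemma contDiffAt {z : ℝ × (Fin 3 → Coord m)} (hz : z ∈ jetTube 3 U) : ContDiffAt ℝ ∞ L z :=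
  h.smooth.contDiffAt ((isOpen_jetTube 3 h.isOpen).mem_nhds hz)

/-- The fourth order velocity occurs in the Euler-Lagrange expression with coefficient `∂²L/∂ẍ∂ẍ`,
while `c` contains no such velocity. Compare the values `0` and `w` of that velocity. -/
lemma fderiv_jetPartial_acc {z : ℝ × (Fin 3 → Coord m)} (hz : z ∈ jetTube 3 U) (i : Fin m)
    (w : Coord m) : fderiv ℝ (jetPartial 2 i L) z (accDir w) = 0 := by
  have h1 := h.euler_apply z.1 hz (z.2 1) (z.2 2) 0 0 i
  have h2 := h.euler_apply z.1 hz (z.2 1) (z.2 2) 0 w i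
  have h3 := totalDeriv_totalDeriv_sub h.isOpen (contDiffOn_jetPartial h.isOpen h.smooth 2 i)
    (z := (z.1, ![z.2 0, z.2 1, z.2 2, 0, 0])) (z' := (z.1, ![z.2 0, z.2 1, z.2 2, 0, w])) hz rfl
    (fun k => by fin_cases k <;> rfl)
  have e1 : ((z.1, fun k : Fin 3 => (![z.2 0, z.2 1, z.2 2, 0, 0] : Fin 5 → Coord m)
      k.castSucc.castSucc) : ℝ × (Fin 3 → Coord m)) = z := by
    conv_rhs => rw [eq_vec z]
    exact Prod.ext rfl (by funext k; fin_cases k <;> rfl)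
  have h4 : fderiv ℝ (jetPartial 2 i L) z (0, Pi.single (Fin.last 2) (w - 0)) = 0 := by
    rw [← e1]
    refine h3.symm.trans ?_
    linarith
  rw [sub_zero] at h4
  exact h4

omit h in
lemma add_smul_accDir_mem {z : ℝ × (Fin 3 → Coord m)} (hz : z ∈ jetTube 3 U) (s : ℝ) (w : Coord m) :
    z + s • accDir w ∈ jetTube 3 U := by
  change z.2 0 + s • (Pi.single 2 w : Fin 3 → Coord m) 0 ∈ U
  rw [Pi.single_eq_of_ne (by decide), smul_zero, add_zero]
  exact hz

omit h in
lemma clm_ext_stdVec {f g : Coord m →L[ℝ] ℝ} (hfg : ∀ i, f (stdVec i) = g (stdVec i)) : f = g := by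
  refine ContinuousLinearMap.coe_injective
    ((EuclideanSpace.basisFun (Fin m) ℝ).toBasis.ext fun i => ?_)
  simpa [stdVec] using hfg i

omit h in
lemma eq_of_hasDerivAt_line {f : ℝ → ℝ} {d : ℝ} (hf : ∀ s, HasDerivAt f d s) : f 1 = f 0 + d := by
  have h1 : ∀ s, HasDerivAt (fun s => f s - s * d) 0 s := fun s => by
    have := (hf s).fun_sub ((hasDerivAt_id s).mul_const d)
    simpa using this
  have h2 := is_const_of_deriv_eq_zero (fun s => (h1 s).differentiableAt)
    (fun s => (h1 s).deriv) 1 0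
  simp at h2
  linarith

omit h in
lemma hasDerivAt_line' {E : Type*} [NormedAddCommGroup E] [NormedSpace ℝ E] {f : E → ℝ} {z d : E}
    {s : ℝ} (hf : DifferentiableAt ℝ f (z + s • d)) :
    HasDerivAt (fun s : ℝ => f (z + s • d)) (fderiv ℝ f (z + s • d) d) s := by
  have h1 : HasDerivAt (fun s : ℝ => z + s • d) d s := by
    simpa using ((hasDerivAt_id s).smul_const d).const_add z
  exact hf.hasFDerivAt.comp_hasDerivAt s h1

omit h in
lemma jetIncl_mem {z : ℝ × (Fin 3 → Coord m)} (hz : z ∈ jetTube 3 U) :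
    jetIncl (jetProj z) ∈ jetTube 3 U := hz

/-- As `∂²L/∂ẍ∂ẍ = 0`, the derivative `∂L/∂ẍ` is constant along each segment from acceleration `0`
to `z.2 2`; all accelerations are admissible, so the segment stays in the domain. -/
lemma fderiv_accDir {z : ℝ × (Fin 3 → Coord m)} (hz : z ∈ jetTube 3 U) (u : Coord m) :
    fderiv ℝ L z (accDir u) = accCoeff L (jetProj z) u := by
  suffices hs : (fderiv ℝ L z).comp accDir = accCoeff L (jetProj z) from DFunLike.congr_fun hs u
  refine clm_ext_stdVec fun i => ?_
  change jetPartial 2 i L z = jetPartial 2 i L (jetIncl (jetProj z))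
  have hd : ∀ s : ℝ, HasDerivAt
      (fun s : ℝ => jetPartial 2 i L (jetIncl (jetProj z) + s • accDir (z.2 2))) 0 s := by
    intro s
    have hm := add_smul_accDir_mem (jetIncl_mem hz) s (z.2 2)
    rw [← h.fderiv_jetPartial_acc hm i (z.2 2)]
    exact hasDerivAt_line' (((contDiffOn_jetPartial h.isOpen h.smooth 2 i).contDiffAt
      ((isOpen_jetTube 3 h.isOpen).mem_nhds hm)).differentiableAt (by simp))
  have h1 := eq_of_hasDerivAt_line hd
  rw [← jet_eq z] at h1
  simpa using h1

/-- Integrate once more along the same segment: its derivative is the constant `∂L/∂ẍ` paired with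
the acceleration. -/
lemma eq_affine {z : ℝ × (Fin 3 → Coord m)} (hz : z ∈ jetTube 3 U) :
    L z = L (jetIncl (jetProj z)) + accCoeff L (jetProj z) (z.2 2) := by
  have hd : ∀ s : ℝ, HasDerivAt
      (fun s : ℝ => L (jetIncl (jetProj z) + s • accDir (z.2 2)))
        (accCoeff L (jetProj z) (z.2 2)) s := by
    intro s
    have hm := add_smul_accDir_mem (jetIncl_mem hz) s (z.2 2)
    have e : jetProj (jetIncl (jetProj z) + s • accDir (z.2 2)) = jetProj z := by
      rw [map_add, map_smul, jetProj_accDir, smul_zero, add_zero]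
      rfl
    have h2 := h.fderiv_accDir hm (z.2 2)
    rw [e] at h2
    rw [← h2]
    exact hasDerivAt_line' ((h.contDiffAt hm).differentiableAt (by simp))
  have h1 := eq_of_hasDerivAt_line hd
  rw [← jet_eq z] at h1
  simpa using h1

end IsLagrangian

end Lagrangian

/-! ### The Poincaré-Cartan form and its contact component -/

section Cartan

variable {m : ℕ} {U : Set (Coord m)} {L : ℝ × (Fin 3 → Coord m) → ℝ}
  {c : Fin m → Coord m × Coord m × Coord m → ℝ}

/-- The part of a Lagrange function independent of `ẍ`. -/
def accFree (L : ℝ × (Fin 3 → Coord m) → ℝ) (w : ℝ × Coord m × Coord m) : ℝ := L (jetIncl w)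

/-- The inclusion of vertical vectors. -/
def vVecL (m : ℕ) : Coord m →L[ℝ] ℝ × Coord m × Coord m :=
  (ContinuousLinearMap.inr ℝ ℝ (Coord m × Coord m)).comp (.inr ℝ (Coord m) (Coord m))

/-- The momenta of a Lagrange function affine in the accelerations. -/
def momentum (L : ℝ × (Fin 3 → Coord m) → ℝ) (w : ℝ × Coord m × Coord m) : Coord m →L[ℝ] ℝ :=
  (fderiv ℝ (accFree L) w).comp (vVecL m) - fderiv ℝ (accCoeff L) w (1, w.2.2, 0)

/-- The Poincaré-Cartan form of a Lagrange function affine in the accelerations. -/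
def cartanForm (L : ℝ × (Fin 3 → Coord m) → ℝ) (w : ℝ × Coord m × Coord m) :
    (ℝ × Coord m × Coord m) [⋀^Fin 1]→L[ℝ] ℝ :=
  oneForm ((accFree L w - momentum L w w.2.2) • .fst ℝ ℝ (Coord m × Coord m) +
    (momentum L w).comp ((ContinuousLinearMap.fst ℝ (Coord m) (Coord m)).comp (.snd ℝ ℝ _)) +
    (accCoeff L w).comp ((ContinuousLinearMap.snd ℝ (Coord m) (Coord m)).comp (.snd ℝ ℝ _)))

lemma cartanForm_apply (w ξ : ℝ × Coord m × Coord m) : cartanForm L w ![ξ] =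
    (accFree L w - momentum L w w.2.2) * ξ.1 + momentum L w ξ.2.1 + accCoeff L w ξ.2.2 := rfl

lemma momentum_apply (w : ℝ × Coord m × Coord m) (u : Coord m) : momentum L w u =
    fderiv ℝ (accFree L) w (vVec u) - fderiv ℝ (accCoeff L) w (1, w.2.2, 0) u := rfl

namespace IsLagrangian

variable (h : IsLagrangian U c L)

include h

lemma smooth_accFree : ContDiffOn ℝ ∞ (accFree L) (tube U) :=
  h.smooth.comp contDiff_jetIncl.contDiffOn fun _ hw => hw

lemma smooth_accCoeff : ContDiffOn ℝ ∞ (accCoeff L) (tube U) :=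
  ((h.smooth.fderiv_of_isOpen (isOpen_jetTube 3 h.isOpen) (by simp)).comp
    contDiff_jetIncl.contDiffOn fun _ hw => hw).clm_comp contDiffOn_const

lemma smooth_fderiv_accFree : ContDiffOn ℝ ∞ (fderiv ℝ (accFree L)) (tube U) :=
  h.smooth_accFree.fderiv_of_isOpen (isOpen_tube h.isOpen) (by simp)

lemma smooth_fderiv_accCoeff : ContDiffOn ℝ ∞ (fderiv ℝ (accCoeff L)) (tube U) :=
  h.smooth_accCoeff.fderiv_of_isOpen (isOpen_tube h.isOpen) (by simp)

lemma smooth_momentum : ContDiffOn ℝ ∞ (momentum L) (tube U) :=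
  (h.smooth_fderiv_accFree.clm_comp contDiffOn_const).sub
    (h.smooth_fderiv_accCoeff.clm_apply (by fun_prop))

lemma smooth_cartanForm : ContDiffOn ℝ ∞ (cartanForm L) (tube U) := by
  refine contDiffOn_alternating_iff.2 fun ξ => ?_
  have hξ : ξ = ![ξ 0] := by funext i; fin_cases i; rfl
  rw [hξ]
  simp only [cartanForm_apply]
  exact (((h.smooth_accFree.sub (h.smooth_momentum.clm_apply (by fun_prop))).mul
    contDiffOn_const).add (h.smooth_momentum.clm_apply contDiffOn_const)).add
    (h.smooth_accCoeff.clm_apply contDiffOn_const)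

variable {w : ℝ × Coord m × Coord m} (hw : w ∈ tube U)

omit h in
lemma diffAt_of_smooth (h : IsLagrangian U c L) {F : Type*} [NormedAddCommGroup F] [NormedSpace ℝ F]
    {f : ℝ × Coord m × Coord m → F} (hf : ContDiffOn ℝ ∞ f (tube U)) {w : ℝ × Coord m × Coord m}
    (hw : w ∈ tube U) : DifferentiableAt ℝ f w :=
  (hf.contDiffAt ((isOpen_tube h.isOpen).mem_nhds hw)).differentiableAt (by simp)

lemma jetPartial_apply (k : Fin 3) (i : Fin m) {z : ℝ × (Fin 3 → Coord m)} (hz : z ∈ jetTube 3 U) :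
    jetPartial k i L z =
      fderiv ℝ (accFree L) (jetProj z) (jetProj (0, Pi.single k (stdVec i))) +
      fderiv ℝ (accCoeff L) (jetProj z) (jetProj (0, Pi.single k (stdVec i))) (z.2 2) +
      accCoeff L (jetProj z) ((Pi.single k (stdVec i) : Fin 3 → Coord m) 2) :=
  hasFDerivAt_affine h.isOpen (fun _ hz => h.eq_affine hz) hz
    (h.diffAt_of_smooth h.smooth_accFree hz) (h.diffAt_of_smooth h.smooth_accCoeff hz) _

lemma jetPartial_zero (i : Fin m) {z : ℝ × (Fin 3 → Coord m)} (hz : z ∈ jetTube 3 U) :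
    jetPartial 0 i L z = fderiv ℝ (accFree L) (jetProj z) (hVec (stdVec i)) +
      fderiv ℝ (accCoeff L) (jetProj z) (hVec (stdVec i)) (z.2 2) := by
  have e1 : jetProj (0, Pi.single (0 : Fin 3) (stdVec i : Coord m)) = hVec (stdVec i) := by
    refine Prod.ext rfl (Prod.ext ?_ ?_)
    · change (Pi.single 0 (stdVec i) : Fin 3 → Coord m) 0 = stdVec i
      rw [Pi.single_eq_same]
    · change (Pi.single 0 (stdVec i) : Fin 3 → Coord m) 1 = 0
      rw [Pi.single_eq_of_ne (by decide)]
  rw [h.jetPartial_apply 0 i hz, e1, Pi.single_eq_of_ne (by decide), map_zero, add_zero]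

lemma jetPartial_one (i : Fin m) {z : ℝ × (Fin 3 → Coord m)} (hz : z ∈ jetTube 3 U) :
    jetPartial 1 i L z = fderiv ℝ (accFree L) (jetProj z) (vVec (stdVec i)) +
      fderiv ℝ (accCoeff L) (jetProj z) (vVec (stdVec i)) (z.2 2) := by
  have e1 : jetProj (0, Pi.single (1 : Fin 3) (stdVec i : Coord m)) = vVec (stdVec i) := by
    refine Prod.ext rfl (Prod.ext ?_ ?_)
    · change (Pi.single 1 (stdVec i) : Fin 3 → Coord m) 0 = 0
      rw [Pi.single_eq_of_ne (by decide)]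
    · change (Pi.single 1 (stdVec i) : Fin 3 → Coord m) 1 = stdVec i
      rw [Pi.single_eq_same]
  rw [h.jetPartial_apply 1 i hz, e1, Pi.single_eq_of_ne (by decide), map_zero, add_zero]

lemma totalDeriv_one (i : Fin m) (t : ℝ) {x : Coord m} (hx : x ∈ U) (v a b : Coord m) :
    totalDeriv (jetPartial 1 i L) (t, ![x, v, a, b]) =
      fderiv ℝ (fun w => fderiv ℝ (accFree L) w (vVec (stdVec i))) (t, x, v) (1, v, a) +
      fderiv ℝ (fderiv ℝ (accCoeff L)) (t, x, v) (1, v, a) (vVec (stdVec i)) a +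
      fderiv ℝ (accCoeff L) (t, x, v) (vVec (stdVec i)) b := by
  have hz : ((t, fun k => (![x, v, a, b] : Fin 4 → Coord m) k.castSucc) :
      ℝ × (Fin 3 → Coord m)) ∈ jetTube 3 U := hx
  have hw : (t, x, v) ∈ tube U := hx
  have h1 := hasFDerivAt_affine (F := jetPartial 1 i L)
    (A := fun w => fderiv ℝ (accFree L) w (vVec (stdVec i)))
    (B := fun w => fderiv ℝ (accCoeff L) w (vVec (stdVec i)))
    h.isOpen (fun z hz => h.jetPartial_one i hz) hz
    ((h.diffAt_of_smooth h.smooth_fderiv_accFree hw).clm_apply (differentiableAt_const _))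
    ((h.diffAt_of_smooth h.smooth_fderiv_accCoeff hw).clm_apply (differentiableAt_const _))
    (1, fun k => (![x, v, a, b] : Fin 4 → Coord m) k.succ)
  refine h1.trans ?_
  have h2 : fderiv ℝ (fun w => fderiv ℝ (accCoeff L) w (vVec (stdVec i))) (t, x, v) (1, v, a) =
      fderiv ℝ (fderiv ℝ (accCoeff L)) (t, x, v) (1, v, a) (vVec (stdVec i)) := by
    rw [fderiv_clm_apply (h.diffAt_of_smooth h.smooth_fderiv_accCoeff hw) (by fun_prop)]
    simp
  rw [← h2]
  rfl

lemma totalDeriv_two (i : Fin m) {z : ℝ × (Fin 4 → Coord m)} (hz : z ∈ jetTube 4 U) :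
    totalDeriv (jetPartial 2 i L) z =
      fderiv ℝ (accCoeff L) (jetProj z) (1, z.2 1, z.2 2) (stdVec i) := by
  have hz' : ((z.1, fun k => z.2 k.castSucc) : ℝ × (Fin 3 → Coord m)) ∈ jetTube 3 U := hz
  have hw : jetProj z ∈ tube U := hz
  have h1 := hasFDerivAt_affine (F := jetPartial 2 i L) (A := fun w => accCoeff L w (stdVec i))
    (B := fun _ => 0) h.isOpen
    (fun z hz => (h.fderiv_accDir hz (stdVec i)).trans (by simp)) hz'
    ((h.diffAt_of_smooth h.smooth_accCoeff hw).clm_apply (differentiableAt_const _))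
    (differentiableAt_const _) (1, fun k => z.2 k.succ)
  refine h1.trans ?_
  have h2 : ∀ ξ, fderiv ℝ (fun w => accCoeff L w (stdVec i)) (jetProj z) ξ =
      fderiv ℝ (accCoeff L) (jetProj z) ξ (stdVec i) := by
    intro ξ
    rw [fderiv_clm_apply (h.diffAt_of_smooth h.smooth_accCoeff hw) (by fun_prop)]
    simp
  simp only [fderiv_fun_const, Pi.zero_apply, zero_apply, add_zero]
  exact h2 _

lemma totalDeriv_totalDeriv_two (i : Fin m) (t : ℝ) {x : Coord m} (hx : x ∈ U)
    (v a b d : Coord m) :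
    totalDeriv (totalDeriv (jetPartial 2 i L)) (t, ![x, v, a, b, d]) =
      fderiv ℝ (fderiv ℝ (accCoeff L)) (t, x, v) (1, v, a) (1, v, a) (stdVec i) +
      fderiv ℝ (accCoeff L) (t, x, v) (0, a, b) (stdVec i) := by
  set z : ℝ × (Fin 4 → Coord m) :=
    (t, fun k => (![x, v, a, b, d] : Fin 5 → Coord m) k.castSucc) with hz
  set ζ : ℝ × (Fin 4 → Coord m) :=
    (1, fun k => (![x, v, a, b, d] : Fin 5 → Coord m) k.succ) with hζ
  have hzU : z ∈ jetTube 4 U := hx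
  have hw : jetProj z ∈ tube U := hx
  have h1 : totalDeriv (jetPartial 2 i L) =ᶠ[𝓝 z]
      fun z => fderiv ℝ (accCoeff L) (jetProj z) (1, z.2 1, z.2 2) (stdVec i) := by
    filter_upwards [(isOpen_jetTube 4 h.isOpen).mem_nhds hzU] with y hy using h.totalDeriv_two i hy
  let ℓ : ℝ × (Fin 4 → Coord m) →L[ℝ] ℝ × Coord m × Coord m :=
    (0 : ℝ × (Fin 4 → Coord m) →L[ℝ] ℝ).prod
    (((ContinuousLinearMap.proj 1).comp (.snd ℝ ℝ (Fin 4 → Coord m))).prod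
      ((ContinuousLinearMap.proj 2).comp (.snd ℝ ℝ (Fin 4 → Coord m))))
  have h2 : HasFDerivAt (fun z : ℝ × (Fin 4 → Coord m) =>
      ((1, z.2 1, z.2 2) : ℝ × Coord m × Coord m)) ℓ z := by
    have : (fun z : ℝ × (Fin 4 → Coord m) => ((1, z.2 1, z.2 2) : ℝ × Coord m × Coord m)) =
        fun z => (1, 0, 0) + ℓ z := by
      funext z
      simp [ℓ]
    rw [this]
    exact ℓ.hasFDerivAt.const_add _
  have h3 := (((h.diffAt_of_smooth h.smooth_fderiv_accCoeff hw).hasFDerivAt.comp z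
    jetProj.hasFDerivAt).clm_apply h2).clm_apply (hasFDerivAt_const (stdVec i : Coord m) z)
  refine (DFunLike.congr_fun (h1.fderiv_eq.trans h3.fderiv) ζ).trans ?_
  simp only [Function.comp, ContinuousLinearMap.comp_zero, zero_add,
    ContinuousLinearMap.flip_apply, add_apply, ContinuousLinearMap.comp_apply]
  rw [add_comm]
  rfl

/-- Here `b` is the third order velocity. Neither `t` nor `b` occurs on the left, so both may be
chosen at will in later uses. -/
lemma euler_expanded (t : ℝ) {x : Coord m} (hx : x ∈ U) (v a b : Coord m) (i : Fin m) :
    c i (x, v, a) = fderiv ℝ (accFree L) (t, x, v) (hVec (stdVec i)) +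
      fderiv ℝ (accCoeff L) (t, x, v) (hVec (stdVec i)) a -
      (fderiv ℝ (fun w => fderiv ℝ (accFree L) w (vVec (stdVec i))) (t, x, v) (1, v, a) +
      fderiv ℝ (fderiv ℝ (accCoeff L)) (t, x, v) (1, v, a) (vVec (stdVec i)) a +
      fderiv ℝ (accCoeff L) (t, x, v) (vVec (stdVec i)) b) +
      (fderiv ℝ (fderiv ℝ (accCoeff L)) (t, x, v) (1, v, a) (1, v, a) (stdVec i) +
      fderiv ℝ (accCoeff L) (t, x, v) (0, a, b) (stdVec i)) := by
  rw [h.euler_apply t hx v a b 0 i, h.totalDeriv_one i t hx, h.totalDeriv_totalDeriv_two i t hx,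
    h.jetPartial_zero i (z := (t, ![x, v, a])) hx]
  rfl

include hw

/-- The coefficient of the third order velocity in `euler_expanded` is the antisymmetric part of the
fibre derivative of `accCoeff`; it must vanish. Compare `b = 0` with `b = q` at zero acceleration.
-/
lemma fderiv_accCoeff_symm (p q : Coord m) :
    fderiv ℝ (accCoeff L) w (vVec p) q = fderiv ℝ (accCoeff L) w (vVec q) p := by
  obtain ⟨t, x, v⟩ := w
  have hi : ∀ i, fderiv ℝ (accCoeff L) (t, x, v) (vVec (stdVec i)) q =
      fderiv ℝ (accCoeff L) (t, x, v) (vVec q) (stdVec i) := by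
    intro i
    have h1 := h.euler_expanded t hw v 0 0 i
    have h2 := h.euler_expanded t hw v 0 q i
    have h3 : ((0, 0, 0) : ℝ × Coord m × Coord m) = 0 := rfl
    rw [h3] at h1
    simp only [map_zero, zero_apply] at h1 h2
    change _ = fderiv ℝ (accCoeff L) (t, x, v) (0, 0, q) (stdVec i)
    linarith
  have := clm_ext_stdVec (f := ((fderiv ℝ (accCoeff L) (t, x, v)).comp (vVecL m)).flip q)
    (g := fderiv ℝ (accCoeff L) (t, x, v) (vVec q)) hi
  exact DFunLike.congr_fun this p

lemma fderiv_fderiv_accCoeff_symm (ξ : ℝ × Coord m × Coord m) (p q : Coord m) :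
    fderiv ℝ (fderiv ℝ (accCoeff L)) w ξ (vVec p) q =
      fderiv ℝ (fderiv ℝ (accCoeff L)) w ξ (vVec q) p := by
  have h1 : ∀ p q : Coord m, fderiv ℝ (fun w => fderiv ℝ (accCoeff L) w (vVec p) q) w ξ =
      fderiv ℝ (fderiv ℝ (accCoeff L)) w ξ (vVec p) q := by
    intro p q
    have h2 := ((h.diffAt_of_smooth h.smooth_fderiv_accCoeff hw).hasFDerivAt.clm_apply
      (hasFDerivAt_const (vVec p) w)).clm_apply (hasFDerivAt_const q w)
    refine (DFunLike.congr_fun h2.fderiv ξ).trans ?_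
    simp
  have h2 : (fun w => fderiv ℝ (accCoeff L) w (vVec p) q) =ᶠ[𝓝 w]
      fun w => fderiv ℝ (accCoeff L) w (vVec q) p := by
    filter_upwards [(isOpen_tube h.isOpen).mem_nhds hw] with y hy
      using h.fderiv_accCoeff_symm hy p q
  rw [← h1, ← h1, h2.fderiv_eq]

/-- On the vector `D_a` frozen at `w`, the form is `accFree` plus the momentum applied to `w.2.2 -
y.2.2` plus `accCoeff` applied to `a`. The middle argument vanishes at `y = w`, so no derivative of
the momentum survives. -/
lemma fderiv_cartanForm_curve (a : Coord m) (ξ : ℝ × Coord m × Coord m) :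
    fderiv ℝ (fun y => cartanForm L y ![(1, w.2.2, a)]) w ξ =
      fderiv ℝ (accFree L) w ξ - momentum L w ξ.2.2 + fderiv ℝ (accCoeff L) w ξ a := by
  have hs : HasFDerivAt (fun y : ℝ × Coord m × Coord m => y.2.2)
      ((ContinuousLinearMap.snd ℝ (Coord m) (Coord m)).comp (.snd ℝ ℝ _)) w :=
    ((ContinuousLinearMap.snd ℝ (Coord m) (Coord m)).comp (.snd ℝ ℝ _)).hasFDerivAt
  have hP := (h.diffAt_of_smooth h.smooth_momentum hw).hasFDerivAt
  have h1 := ((((h.diffAt_of_smooth h.smooth_accFree hw).hasFDerivAt.sub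
    (hP.clm_apply hs)).mul_const 1).add (hP.clm_apply (hasFDerivAt_const w.2.2 w))).add
    ((h.diffAt_of_smooth h.smooth_accCoeff hw).hasFDerivAt.clm_apply (hasFDerivAt_const a w))
  refine (DFunLike.congr_fun h1.fderiv ξ).trans ?_
  simp
  ring

lemma fderiv_cartanForm_hor (a : Coord m) (u : Coord m) :
    fderiv ℝ (fun y => cartanForm L y ![hVec u]) w (1, w.2.2, a) =
      fderiv ℝ (fun w => fderiv ℝ (accFree L) w (vVec u)) w (1, w.2.2, a) -
      (fderiv ℝ (fderiv ℝ (accCoeff L)) w (1, w.2.2, a) (1, w.2.2, 0) u +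
      fderiv ℝ (accCoeff L) w (hVec a) u) := by
  let ℓ : ℝ × Coord m × Coord m →L[ℝ] ℝ × Coord m × Coord m :=
    (0 : ℝ × Coord m × Coord m →L[ℝ] ℝ).prod
      (((ContinuousLinearMap.snd ℝ (Coord m) (Coord m)).comp (.snd ℝ ℝ _)).prod 0)
  have hs : HasFDerivAt (fun y : ℝ × Coord m × Coord m =>
      ((1, y.2.2, 0) : ℝ × Coord m × Coord m)) ℓ w := by
    have : (fun y : ℝ × Coord m × Coord m => ((1, y.2.2, 0) : ℝ × Coord m × Coord m)) =
        fun z => (1, 0, 0) + ℓ z := by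
      funext z
      simp [ℓ]
    rw [this]
    exact ℓ.hasFDerivAt.const_add _
  have hf : (fun y => cartanForm L y ![hVec u]) = fun y => fderiv ℝ (accFree L) y (vVec u) -
      fderiv ℝ (accCoeff L) y (1, y.2.2, 0) u := by
    funext y
    rw [cartanForm_apply, ← momentum_apply]
    simp [hVec]
  have h1 : DifferentiableAt ℝ (fun w => fderiv ℝ (accFree L) w (vVec u)) w :=
    (h.diffAt_of_smooth h.smooth_fderiv_accFree hw).clm_apply (differentiableAt_const _)
  have h2 := h1.hasFDerivAt.sub (((h.diffAt_of_smooth h.smooth_fderiv_accCoeff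
    hw).hasFDerivAt.clm_apply hs).clm_apply (hasFDerivAt_const u w))
  rw [hf]
  refine (DFunLike.congr_fun h2.fderiv _).trans ?_
  simp [ℓ, hVec]
  ring

lemma fderiv_cartanForm_vert (p : Coord m) (ξ : ℝ × Coord m × Coord m) :
    fderiv ℝ (fun y => cartanForm L y ![vVec p]) w ξ = fderiv ℝ (accCoeff L) w ξ p := by
  have hf : (fun y => cartanForm L y ![vVec p]) = fun y => accCoeff L y p := by
    funext y
    rw [cartanForm_apply]
    simp [vVec]
  rw [hf, fderiv_clm_apply (h.diffAt_of_smooth h.smooth_accCoeff hw) (by fun_prop)]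
  simp

lemma extDeriv_cartanForm_apply (ξ η : ℝ × Coord m × Coord m) :
    extDeriv (cartanForm L) w ![ξ, η] = fderiv ℝ (fun y => cartanForm L y ![η]) w ξ -
      fderiv ℝ (fun y => cartanForm L y ![ξ]) w η :=
  extDeriv_oneForm_apply (h.diffAt_of_smooth h.smooth_cartanForm hw) ξ η

/-- The momentum is defined so that the terms without `a` cancel; those linear in `a` cancel by the
symmetry of the fibre derivative of `accCoeff`. -/
lemma extDeriv_cartanForm_vert (a p : Coord m) :
    extDeriv (cartanForm L) w ![vVec p, (1, w.2.2, a)] = 0 := by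
  have e : ((1, w.2.2, a) : ℝ × Coord m × Coord m) = (1, w.2.2, 0) + vVec a := by simp [vVec]
  rw [h.extDeriv_cartanForm_apply hw, h.fderiv_cartanForm_curve hw, h.fderiv_cartanForm_vert hw,
    show (vVec p : ℝ × Coord m × Coord m).2.2 = p from rfl, momentum_apply, e, map_add,
    add_apply, h.fderiv_accCoeff_symm hw a p]
  ring

/-- The contraction reproduces the Euler-Lagrange expression with third order velocity set to `0`.
The second derivatives of `accCoeff` paired with a vertical vector match only after applying
`fderiv_fderiv_accCoeff_symm`. -/
lemma extDeriv_cartanForm_hor_std (a : Coord m) (i : Fin m) :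
    extDeriv (cartanForm L) w ![hVec (stdVec i), (1, w.2.2, a)] = c i (w.2.1, w.2.2, a) := by
  have e : ((1, w.2.2, a) : ℝ × Coord m × Coord m) = (1, w.2.2, 0) + vVec a := by simp [vVec]
  rw [h.extDeriv_cartanForm_apply hw, h.fderiv_cartanForm_curve hw, h.fderiv_cartanForm_hor hw,
    h.euler_expanded w.1 hw w.2.2 a 0 i, h.fderiv_fderiv_accCoeff_symm hw _ (stdVec i) a,
    show (hVec (stdVec i) : ℝ × Coord m × Coord m).2.2 = 0 from rfl, map_zero]
  have h1 : fderiv ℝ (fderiv ℝ (accCoeff L)) w (1, w.2.2, a) (1, w.2.2, a) (stdVec i) =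
      fderiv ℝ (fderiv ℝ (accCoeff L)) w (1, w.2.2, a) (1, w.2.2, 0) (stdVec i) +
      fderiv ℝ (fderiv ℝ (accCoeff L)) w (1, w.2.2, a) (vVec a) (stdVec i) := by
    conv_lhs => rw [show fderiv ℝ (fderiv ℝ (accCoeff L)) w (1, w.2.2, a) (1, w.2.2, a) =
      fderiv ℝ (fderiv ℝ (accCoeff L)) w (1, w.2.2, a) ((1, w.2.2, 0) + vVec a) by rw [← e]]
    rw [map_add]
    rfl
  have h2 : (w.1, w.2.1, w.2.2) = w := rfl
  rw [h2, h1, map_zero, hVec, hVec]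
  ring

omit hw

lemma closedRep (hc : ∀ x ∈ U, ∀ (v : Coord m) (i : Fin m),
      DifferentiableAt ℝ (fun v => c i (x, v, 0)) v) :
    ClosedRep U (fun x v a u => ∑ i, c i (x, v, a) * u i) (extDeriv (cartanForm L)) where
  isOpen := h.isOpen
  smooth := by
    refine contDiffOn_alternating_iff.2 fun ξ => ?_
    have hξ : ξ = ![ξ 0, ξ 1] := by funext i; fin_cases i <;> rfl
    rw [hξ]
    have h1 : ∀ ξ η : ℝ × Coord m × Coord m, ContDiffOn ℝ ∞
        (fun w => fderiv ℝ (fun y => cartanForm L y ![η]) w ξ) (tube U) := fun ξ η =>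
      ((contDiffOn_alternating_iff.1 h.smooth_cartanForm ![η]).fderiv_of_isOpen
        (isOpen_tube h.isOpen) (by simp)).clm_apply contDiffOn_const
    exact ((h1 _ _).sub (h1 _ _)).congr fun w hw => h.extDeriv_cartanForm_apply hw _ _
  closed z hz := extDeriv_extDeriv_apply (r := ∞)
    (h.smooth_cartanForm.contDiffAt ((isOpen_tube h.isOpen).mem_nhds hz))
    (by simp only [minSmoothness_of_isRCLikeNormedField]; exact WithTop.coe_le_coe.2 le_top)
  horizontal z hz a u := by
    -- Both sides are linear in `u`, so the identity for the standard basis suffices.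
    let f : Coord m →ₗ[ℝ] ℝ :=
      { toFun := fun u => extDeriv (cartanForm L) z ![hVec u, (1, z.2.2, a)]
        map_add' := fun u u' => by
          rw [← alt_add_left]; congr 2; simp [hVec]
        map_smul' := fun r u => by
          rw [RingHom.id_apply, smul_eq_mul, ← alt_smul_left]; congr 2; simp [hVec] }
    let g : Coord m →L[ℝ] ℝ :=
      ∑ i, c i (z.2.1, z.2.2, a) • (EuclideanSpace.proj i : Coord m →L[ℝ] ℝ)
    have h1 : LinearMap.toContinuousLinearMap f = g := by
      refine clm_ext_stdVec fun i => ?_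
      refine (h.extDeriv_cartanForm_hor_std hz a i).trans ?_
      simp [g, stdVec]
    refine (DFunLike.congr_fun h1 u).trans ?_
    simp [g]
  vertical z hz a p := h.extDeriv_cartanForm_vert hz a p
  diff x hx v u := by
    refine DifferentiableAt.fun_sum fun i _ => ?_
    exact (hc x hx v i).mul_const _

end IsLagrangian

end Cartan

/-! ## Decomposition of closed forms -/

section Decomposition

variable {X : Type} [NormedAddCommGroup X] [NormedSpace ℝ X]

/-- The restriction of a two-form to `t = 0`. -/
def spatialPart (α : ℝ × X × X → (ℝ × X × X) [⋀^Fin 2]→L[ℝ] ℝ) (y : X × X) :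
    (X × X) [⋀^Fin 2]→L[ℝ] ℝ :=
  (α (0, y)).compContinuousLinearMap (.inr ℝ ℝ (X × X))

/-- The contraction of a two-form with `∂/∂t`, restricted to `t = 0`. -/
def timePart (α : ℝ × X × X → (ℝ × X × X) [⋀^Fin 2]→L[ℝ] ℝ) (y : X × X) :
    (X × X) [⋀^Fin 1]→L[ℝ] ℝ :=
  ((α (0, y)).curryLeft tVec).compContinuousLinearMap (.inr ℝ ℝ (X × X))

/-- The form `t` times the contraction with `∂/∂t`. -/
def timePotential (α : ℝ × X × X → (ℝ × X × X) [⋀^Fin 2]→L[ℝ] ℝ) (z : ℝ × X × X) :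
    (ℝ × X × X) [⋀^Fin 1]→L[ℝ] ℝ :=
  z.1 • (timePart α z.2).compContinuousLinearMap (.snd ℝ ℝ (X × X))

/-- The pull-back of the restriction of a two-form to the zero section. -/
def zeroSectionPart (σ : X × X → (X × X) [⋀^Fin 2]→L[ℝ] ℝ) (y : X × X) :
    (X × X) [⋀^Fin 2]→L[ℝ] ℝ :=
  (σ (y.1, 0)).compContinuousLinearMap ((ContinuousLinearMap.inl ℝ X X).comp (.fst ℝ X X))

variable (α : ℝ × X × X → (ℝ × X × X) [⋀^Fin 2]→L[ℝ] ℝ)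

lemma spatialPart_apply (y w w' : X × X) :
    spatialPart α y ![w, w'] = α (0, y) ![(0, w), (0, w')] := by
  refine congrArg (α (0, y)) ?_
  funext i; fin_cases i <;> rfl

lemma timePart_apply (y w : X × X) : timePart α y ![w] = α (0, y) ![tVec, (0, w)] := by
  rw [timePart, ContinuousAlternatingMap.compContinuousLinearMap_apply,
    ContinuousAlternatingMap.curryLeft_apply_apply]
  refine congrArg (α (0, y)) ?_
  funext i; fin_cases i <;> rfl

lemma timePotential_apply (z w : ℝ × X × X) :
    timePotential α z ![w] = z.1 * timePart α z.2 ![w.2] := by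
  refine congrArg (z.1 * ·) (congrArg (timePart α z.2) ?_)
  funext i; fin_cases i; rfl

lemma zeroSectionPart_apply (σ : X × X → (X × X) [⋀^Fin 2]→L[ℝ] ℝ) (y w w' : X × X) :
    zeroSectionPart σ y ![w, w'] = σ (y.1, 0) ![(w.1, 0), (w'.1, 0)] := by
  refine congrArg (σ (y.1, 0)) ?_
  funext i; fin_cases i <;> rfl

lemma contDiffOn_zeroSectionPart [FiniteDimensional ℝ X] {U : Set X}
    {σ : X × X → (X × X) [⋀^Fin 2]→L[ℝ] ℝ}
    (hσ : ContDiffOn ℝ ∞ σ (Prod.fst ⁻¹' U)) :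
    ContDiffOn ℝ ∞ (zeroSectionPart σ) (Prod.fst ⁻¹' U) := by
  refine contDiffOn_alternating_iff.2 fun w => ?_
  exact contDiffOn_alternating_iff.1 (hσ.comp (f := fun y : X × X => (y.1, 0))
    (by fun_prop) fun _ h => h) _

namespace ClosedRep

variable {α} {U : Set X} {e : X → X → X → X → ℝ} (h : ClosedRep U e α)

include h

/-- This is `α = α' + dt ∧ θ`, both parts evaluated at `t = 0`, which is harmless because `α` is
independent of `t`. -/
lemma apply_eq {z : ℝ × X × X} (hz : z ∈ tube U) (w w' : ℝ × X × X) :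
    α z ![w, w'] = spatialPart α z.2 ![w.2, w'.2] + w.1 * timePart α z.2 ![w'.2]
      - w'.1 * timePart α z.2 ![w.2] := by
  have e1 : ∀ w : ℝ × X × X, w = w.1 • tVec + (0, w.2) := fun w => by ext <;> simp [tVec]
  rw [h.eq_time hz, spatialPart_apply, timePart_apply, timePart_apply]
  conv_lhs => rw [e1 w, e1 w']
  rw [alt_add_left, alt_add_right, alt_add_right, alt_smul_left, alt_smul_left, alt_smul_right,
    alt_smul_right, alt_self, alt_swap _ (0, w.2) tVec]
  ring

lemma smooth_apply [FiniteDimensional ℝ X] (p q : ℝ × X × X) :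
    ContDiffOn ℝ ∞ (fun y : X × X => α (0, y) ![p, q]) (Prod.fst ⁻¹' U) :=
  (contDiffOn_alternating_iff.1 h.smooth _).comp (f := fun y : X × X => ((0 : ℝ), y))
    (by fun_prop) fun _ h => h

lemma fderiv_slice {y : X × X} (hy : y.1 ∈ U) (p q : ℝ × X × X) (w : X × X) :
    fderiv ℝ (fun y : X × X => α (0, y) ![p, q]) y w =
      fderiv ℝ (fun z => α z ![p, q]) (0, y) (0, w) := by
  have h1 : HasFDerivAt (fun y : X × X => ((0 : ℝ), y)) (.inr ℝ ℝ (X × X)) y :=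
    hasFDerivAt_prodMk_right 0 y
  have hz : ((0 : ℝ), y) ∈ tube U := hy
  have h2 := (h.diffAt hz p q).hasFDerivAt.comp y h1
  exact DFunLike.congr_fun h2.fderiv w

lemma fderiv_time {z : ℝ × X × X} (hz : z ∈ tube U) (p q : ℝ × X × X) :
    fderiv ℝ (fun z => α z ![p, q]) z tVec = 0 := by
  refine (hasDerivAt_line (h.diffAt hz p q) tVec).unique
    ((hasDerivAt_const (0 : ℝ) (α z ![p, q])).congr_of_eventuallyEq ?_)
  filter_upwards [eventually_line (isOpen_tube h.isOpen) hz tVec] with s hs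
  rw [h.eq_time hs, h.eq_time hz]
  change α (0, z.2 + s • (0 : X × X)) _ = _
  rw [smul_zero, add_zero]

variable [FiniteDimensional ℝ X]

lemma smooth_spatialPart : ContDiffOn ℝ ∞ (spatialPart α) (Prod.fst ⁻¹' U) := by
  refine contDiffOn_alternating_iff.2 fun w => ?_
  exact (contDiffOn_alternating_iff.1 h.smooth _).comp (f := fun y : X × X => ((0 : ℝ), y))
    (by fun_prop) fun _ h => h

lemma smooth_timePart : ContDiffOn ℝ ∞ (timePart α) (Prod.fst ⁻¹' U) := by
  refine contDiffOn_alternating_iff.2 fun w => ?_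
  have hw : w = ![w 0] := by funext i; fin_cases i; rfl
  rw [hw]
  simp only [timePart_apply]
  exact h.smooth_apply _ _

lemma lagrangianRep : LagrangianRep U (spatialPart α) where
  isOpen := h.isOpen
  smooth := h.smooth_spatialPart
  closed y hy := by
    have hz : ((0 : ℝ), y) ∈ tube U := hy
    have hd : DifferentiableAt ℝ (spatialPart α) y := (h.smooth_spatialPart.contDiffAt
      ((h.isOpen.preimage continuous_fst).mem_nhds hy)).differentiableAt (by simp)
    ext w
    have hw : w = ![w 0, w 1, w 2] := by funext i; fin_cases i <;> rfl
    rw [hw, extDeriv_twoForm_apply hd]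
    simp only [spatialPart_apply]
    rw [h.fderiv_slice hy, h.fderiv_slice hy, h.fderiv_slice hy]
    exact h.closed_apply hz _ _ _
  vert_vert y hy p q := by
    rw [spatialPart_apply]
    exact h.vert_vert (z := (0, y)) hy p q

-- Closedness of `timePart`: in `dα(∂/∂t, w, w') = 0` the derivative along `∂/∂t` drops out, as `α`
-- is autonomous.
omit [FiniteDimensional ℝ X] in
lemma extDeriv_timePart {y : X × X} (hy : y.1 ∈ U) (w w' : X × X) :
    fderiv ℝ (fun y => timePart α y ![w']) y w -
      fderiv ℝ (fun y => timePart α y ![w]) y w' = 0 := by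
  have hz : ((0 : ℝ), y) ∈ tube U := hy
  simp only [timePart_apply]
  rw [h.fderiv_slice hy, h.fderiv_slice hy]
  have h1 := h.closed_apply hz tVec (0, w) (0, w')
  rw [h.fderiv_time hz] at h1
  linarith

lemma smooth_timePotential : ContDiffOn ℝ ∞ (timePotential α) (tube U) := by
  refine contDiffOn_alternating_iff.2 fun w => ?_
  have hw : w = ![w 0] := by funext i; fin_cases i; rfl
  rw [hw]
  simp only [timePotential_apply]
  exact contDiffOn_fst.mul ((contDiffOn_alternating_iff.1 h.smooth_timePart _).comp
    (f := fun z : ℝ × X × X => z.2) (by fun_prop) fun _ h => h)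

lemma fderiv_timePotential {z : ℝ × X × X} (hz : z ∈ tube U) (w w' : ℝ × X × X) :
    fderiv ℝ (fun z => timePotential α z ![w']) z w =
      w.1 * timePart α z.2 ![w'.2] + z.1 * fderiv ℝ (fun y => timePart α y ![w'.2]) z.2 w.2 := by
  simp only [timePotential_apply]
  have h0 : DifferentiableAt ℝ (fun y => timePart α y ![w'.2]) z.2 :=
    ((contDiffOn_alternating_iff.1 h.smooth_timePart _).contDiffAt
      ((h.isOpen.preimage continuous_fst).mem_nhds hz)).differentiableAt (by simp)
  have h1 : HasFDerivAt (fun z : ℝ × X × X => z.2) (.snd ℝ ℝ (X × X)) z := hasFDerivAt_snd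
  have h2 := (hasFDerivAt_fst (p := z) (𝕜 := ℝ)).mul (h0.hasFDerivAt.comp z h1)
  refine (DFunLike.congr_fun h2.fderiv w).trans ?_
  simp
  ring

/-- With `θ = timePart α` one has `d(tθ) = dt ∧ θ + t dθ` and `dθ = 0`; the spatial part is handled
by the fibre homotopy. The final linear combination removes `t dθ`. -/
lemma eq_add_extDeriv {z : ℝ × X × X} (hz : z ∈ tube U) : α z =
    (zeroSectionPart (spatialPart α) z.2).compContinuousLinearMap (.snd ℝ ℝ (X × X)) +
      extDeriv (fun z => timePotential α z + (fiberPotential (spatialPart α) z.2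
        ).compContinuousLinearMap (.snd ℝ ℝ (X × X))) z := by
  have hl := h.lagrangianRep
  have h0 : DifferentiableAt ℝ (fiberPotential (spatialPart α)) z.2 :=
    (hl.contDiffOn_fiberPotential.contDiffAt (hl.isOpen'.mem_nhds hz)).differentiableAt (by simp)
  have h1 : DifferentiableAt ℝ (timePotential α) z := (h.smooth_timePotential.contDiffAt
    ((isOpen_tube h.isOpen).mem_nhds hz)).differentiableAt (by simp)
  have hs : fderiv ℝ (fun z : ℝ × X × X => z.2) z = .snd ℝ ℝ (X × X) := fderiv_snd
  have hs' : ∀ z, fderiv ℝ (fun z : ℝ × X × X => z.2) z = .snd ℝ ℝ (X × X) := fun _ => fderiv_snd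
  have h2 := extDeriv_pullback (f := fun z : ℝ × X × X => z.2)
    (x := z) (r := ∞) h0 contDiffAt_snd
    (by simp only [minSmoothness_of_isRCLikeNormedField]; exact WithTop.coe_le_coe.2 le_top)
  simp only [hs'] at h2
  have h3 : DifferentiableAt ℝ (fun z : ℝ × X × X => (fiberPotential (spatialPart α) z.2
        ).compContinuousLinearMap (.snd ℝ ℝ (X × X))) z :=
    (h0.comp (f := fun z : ℝ × X × X => z.2) z
      differentiableAt_snd).continuousAlternatingMapCompContinuousLinearMap
        (differentiableAt_const _)
  rw [extDeriv_fun_add h1 h3, h2]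
  refine alternating_two_ext fun w w' => ?_
  have e1 : ∀ (a : (X × X) [⋀^Fin 2]→L[ℝ] ℝ), a.compContinuousLinearMap (.snd ℝ ℝ (X × X)) ![w, w']
      = a ![w.2, w'.2] := by
    intro a
    refine congrArg a ?_
    funext i; fin_cases i <;> rfl
  rw [ContinuousAlternatingMap.add_apply, ContinuousAlternatingMap.add_apply, e1, e1,
    hl.extDeriv_fiberPotential hz, zeroSectionPart_apply, extDeriv_oneForm_apply h1,
    h.fderiv_timePotential hz, h.fderiv_timePotential hz, h.apply_eq hz]
  have h4 := h.extDeriv_timePart (y := z.2) hz w.2 w'.2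
  linear_combination -z.1 * h4

end ClosedRep

end Decomposition

/-! ## Staircase integrals -/

section Staircase

variable {m : ℕ} {U : Set (Coord m)} {σ : Coord m × Coord m → (Coord m × Coord m) [⋀^Fin 2]→L[ℝ] ℝ}

/-- The point `v` with its first `k` coordinates replaced by zero. -/
def truncate (k : ℕ) (v : Coord m) : Coord m := WithLp.toLp 2 fun i => if i.val < k then 0 else v i

lemma stair_eq_add (l : Fin m) (ν : ℝ) (v : Coord m) :
    stair l ν v = stair l 0 v + ν • stdVec l := by
  ext k
  by_cases h1 : k < l
  · simp [stair, stdVec, h1, h1.ne]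
  · by_cases h2 : k = l
    · simp [stair, stdVec, h2]
    · simp [stair, stdVec, h1, h2]

/-- The `l`-th segment of the staircase joins `truncate (l + 1) v` (at `ν = 0`) to `truncate l v`
(at `ν = v l`), so consecutive segments share endpoints and the integrals telescope. -/
lemma stair_self (l : Fin m) (v : Coord m) : stair l (v l) v = truncate l v := by
  ext k
  by_cases h1 : k < l
  · simp [stair, truncate, h1]
  · by_cases h2 : k = l
    · subst h2; simp [stair, truncate]
    · simp [stair, truncate, h1, h2]

lemma stair_zero (l : Fin m) (v : Coord m) : stair l 0 v = truncate (l + 1) v := by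
  ext k
  by_cases h1 : k < l
  · have : k.val < l.val + 1 := Nat.lt_succ_of_lt h1
    change (if k < l then (0 : ℝ) else if k = l then 0 else v k) =
      if k.val < l.val + 1 then 0 else v k
    rw [if_pos h1, if_pos this]
  · by_cases h2 : k = l
    · subst h2; simp [stair, truncate]
    · have : ¬ k.val < l.val + 1 := by
        intro h3
        rcases Nat.lt_succ_iff_lt_or_eq.1 h3 with h | h
        · exact h1 h
        · exact h2 (Fin.ext h)
      change (if k < l then (0 : ℝ) else if k = l then 0 else v k) =
        if k.val < l.val + 1 then 0 else v k
      rw [if_neg h1, if_neg h2, if_neg this]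

namespace LagrangianRep

variable (h : LagrangianRep U σ)

include h

/-- Evaluate `extDeriv_fiberPotential` on a vertical and a horizontal vector: the zero section term
and the potential itself vanish on vertical vectors. Hence the mixed components of `σ` are, up to
sign, the fibre gradient of the potential. -/
lemma fderiv_fiberPotential_vert {y : Coord m × Coord m} (hy : y.1 ∈ U) (u p : Coord m) :
    fderiv ℝ (fun y => fiberPotential σ y ![(u, 0)]) y (0, p) = -σ y ![(u, 0), (0, p)] := by
  have hd : DifferentiableAt ℝ (fiberPotential σ) y :=
    (h.contDiffOn_fiberPotential.contDiffAt (h.isOpen'.mem_nhds hy)).differentiableAt (by simp)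
  have h1 := h.extDeriv_fiberPotential hy (0, p) (u, 0)
  rw [extDeriv_oneForm_apply hd] at h1
  have h2 : (fun y => fiberPotential σ y ![(0, p)]) =ᶠ[𝓝 y] fun _ => 0 := by
    filter_upwards [h.isOpen'.mem_nhds hy] with z hz
    rw [h.fiberPotential_apply hz]
    have : ∀ s : ℝ, σ (z.1, s • z.2) ![(0, z.2), (((0, p) : Coord m × Coord m).1, 0)] = 0 :=
      fun s => h.vert_vert (z.1, s • z.2) hz z.2 0
    simp only [this]
    simp
  have h3 : σ (y.1, 0) ![(((0, p) : Coord m × Coord m).1, 0),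
      (((u, 0) : Coord m × Coord m).1, 0)] = 0 := by
    have := alt_smul_left (σ (y.1, 0)) 0 (0 : Coord m × Coord m) (u, 0)
    rw [zero_smul, zero_mul] at this
    exact this
  rw [h2.fderiv_eq, h3, alt_swap (σ y)] at h1
  simpa using h1

lemma fiberPotential_zero {x : Coord m} (hx : x ∈ U) (w : Coord m × Coord m) :
    fiberPotential σ (x, 0) ![w] = 0 := by
  rw [h.fiberPotential_apply (y := (x, 0)) hx]
  have : ∀ s : ℝ, σ (x, s • (0 : Coord m)) ![(0, 0), (w.1, 0)] = 0 := by
    intro s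
    have := alt_smul_left (σ (x, s • (0 : Coord m))) 0 (0 : Coord m × Coord m) (w.1, 0)
    rw [zero_smul, zero_mul] at this
    exact this
  simp only [this]
  simp

/-- The integral along a staircase path agrees with the one along a straight path. -/
lemma sum_integral_stair {x : Coord m} (hx : x ∈ U) (u v : Coord m) :
    ∑ l, ∫ ν in (0 : ℝ)..(v l), σ (x, stair l ν v) ![(u, 0), (0, stdVec l)] =
      -fiberPotential σ (x, v) ![(u, 0)] := by
  -- On each segment the integrand is the derivative of minus the potential. The sum then telescopes
  -- from `truncate m v = 0`, where the potential vanishes, to `truncate 0 v = v`.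
  have hint : ∀ l, ∫ ν in (0 : ℝ)..(v l), σ (x, stair l ν v) ![(u, 0), (0, stdVec l)] =
      fiberPotential σ (x, truncate (l + 1) v) ![(u, 0)] -
        fiberPotential σ (x, truncate l v) ![(u, 0)] := by
    intro l
    have hd : ∀ ν : ℝ, HasDerivAt (fun ν : ℝ => -fiberPotential σ (x, stair l ν v) ![(u, 0)])
        (σ (x, stair l ν v) ![(u, 0), (0, stdVec l)]) ν := by
      intro ν
      have e1 : ∀ ν : ℝ, (x, stair l ν v) = (x, stair l 0 v) + ν • ((0, stdVec l) :
          Coord m × Coord m) := by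
        intro ν
        rw [stair_eq_add l ν v]
        ext <;> simp
      have hy : (x, stair l ν v).1 ∈ U := hx
      have h1 := h.fderiv_fiberPotential_vert hy u (stdVec l)
      have hd : DifferentiableAt ℝ (fun y => fiberPotential σ y ![(u, 0)]) (x, stair l ν v) :=
        differentiableAt_apply_const ((h.contDiffOn_fiberPotential.contDiffAt
          (h.isOpen'.mem_nhds hy)).differentiableAt (by simp)) _
      rw [e1 ν] at hd h1
      have h2 := (IsLagrangian.hasDerivAt_line' hd).fun_neg
      rw [h1, neg_neg] at h2
      simp only [← e1] at h2
      exact h2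
    have hc : Continuous fun ν : ℝ => σ (x, stair l ν v) ![(u, 0), (0, stdVec l)] := by
      refine (contDiffOn_alternating_iff.1 h.smooth _).continuousOn.comp_continuous
        (f := fun ν : ℝ => (x, stair l ν v)) ?_ fun _ => hx
      have : (fun ν : ℝ => (x, stair l ν v)) = fun ν => (x, stair l 0 v + ν • stdVec l) :=
        funext fun ν => congrArg (Prod.mk x) (stair_eq_add l ν v)
      rw [this]
      fun_prop
    rw [intervalIntegral.integral_eq_sub_of_hasDerivAt (fun ν _ => hd ν)
      (hc.intervalIntegrable _ _), stair_self, stair_zero]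
    ring
  simp only [hint]
  rw [Fin.sum_univ_eq_sum_range (fun l => fiberPotential σ (x, truncate (l + 1) v) ![(u, 0)] -
    fiberPotential σ (x, truncate l v) ![(u, 0)]),
    Finset.sum_range_sub (fun k => fiberPotential σ (x, truncate k v) ![(u, 0)])]
  have e1 : truncate m v = 0 := by ext k; simp [truncate]
  have e2 : truncate 0 v = v := by ext k; simp [truncate]
  rw [e1, e2, h.fiberPotential_zero hx, zero_sub]

end LagrangianRep

end Staircase

/-! ## Existence and uniqueness of the Lepage equivalent -/

namespace ClosedRep

variable {X : Type*} [NormedAddCommGroup X] [NormedSpace ℝ X] {U U' : Set X}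
  {e : X → X → X → X → ℝ} {α β : ℝ × X × X → (ℝ × X × X) [⋀^Fin 2]→L[ℝ] ℝ}

lemma congr (h : ClosedRep U e α) (hβ : ∀ z ∈ tube U, β z = α z) : ClosedRep U e β where
  isOpen := h.isOpen
  smooth := h.smooth.congr hβ
  closed z hz := by
    rw [← h.closed z hz]
    apply Filter.EventuallyEq.extDeriv_eq
    filter_upwards [(isOpen_tube h.isOpen).mem_nhds hz] with y hy using hβ y hy
  horizontal z hz := by rw [hβ z hz]; exact h.horizontal z hz
  vertical z hz := by rw [hβ z hz]; exact h.vertical z hz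
  diff := h.diff

lemma of_local (hU : IsOpen U) (h : ∀ x ∈ U, ∃ U', x ∈ U' ∧ ClosedRep U' e α) :
    ClosedRep U e α where
  isOpen := hU
  smooth z hz := by
    obtain ⟨U', hx, h'⟩ := h _ hz
    exact (h'.contDiffAt hx).contDiffWithinAt
  closed z hz := by
    obtain ⟨U', hx, h'⟩ := h _ hz
    exact h'.closed z hx
  horizontal z hz := by
    obtain ⟨U', hx, h'⟩ := h _ hz
    exact h'.horizontal z hx
  vertical z hz := by
    obtain ⟨U', hx, h'⟩ := h _ hz
    exact h'.vertical z hx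
  diff x hx := by
    obtain ⟨U', hx', h'⟩ := h _ hx
    exact h'.diff x hx'

end ClosedRep

variable {m : ℕ} {M : Type*} [TopologicalSpace M] [ChartedSpace (Coord m) M]
  [IsManifold (𝓡 m) ∞ M]

/-- The preferred chart at a point. -/
def Chart.at (x : M) : Chart m M := ⟨chartAt (Coord m) x, IsManifold.chart_mem_maximalAtlas x⟩

namespace SourceForm

variable (ε : SourceForm m M) (φ ψ : Chart m M)

/-- The horizontal covector `εᵢ(x, v, a) dxⁱ`. -/
def expr (x v a u : Coord m) : ℝ := ∑ i, ε.coeff φ i (x, v, a) * u i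

lemma contDiffAt_coeff (i : Fin m) {z : Coord m × Coord m × Coord m} (hz : z.1 ∈ φ.img) :
    ContDiffAt ℝ ∞ (ε.coeff φ i) z :=
  (ε.smooth φ i).contDiffAt ((φ.1.open_target.prod isOpen_univ).mem_nhds ⟨hz, trivial⟩)

lemma differentiableAt_coeff (i : Fin m) {x : Coord m} (hx : x ∈ φ.img) (v : Coord m) :
    DifferentiableAt ℝ (fun v => ε.coeff φ i (x, v, 0)) v :=
  DifferentiableAt.comp (g := ε.coeff φ i) v
    ((ε.contDiffAt_coeff φ i (z := (x, v, 0)) hx).differentiableAt (by simp)) (by fun_prop)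

variable {ε φ ψ}

lemma closedRep_of_represents {α : DForm (RTMModel m) (ℝ × TM m M) 2} {U : Set (Coord m)}
    (hU : IsOpen U) (hUφ : U ⊆ φ.img) (hs : ContDiffOn ℝ ∞ (φ.evolution.rep α) (tube U))
    (hc : ∀ z ∈ tube U, extDeriv (φ.evolution.rep α) z = 0)
    (hr : ∀ z ∈ tube U, ε.Represents φ z.2.1 z.2.2 (φ.evolution.rep α z)) :
    ClosedRep U (ε.expr φ) (φ.evolution.rep α) where
  isOpen := hU
  smooth := hs
  closed := hc
  horizontal z hz a := (hr z hz a).1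
  vertical z hz a := (hr z hz a).2
  diff _ hx v _ := DifferentiableAt.fun_sum fun i _ =>
    (ε.differentiableAt_coeff φ i (hUφ hx) v).mul_const _

lemma represents_of_closedRep {α : ℝ × Coord m × Coord m → (ℝ × Coord m × Coord m) [⋀^Fin 2]→L[ℝ] ℝ}
    {U : Set (Coord m)} (h : ClosedRep U (ε.expr φ) α) {z : ℝ × Coord m × Coord m}
    (hz : z ∈ tube U) : ε.Represents φ z.2.1 z.2.2 (α z) := fun a =>
  ⟨h.horizontal z hz a, h.vertical z hz a⟩

/-- Smoothness and closedness pass through pull-back by the transition map. The contact condition is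
moved intrinsically instead: a jet given by `φ` is also a jet given by `ψ`, and `HasContactPart`
mentions no chart. -/
lemma closedRep_transfer {α : DForm (RTMModel m) (ℝ × TM m M) 2}
    (h : ClosedRep ψ.img (ε.expr ψ) (ψ.evolution.rep α)) (φ : Chart m M) :
    ClosedRep (φ.base.overlap ψ.base) (ε.expr φ) (φ.evolution.rep α) := by
  have hmem : ∀ z ∈ tube (φ.base.overlap ψ.base), z ∈ φ.evolution.overlap ψ.evolution :=
    fun z hz => hz
  have hmem' : ∀ z ∈ tube (φ.base.overlap ψ.base),
      φ.evolution.trans ψ.evolution z ∈ tube ψ.img := fun z hz => ψ.1.map_source hz.2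
  have hev : ∀ z ∈ tube (φ.base.overlap ψ.base), φ.evolution.rep α =ᶠ[𝓝 z] fun z =>
      (ψ.evolution.rep α (φ.evolution.trans ψ.evolution z)).compContinuousLinearMap
        (fderiv ℝ (φ.evolution.trans ψ.evolution) z) := by
    intro z hz
    filter_upwards [(φ.evolution.isOpen_overlap ψ.evolution).mem_nhds (hmem z hz)] with y hy
    exact φ.evolution.rep_eq_pullback ψ.evolution α hy
  refine closedRep_of_represents (φ.base.isOpen_overlap ψ.base) Set.inter_subset_left ?_ ?_ ?_
  · intro z hz
    have ht := φ.evolution.contDiffAt_trans ψ.evolution (hmem z hz)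
    exact ((contDiffAt_compContinuousLinearMap (ContDiffAt.comp (g := ψ.evolution.rep α) z
      (h.contDiffAt (hmem' z hz)) ht) (ht.fderiv_right (by simp))).congr_of_eventuallyEq
        (hev z hz)).contDiffWithinAt
  · intro z hz
    rw [(hev z hz).extDeriv_eq, extDeriv_pullback (r := ∞) (h.differentiableAt (hmem' z hz))
      (φ.evolution.contDiffAt_trans ψ.evolution (hmem z hz))
      (by simp only [minSmoothness_of_isRCLikeNormedField]; exact WithTop.coe_le_coe.2 le_top),
      h.closed _ (hmem' z hz)]
    rfl
  · rintro ⟨t, x, v⟩ hz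
    refine (ε.hasContactPart_iff φ α t hz.1 v).1 fun a => ?_
    obtain ⟨x', hx', v', a', hJ⟩ := ψ.exists_jet (J := φ.jet hz.1 v a) hz.2
    rw [hJ]
    exact (ε.hasContactPart_iff ψ α t hx' v').2
      (represents_of_closedRep h (z := (t, x', v')) hx') a'

/-- Turns the intrinsic definition into the coordinate condition in all charts, in which uniqueness,
gluing and all component formulas are proved. -/
lemma isLepageEquivalent_iff {α : DForm (RTMModel m) (ℝ × TM m M) 2} :
    ε.IsLepageEquivalent α ↔
      ∀ φ : Chart m M, ClosedRep φ.img (ε.expr φ) (φ.evolution.rep α) := by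
  constructor
  · rintro ⟨hs, hd, hc⟩ φ
    have h1 : ContDiffOn ℝ ∞ (φ.evolution.rep α) (tube φ.img) := hs.contDiffOn_rep φ.evolution
    refine closedRep_of_represents φ.1.open_target subset_rfl h1 ?_ ?_
    · intro z hz
      rw [← φ.evolution.rep_d α hz ((h1.contDiffAt
        ((isOpen_tube φ.1.open_target).mem_nhds hz)).differentiableAt (by simp)), hd]
      rfl
    · rintro ⟨t, x, v⟩ hz
      exact (ε.hasContactPart_iff φ α t hz v).1 fun a => hc t _
  · intro h
    refine ⟨SmoothCoord.isSmooth_of fun q => ⟨(Chart.at q.2.proj).evolution,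
      mem_chart_source _ q.2.proj, (h _).contDiffAt ?_⟩, ?_, ?_⟩
    · exact (Chart.at q.2.proj).evolution.map_source' (mem_chart_source _ q.2.proj)
    · funext q
      have hq : q ∈ (Chart.at q.2.proj).evolution.source := mem_chart_source _ q.2.proj
      have hz := (Chart.at q.2.proj).evolution.map_source' hq
      refine (Chart.at q.2.proj).evolution.eq_of_rep_eq (η := 0) hq ?_
      rw [(Chart.at q.2.proj).evolution.rep_d α hz ((h _).differentiableAt hz)]
      exact (h _).closed _ hz
    · intro t J
      obtain ⟨φ, hφ⟩ : ∃ φ : Chart m M, J.pt.proj ∈ φ.dom := ⟨.at _, mem_chart_source _ J.pt.proj⟩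
      obtain ⟨x, hx, v, a, rfl⟩ := φ.exists_jet hφ
      exact (ε.hasContactPart_iff _ α t hx v).2
        (represents_of_closedRep (h _) (z := (t, x, v)) hx) a

lemma IsLepageEquivalent.unique {α β : DForm (RTMModel m) (ℝ × TM m M) 2}
    (hα : ε.IsLepageEquivalent α) (hβ : ε.IsLepageEquivalent β) : β = α := by
  rw [isLepageEquivalent_iff] at hα hβ
  funext q
  have hq : q ∈ (Chart.at q.2.proj).evolution.source := mem_chart_source _ q.2.proj
  have hz := (Chart.at q.2.proj).evolution.map_source' hq
  exact (Chart.at q.2.proj).evolution.eq_of_rep_eq hq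
    ((hβ _).eq_of_closedRep (hα _) hz hz rfl fun _ _ _ => rfl)

lemma IsLocallyVariational.exists_closedRep (hε : ε.IsLocallyVariational) (x : M) :
    ∃ (ψ : Chart m M) (α : DForm (RTMModel m) (ℝ × TM m M) 2), x ∈ ψ.dom ∧
      ClosedRep ψ.img (ε.expr ψ) (ψ.evolution.rep α) := by
  obtain ⟨ψ, hx, L, hL, hE⟩ := hε x
  have h : IsLagrangian ψ.img (ε.coeff ψ) L := ⟨ψ.1.open_target, hL, hE⟩
  -- The lift is a section over all of `ℝ × TM`, but only its values over the domain of `ψ` are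
  -- used.
  refine ⟨ψ, ψ.evolution.lift (extDeriv (cartanForm L)), hx, ?_⟩
  exact (h.closedRep fun x hx v i => ε.differentiableAt_coeff ψ i hx v).congr
    fun z hz => ψ.evolution.rep_lift _ hz

/-- A locally variational source form has a Lepage equivalent. -/
lemma IsLocallyVariational.exists_isLepageEquivalent (hε : ε.IsLocallyVariational) :
    ∃ α, ε.IsLepageEquivalent α := by
  choose ψ α hx hα using hε.exists_closedRep
  -- At each point take the local form chosen for its base point. Near a given point this agrees
  -- with one fixed smooth local form by uniqueness, so no compatibility of the choices is needed.
  refine ⟨fun q => α q.2.proj q, isLepageEquivalent_iff.2 fun φ =>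
    ClosedRep.of_local φ.1.open_target fun x hx' => ?_⟩
  have hloc := fun y : M => closedRep_transfer (hα y) φ
  refine ⟨φ.base.overlap (ψ (φ.1.symm x)).base, ⟨hx', hx _⟩, (hloc (φ.1.symm x)).congr ?_⟩
  intro z hz
  exact (hloc (φ.1.symm z.2.1)).eq_of_closedRep (hloc (φ.1.symm x)) (z := z)
    ⟨hz.1, hx _⟩ hz rfl fun _ _ _ => rfl

end SourceForm

/-! ## Chart expressions -/

section Expansion

variable {V : Type*} [AddCommGroup V] [Module ℝ V] [TopologicalSpace V]

/-- The contraction of a two-form with a vector. -/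
def contract (a : V [⋀^Fin 2]→L[ℝ] ℝ) (u : V) : V →L[ℝ] ℝ where
  toFun w := a ![u, w]
  map_add' w w' := alt_add_right a u w w'
  map_smul' r w := alt_smul_right a r u w
  cont := a.cont.comp (continuous_const.matrixVecCons
    (continuous_id.matrixVecCons continuous_const))

lemma sum_sum_smul_wedge_apply {ι : Type*} [Fintype ι] (r : ι → ι → ℝ) (f g : ι → V →L[ℝ] ℝ)
    (v : Fin 2 → V) {F G : ι → Fin 2 → ℝ} (hf : ∀ i k, f i (v k) = F i k)
    (hg : ∀ i k, g i (v k) = G i k) : (∑ i, ∑ j, r i j • wedge (f i) (g j)) v =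
      ∑ i, ∑ j, r i j * (F i 0 * G j 1 - F i 1 * G j 0) := by
  simp only [ContinuousAlternatingMap.sum_apply, ContinuousAlternatingMap.smul_apply, ← hf, ← hg]
  rfl

lemma sum_smul_oneForm_apply {ι : Type*} [Fintype ι] (r : ι → ℝ) (f : ι → V →L[ℝ] ℝ)
    (v : Fin 1 → V) {F : ι → ℝ} (hf : ∀ i, f i (v 0) = F i) :
    (∑ i, r i • oneForm (f i)) v = ∑ i, r i * F i := by
  simp only [ContinuousAlternatingMap.sum_apply, ContinuousAlternatingMap.smul_apply, ← hf]
  rfl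

lemma neg_sum_sum_smul_oneForm_apply {ι : Type*} [Fintype ι] (r : ι → ι → ℝ) (f : ι → V →L[ℝ] ℝ)
    (v : Fin 1 → V) {F : ι → ℝ} (hf : ∀ i, f i (v 0) = F i) :
    (-∑ l, ∑ i, r l i • oneForm (f i)) v = ∑ i, (-∑ l, r l i) * F i := by
  rw [Finset.sum_comm]
  simp only [ContinuousAlternatingMap.sum_apply, ContinuousAlternatingMap.smul_apply,
    ContinuousAlternatingMap.neg_apply, ← hf, neg_mul, Finset.sum_mul, Finset.sum_neg_distrib]
  rfl

variable {m : ℕ}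

lemma sum_smul_stdVec (u : Coord m) : ∑ i, u i • stdVec i = u := by
  ext k
  simp [stdVec, Finset.sum_apply, Pi.single_apply]

lemma clm_apply_eq_sum (f : Coord m →L[ℝ] ℝ) (u : Coord m) : f u = ∑ i, u i * f (stdVec i) := by
  conv_lhs => rw [← sum_smul_stdVec u, map_sum]
  simp

lemma alt_eq_sum (a : V [⋀^Fin 2]→L[ℝ] ℝ) (f g : Coord m →L[ℝ] V) (u w : Coord m) :
    a ![f u, g w] = ∑ i, ∑ j, u i * w j * a ![f (stdVec i), g (stdVec j)] := by
  have h1 : ∀ u, a ![f u, g w] = ∑ j, w j * a ![f u, g (stdVec j)] := fun u =>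
    clm_apply_eq_sum ((contract a (f u)).comp g) w
  have h2 : ∀ v, a ![f u, v] = ∑ i, u i * a ![f (stdVec i), v] := by
    intro v
    have := clm_apply_eq_sum ((contract a v).comp f) u
    change a ![v, f u] = ∑ i, u i * a ![v, f (stdVec i)] at this
    rw [alt_swap, this, ← Finset.sum_neg_distrib]
    refine Finset.sum_congr rfl fun i _ => ?_
    rw [alt_swap a v]
    ring
  rw [h2]
  refine Finset.sum_congr rfl fun i _ => ?_
  rw [h1, Finset.mul_sum]
  exact Finset.sum_congr rfl fun j _ => (mul_assoc _ _ _).symm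

/-- `hVec` as a linear map. -/
def hVecL : Coord m →L[ℝ] ℝ × Coord m × Coord m :=
  (ContinuousLinearMap.inr ℝ ℝ (Coord m × Coord m)).comp (.inl ℝ (Coord m) (Coord m))

end Expansion

variable {m : ℕ} {M : Type*} [TopologicalSpace M] [ChartedSpace (Coord m) M]
  [IsManifold (𝓡 m) ∞ M] {ε : SourceForm m M} {φ : Chart m M}

lemma SourceForm.expr_stdVec (x v a : Coord m) (i : Fin m) :
    ε.expr φ x v a (stdVec i) = ε.coeff φ i (x, v, a) := by
  simp [SourceForm.expr, stdVec]

namespace ClosedRep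

variable {α : ℝ × Coord m × Coord m → (ℝ × Coord m × Coord m) [⋀^Fin 2]→L[ℝ] ℝ}
  (h : ClosedRep φ.img (ε.expr φ) α) {z : ℝ × Coord m × Coord m} (hz : z.2.1 ∈ φ.img)

include h hz

lemma coeff_eq_add (a : Coord m) (i : Fin m) : ε.coeff φ i (z.2.1, z.2.2, a) =
    ε.A φ i z.2.1 z.2.2 + α z ![hVec (stdVec i), vVec a] := by
  rw [h.hor_vert hz, SourceForm.expr_stdVec, SourceForm.expr_stdVec, SourceForm.A]
  ring

/-- By `coeff_eq_add`, `εᵢ` is affine in the acceleration with linear part the contraction of `α`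
with `∂/∂xⁱ`; its derivative at `0` is that linear part. -/
lemma B_eq (i j : Fin m) : ε.B φ i j z.2.1 z.2.2 = α z ![hVec (stdVec i), vVec (stdVec j)] := by
  have h1 : (fun a => ε.coeff φ i (z.2.1, z.2.2, a)) = fun a =>
      ε.A φ i z.2.1 z.2.2 + ((contract (α z) (hVec (stdVec i))).comp (vVecL m)) a :=
    funext fun a => h.coeff_eq_add hz a i
  rw [SourceForm.B, h1, fderiv_const_add, ContinuousLinearMap.fderiv]
  rfl

lemma curlA_eq (i j : Fin m) : ε.curlA φ i j z.2.1 z.2.2 =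
    2 * α z ![hVec (stdVec i), hVec (stdVec j)] := by
  rw [h.two_mul_hor_hor hz]
  simp only [SourceForm.expr_stdVec]
  rfl

lemma hor_hor_eq_sum (u w : Coord m) : α z ![hVec u, hVec w] =
    ∑ i, ∑ j, 1 / 2 * ε.curlA φ i j z.2.1 z.2.2 * (u i * w j) := by
  refine (alt_eq_sum (α z) hVecL hVecL u w).trans ?_
  refine Finset.sum_congr rfl fun i _ => Finset.sum_congr rfl fun j _ => ?_
  rw [h.curlA_eq hz]
  change _ * _ * α z ![hVec (stdVec i), hVec (stdVec j)] = _
  ring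

lemma hor_vert_eq_sum (u w : Coord m) : α z ![hVec u, vVec w] =
    ∑ i, ∑ j, ε.B φ i j z.2.1 z.2.2 * (u i * w j) := by
  refine (alt_eq_sum (α z) hVecL (vVecL m) u w).trans ?_
  refine Finset.sum_congr rfl fun i _ => Finset.sum_congr rfl fun j _ => ?_
  rw [h.B_eq hz]
  exact mul_comm _ _

lemma coeff_eq (a : Coord m) (i : Fin m) : ε.coeff φ i (z.2.1, z.2.2, a) =
    ε.A φ i z.2.1 z.2.2 + ∑ j, ε.B φ i j z.2.1 z.2.2 * a j := by
  have h1 := clm_apply_eq_sum ((contract (α z) (hVec (stdVec i))).comp (vVecL m)) a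
  rw [h.coeff_eq_add hz]
  refine congrArg (ε.A φ i z.2.1 z.2.2 + ·) (h1.trans ?_)
  refine Finset.sum_congr rfl fun j _ => ?_
  rw [h.B_eq hz]
  exact mul_comm _ _

omit hz

lemma rep_alphaPrimeChart {y : Coord m × Coord m} (hy : y.1 ∈ φ.img) :
    φ.tangent.rep (ε.alphaPrimeChart φ) y = spatialPart α y := by
  refine alternating_two_ext fun w w' => ?_
  have hx : φ.pos (φ.tangentInv y) = y.1 := φ.tangentInv_pos hy
  have hv : φ.vel (φ.tangentInv y) = y.2 := φ.tangentInv_vel hy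
  have e1 : ε.alphaPrimeChart φ (φ.tangentInv y) =
      (∑ i, ∑ j, (1 / 4 * ε.curlA φ i j y.1 y.2) •
        wedge (φ.dx i (φ.tangentInv y)) (φ.dx j (φ.tangentInv y))) +
      ∑ i, ∑ j, ε.B φ i j y.1 y.2 •
        wedge (φ.dx i (φ.tangentInv y)) (φ.dv j (φ.tangentInv y)) := by
    simp only [SourceForm.alphaPrimeChart, hx, hv, Finset.sum_add_distrib]
  have e2 : φ.tangent.rep (ε.alphaPrimeChart φ) y ![w, w'] =
      (∑ i, ∑ j, 1 / 4 * ε.curlA φ i j y.1 y.2 * (w.1 i * w'.1 j - w'.1 i * w.1 j)) +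
      ∑ i, ∑ j, ε.B φ i j y.1 y.2 * (w.1 i * w'.2 j - w'.1 i * w.2 j) := by
    have hdx : ∀ i k, φ.dx i (φ.tangentInv y) (φ.tangent.frame y ((![w, w'] : Fin 2 → _) k)) =
      (![w, w'] k).1 i := fun i k => φ.dx_frame i hy _
    have hdv : ∀ i k, φ.dv i (φ.tangentInv y) (φ.tangent.frame y ((![w, w'] : Fin 2 → _) k)) =
      (![w, w'] k).2 i := fun i k => φ.dv_frame i hy _
    refine (congrArg (fun a : TangentSpace (𝓡 m).tangent (φ.tangentInv y) [⋀^Fin 2]→L[ℝ] ℝ =>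
      a fun k => φ.tangent.frame y ((![w, w'] : Fin 2 → _) k)) e1).trans ?_
    exact congrArg₂ (· + ·) (sum_sum_smul_wedge_apply _ _ _ _ hdx hdx)
      (sum_sum_smul_wedge_apply _ _ _ _ hdx hdv)
  have hz : ((0 : ℝ), y).2.1 ∈ φ.img := hy
  have e3 : ∀ w : Coord m × Coord m, ((0 : ℝ), w) = hVec w.1 + vVec w.2 := fun w => by
    simp [hVec, vVec]
  -- The horizontal term is split into two halves to match the antisymmetrised sum over all `i, j`;
  -- one half times the `1/2` of `hor_hor_eq_sum` is the factor `1/4`.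
  have e4 : spatialPart α y ![w, w'] = 1 / 2 * α (0, y) ![hVec w.1, hVec w'.1]
      - 1 / 2 * α (0, y) ![hVec w'.1, hVec w.1] +
      (α (0, y) ![hVec w.1, vVec w'.2] - α (0, y) ![hVec w'.1, vVec w.2]) := by
    rw [spatialPart_apply, e3 w, e3 w', alt_add_left, alt_add_right, alt_add_right,
      h.vert_vert hz, alt_swap _ (vVec w.2), alt_swap _ (hVec w'.1) (hVec w.1)]
    ring
  rw [e2, e4, h.hor_hor_eq_sum hz, h.hor_hor_eq_sum hz, h.hor_vert_eq_sum hz,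
    h.hor_vert_eq_sum hz]
  simp only [Finset.mul_sum, ← Finset.sum_sub_distrib, ← Finset.sum_add_distrib]
  refine Finset.sum_congr rfl fun i _ => Finset.sum_congr rfl fun j _ => ?_
  ring

/-- Freezing the velocity at `0` in the horizontal part of `α'` is restriction to the zero section,
which is why `ω` has an invariant meaning. -/
lemma rep_omegaChart {y : Coord m × Coord m} (hy : y.1 ∈ φ.img) :
    φ.tangent.rep (ε.omegaChart φ) y = zeroSectionPart (spatialPart α) y := by
  refine alternating_two_ext fun w w' => ?_
  have hx : φ.pos (φ.tangentInv y) = y.1 := φ.tangentInv_pos hy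
  have e1 : ε.omegaChart φ (φ.tangentInv y) = ∑ i, ∑ j, (1 / 4 * ε.curlA φ i j y.1 0) •
      wedge (φ.dx i (φ.tangentInv y)) (φ.dx j (φ.tangentInv y)) := by
    simp only [SourceForm.omegaChart, hx]
  have e2 : φ.tangent.rep (ε.omegaChart φ) y ![w, w'] =
      ∑ i, ∑ j, 1 / 4 * ε.curlA φ i j y.1 0 * (w.1 i * w'.1 j - w'.1 i * w.1 j) := by
    have hdx : ∀ i k, φ.dx i (φ.tangentInv y) (φ.tangent.frame y ((![w, w'] : Fin 2 → _) k)) =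
      (![w, w'] k).1 i := fun i k => φ.dx_frame i hy _
    refine (congrArg (fun a : TangentSpace (𝓡 m).tangent (φ.tangentInv y) [⋀^Fin 2]→L[ℝ] ℝ =>
      a fun k => φ.tangent.frame y ((![w, w'] : Fin 2 → _) k)) e1).trans ?_
    have e3 := sum_sum_smul_wedge_apply (fun i j => 1 / 4 * ε.curlA φ i j y.1 0)
      (fun i => φ.dx i (φ.tangentInv y)) (fun i => φ.dx i (φ.tangentInv y))
      (fun k => φ.tangent.frame y ((![w, w'] : Fin 2 → _) k)) hdx hdx
    exact e3
  have hz : ((0 : ℝ), y.1, (0 : Coord m)).2.1 ∈ φ.img := hy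
  have e4 : zeroSectionPart (spatialPart α) y ![w, w'] =
      1 / 2 * α (0, y.1, 0) ![hVec w.1, hVec w'.1]
      - 1 / 2 * α (0, y.1, 0) ![hVec w'.1, hVec w.1] := by
    rw [zeroSectionPart_apply, spatialPart_apply, alt_swap _ (hVec w'.1) (hVec w.1)]
    change α (0, y.1, 0) ![hVec w.1, hVec w'.1] = _
    ring
  rw [e2, e4, h.hor_hor_eq_sum hz, h.hor_hor_eq_sum hz]
  simp only [Finset.mul_sum, ← Finset.sum_sub_distrib]
  refine Finset.sum_congr rfl fun i _ => Finset.sum_congr rfl fun j _ => ?_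
  ring

/-- The staircase in the definition of `κ` depends on the order of the coordinates; replacing it by
the straight ray in the fibre gives an expression suited to changes of chart. -/
lemma rep_kappaChart {y : Coord m × Coord m} (hy : y.1 ∈ φ.img) :
    φ.tangent.rep (ε.kappaChart φ) y = fiberPotential (spatialPart α) y := by
  refine alternating_one_ext fun w => ?_
  have hx : φ.pos (φ.tangentInv y) = y.1 := φ.tangentInv_pos hy
  have hv : φ.vel (φ.tangentInv y) = y.2 := φ.tangentInv_vel hy
  have e1 : ε.kappaChart φ (φ.tangentInv y) =
      -∑ l, ∑ j, (∫ ν in (0 : ℝ)..(y.2 l), ε.B φ j l y.1 (stair l ν y.2)) •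
        oneForm (φ.dx j (φ.tangentInv y)) := by
    simp only [SourceForm.kappaChart, hx, hv]
  have e2 : φ.tangent.rep (ε.kappaChart φ) y ![w] =
      ∑ j, (-∑ l, ∫ ν in (0 : ℝ)..(y.2 l), ε.B φ j l y.1 (stair l ν y.2)) * w.1 j := by
    have hdx : ∀ i, φ.dx i (φ.tangentInv y) (φ.tangent.frame y ((![w] : Fin 1 → _) 0)) =
      w.1 i := fun i => φ.dx_frame i hy _
    refine (congrArg (fun a : TangentSpace (𝓡 m).tangent (φ.tangentInv y) [⋀^Fin 1]→L[ℝ] ℝ =>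
      a fun k => φ.tangent.frame y ((![w] : Fin 1 → _) k)) e1).trans ?_
    exact neg_sum_sum_smul_oneForm_apply _ _ _ hdx
  have e3 : ∀ j, -∑ l, ∫ ν in (0 : ℝ)..(y.2 l), ε.B φ j l y.1 (stair l ν y.2) =
      fiberPotential (spatialPart α) y ![(stdVec j, 0)] := by
    intro j
    rw [← neg_neg (fiberPotential _ _ _), ← h.lagrangianRep.sum_integral_stair hy (stdVec j) y.2]
    have : ∀ l ν, ε.B φ j l y.1 (stair l ν y.2) =
        spatialPart α (y.1, stair l ν y.2) ![(stdVec j, 0), (0, stdVec l)] := fun l ν => by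
      rw [spatialPart_apply]
      exact h.B_eq (z := (0, y.1, stair l ν y.2)) hy j l
    simp only [this]
  have e4 : fiberPotential (spatialPart α) y ![w] =
      fiberPotential (spatialPart α) y ![(w.1, 0)] := by
    rw [h.lagrangianRep.fiberPotential_apply hy, h.lagrangianRep.fiberPotential_apply hy]
  rw [e2, e4]
  simp only [e3]
  have e5 := clm_apply_eq_sum (((ContinuousAlternatingMap.ofSubsingleton ℝ _ ℝ 0).symm
    (fiberPotential (spatialPart α) y)).comp (.inl ℝ (Coord m) (Coord m))) w.1
  refine Eq.trans ?_ (e5.symm.trans ?_)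
  · refine Finset.sum_congr rfl fun j _ => (mul_comm _ _).trans (congrArg (w.1 j * ·) ?_)
    refine congrArg (fiberPotential (spatialPart α) y) ?_
    funext i; fin_cases i; rfl
  · refine congrArg (fiberPotential (spatialPart α) y) ?_
    funext i; fin_cases i; rfl

/-- The coefficients of `μ₀` are `t` times the components of `α` on `∂/∂t`, which `hor_time` and
`vert_time` express through `A`, the curl of `A`, and `B`. -/
lemma rep_mu0Chart {z : ℝ × Coord m × Coord m} (hz : z.2.1 ∈ φ.img) :
    φ.evolution.rep (ε.mu0Chart φ) z = timePotential α z := by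
  refine alternating_one_ext fun w => ?_
  have hx : φ.pos (φ.evolution.invFun z).2 = z.2.1 := φ.tangentInv_pos hz
  have hv : φ.vel (φ.evolution.invFun z).2 = z.2.2 := φ.tangentInv_vel hz
  have e1 : ε.mu0Chart φ (φ.evolution.invFun z) =
      -(∑ i, ((ε.A φ i z.2.1 z.2.2 - 1 / 2 * ∑ j, ε.curlA φ i j z.2.1 z.2.2 * z.2.2 j) * z.1) •
          oneForm (φ.dxR i (φ.evolution.invFun z))) -
        ∑ j, (∑ i, ε.B φ i j z.2.1 z.2.2 * z.2.2 i * z.1) •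
          oneForm (φ.dvR j (φ.evolution.invFun z)) := by
    simp only [SourceForm.mu0Chart, hx, hv, Finset.sum_smul]
    rw [Finset.sum_comm (γ := Fin m)]
    rfl
  have e2 : φ.evolution.rep (ε.mu0Chart φ) z ![w] =
      -(∑ i, ((ε.A φ i z.2.1 z.2.2 - 1 / 2 * ∑ j, ε.curlA φ i j z.2.1 z.2.2 * z.2.2 j) * z.1) *
          w.2.1 i) -
        ∑ j, (∑ i, ε.B φ i j z.2.1 z.2.2 * z.2.2 i * z.1) * w.2.2 j := by
    have hdx : ∀ i, φ.dxR i (φ.evolution.invFun z) (φ.evolution.frame z ((![w] : Fin 1 → _) 0)) =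
      w.2.1 i := fun i => φ.dxR_frame i hz _
    have hdv : ∀ i, φ.dvR i (φ.evolution.invFun z) (φ.evolution.frame z ((![w] : Fin 1 → _) 0)) =
      w.2.2 i := fun i => φ.dvR_frame i hz _
    refine (congrArg (fun a : TangentSpace (RTMModel m) (φ.evolution.invFun z) [⋀^Fin 1]→L[ℝ] ℝ =>
      a fun k => φ.evolution.frame z ((![w] : Fin 1 → _) k)) e1).trans ?_
    exact congrArg₂ (fun a b => -a - b) (sum_smul_oneForm_apply _ _ _ hdx)
      (sum_smul_oneForm_apply _ _ _ hdv)
  have e3 : ((0 : ℝ), w.2) = hVec w.2.1 + vVec w.2.2 := by simp [hVec, vVec]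
  have hz0 : ((0 : ℝ), z.2).2.1 ∈ φ.img := hz
  have e4 : timePart α z.2 ![w.2] = -(ε.expr φ z.2.1 z.2.2 0 w.2.1 -
      α (0, z.2) ![hVec w.2.1, hVec z.2.2]) - α (0, z.2) ![hVec z.2.2, vVec w.2.2] := by
    rw [timePart_apply, e3, alt_add_right, alt_swap _ tVec, alt_swap _ tVec, h.hor_time hz0,
      h.vert_time hz0]
    ring
  have f1 : ∑ i, ((ε.A φ i z.2.1 z.2.2 - 1 / 2 * ∑ j, ε.curlA φ i j z.2.1 z.2.2 * z.2.2 j) * z.1) *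
      w.2.1 i = z.1 * (ε.expr φ z.2.1 z.2.2 0 w.2.1 -
        ∑ i, ∑ j, 1 / 2 * ε.curlA φ i j z.2.1 z.2.2 * (w.2.1 i * z.2.2 j)) := by
    rw [SourceForm.expr, ← Finset.sum_sub_distrib, Finset.mul_sum]
    refine Finset.sum_congr rfl fun i _ => ?_
    have : ∑ j, 1 / 2 * ε.curlA φ i j z.2.1 z.2.2 * (w.2.1 i * z.2.2 j) =
        1 / 2 * w.2.1 i * ∑ j, ε.curlA φ i j z.2.1 z.2.2 * z.2.2 j := by
      rw [Finset.mul_sum]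
      exact Finset.sum_congr rfl fun j _ => by ring
    rw [this, SourceForm.A]
    ring
  have f2 : ∑ j, (∑ i, ε.B φ i j z.2.1 z.2.2 * z.2.2 i * z.1) * w.2.2 j =
      z.1 * ∑ i, ∑ j, ε.B φ i j z.2.1 z.2.2 * (z.2.2 i * w.2.2 j) := by
    simp only [Finset.sum_mul, Finset.mul_sum]
    rw [Finset.sum_comm]
    exact Finset.sum_congr rfl fun i _ => Finset.sum_congr rfl fun j _ => by ring
  rw [e2, timePotential_apply, e4, h.hor_hor_eq_sum hz0, h.hor_vert_eq_sum hz0, f1, f2]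
  ring

end ClosedRep

/-! ## Independence of the chart -/

variable {m : ℕ} {M : Type*} [TopologicalSpace M] [ChartedSpace (Coord m) M]
  [IsManifold (𝓡 m) ∞ M]

namespace Chart

variable (φ ψ : Chart m M)

lemma tangent_trans {y : Coord m × Coord m} (hy : y ∈ φ.tangent.overlap ψ.tangent) :
    φ.tangent.trans ψ.tangent y =
      (φ.base.trans ψ.base y.1, fderiv ℝ (φ.base.trans ψ.base) y.1 y.2) := by
  rw [φ.base.fderiv_trans ψ.base (y := y.1) hy]
  rfl

/-- The second derivative of the base transition enters only the fibre component, and is absent both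
on vertical vectors and on the zero section. -/
lemma fderiv_tangent_trans {y : Coord m × Coord m} (hy : y ∈ φ.tangent.overlap ψ.tangent)
    (w : Coord m × Coord m) : fderiv ℝ (φ.tangent.trans ψ.tangent) y w =
      (fderiv ℝ (φ.base.trans ψ.base) y.1 w.1,
        fderiv ℝ (φ.base.trans ψ.base) y.1 w.2 +
          fderiv ℝ (fderiv ℝ (φ.base.trans ψ.base)) y.1 w.1 y.2) := by
  have h0 := φ.base.contDiffAt_trans ψ.base (y := y.1) hy
  have h1 : HasFDerivAt (fun y : Coord m × Coord m => φ.base.trans ψ.base y.1)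
      ((fderiv ℝ (φ.base.trans ψ.base) y.1).comp (.fst ℝ (Coord m) (Coord m))) y :=
    (h0.differentiableAt (by simp)).hasFDerivAt.comp y hasFDerivAt_fst
  have h2 : HasFDerivAt (fun y : Coord m × Coord m => fderiv ℝ (φ.base.trans ψ.base) y.1)
      ((fderiv ℝ (fderiv ℝ (φ.base.trans ψ.base)) y.1).comp (.fst ℝ (Coord m) (Coord m))) y :=
    ((h0.fderiv_right (m := ∞) (by simp)).differentiableAt (by simp)).hasFDerivAt.comp y
      hasFDerivAt_fst
  have h3 := h1.prodMk (h2.clm_apply (hasFDerivAt_snd (p := y)))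
  have h4 : φ.tangent.trans ψ.tangent =ᶠ[𝓝 y] fun y =>
      (φ.base.trans ψ.base y.1, fderiv ℝ (φ.base.trans ψ.base) y.1 y.2) := by
    filter_upwards [(φ.tangent.isOpen_overlap ψ.tangent).mem_nhds hy] with z hz
    exact φ.tangent_trans ψ hz
  rw [h4.fderiv_eq]
  exact DFunLike.congr_fun h3.fderiv w

lemma fderiv_evolution_trans {z : ℝ × Coord m × Coord m}
    (hz : z.2 ∈ φ.tangent.overlap ψ.tangent) (w : ℝ × Coord m × Coord m) :
    fderiv ℝ (φ.evolution.trans ψ.evolution) z w =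
      (w.1, fderiv ℝ (φ.tangent.trans ψ.tangent) z.2 w.2) := by
  have h1 := ((φ.tangent.contDiffAt_trans ψ.tangent hz).differentiableAt (by simp)).hasFDerivAt
  have h2 := (hasFDerivAt_id (𝕜 := ℝ) z.1).prodMap z h1
  exact DFunLike.congr_fun h2.fderiv w

lemma evolution_rep_apply (α : DForm (RTMModel m) (ℝ × TM m M) 2) {y : Coord m × Coord m}
    (hy : y ∈ φ.tangent.overlap ψ.tangent) (w w' : ℝ × Coord m × Coord m) :
    φ.evolution.rep α (0, y) ![w, w'] = ψ.evolution.rep α (0, φ.tangent.trans ψ.tangent y)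
      ![(w.1, fderiv ℝ (φ.tangent.trans ψ.tangent) y w.2),
        (w'.1, fderiv ℝ (φ.tangent.trans ψ.tangent) y w'.2)] := by
  rw [φ.evolution.rep_eq_pullback ψ.evolution α (y := (0, y)) hy,
    ContinuousAlternatingMap.compContinuousLinearMap_apply]
  refine congrArg (ψ.evolution.rep α (0, φ.tangent.trans ψ.tangent y)) ?_
  funext i
  fin_cases i
  · exact φ.fderiv_evolution_trans ψ (z := (0, y)) hy w
  · exact φ.fderiv_evolution_trans ψ (z := (0, y)) hy w'

lemma spatialPart_rep_apply (α : DForm (RTMModel m) (ℝ × TM m M) 2) {y : Coord m × Coord m}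
    (hy : y ∈ φ.tangent.overlap ψ.tangent) (w w' : Coord m × Coord m) :
    spatialPart (φ.evolution.rep α) y ![w, w'] =
      spatialPart (ψ.evolution.rep α) (φ.tangent.trans ψ.tangent y)
      ![fderiv ℝ (φ.tangent.trans ψ.tangent) y w, fderiv ℝ (φ.tangent.trans ψ.tangent) y w'] := by
  rw [spatialPart_apply, spatialPart_apply]
  exact φ.evolution_rep_apply ψ α hy _ _

end Chart

namespace SourceForm

variable {ε : SourceForm m M} {α : DForm (RTMModel m) (ℝ × TM m M) 2}

namespace IsLepageEquivalent

variable (h : ε.IsLepageEquivalent α)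

include h

lemma closedRep (φ : Chart m M) : ClosedRep φ.img (ε.expr φ) (φ.evolution.rep α) :=
  isLepageEquivalent_iff.1 h φ

/-- The transition maps of `TM` preserve the zero section and, along it, send `(u, 0)` to a vector
with zero fibre component; hence restriction to the zero section commutes with the change of chart.
-/
lemma omegaChart_eq (φ ψ : Chart m M) {p : TM m M} (hφ : p.proj ∈ φ.dom) (hψ : p.proj ∈ ψ.dom) :
    ε.omegaChart φ p = ε.omegaChart ψ p := by
  have hp : p ∈ φ.tangent.source := hφ
  have hy : φ.tangent.toFun p ∈ φ.tangent.overlap ψ.tangent :=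
    φ.tangent.toFun_mem_overlap ψ.tangent hp hψ
  refine φ.tangent.eq_of_rep_eq hp ?_
  generalize φ.tangent.toFun p = y at hy
  have hy' : (y.1, (0 : Coord m)) ∈ φ.tangent.overlap ψ.tangent := hy
  have hTy : (φ.tangent.trans ψ.tangent y).1 ∈ ψ.img := ψ.tangent.map_source' hy.2
  rw [φ.tangent.rep_eq_pullback ψ.tangent (ε.omegaChart ψ) hy, (h.closedRep φ).rep_omegaChart hy.1,
    (h.closedRep ψ).rep_omegaChart hTy]
  refine alternating_two_ext fun w w' => ?_
  have e1 : ∀ u : Coord m, fderiv ℝ (φ.tangent.trans ψ.tangent) (y.1, 0) (u, 0) =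
      (fderiv ℝ (φ.base.trans ψ.base) y.1 u, 0) := fun u => by
    rw [φ.fderiv_tangent_trans ψ hy', map_zero, map_zero, add_zero]
  have e2 : φ.tangent.trans ψ.tangent (y.1, 0) = (φ.base.trans ψ.base y.1, 0) := by
    rw [φ.tangent_trans ψ hy', map_zero]
  rw [zeroSectionPart_apply, φ.spatialPart_rep_apply ψ α hy', e1, e1, e2]
  have e3 : ∀ w, (fderiv ℝ (φ.tangent.trans ψ.tangent) y w).1 =
      fderiv ℝ (φ.base.trans ψ.base) y.1 w.1 := fun w => by rw [φ.fderiv_tangent_trans ψ hy]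
  rw [← e3, ← e3]
  refine (zeroSectionPart_apply _ (φ.tangent.trans ψ.tangent y) _ _).symm.trans ?_
  refine congrArg (zeroSectionPart _ _) ?_
  funext i; fin_cases i <;> rfl

/-- The transition is linear in the fibre, so it commutes with the dilations and carries the vector
`(0, y.2)` to its counterpart. The second derivative term only changes the fibre component of the
other argument, which `apply_vert_left` discards. -/
lemma kappaChart_eq (φ ψ : Chart m M) {p : TM m M} (hφ : p.proj ∈ φ.dom) (hψ : p.proj ∈ ψ.dom) :
    ε.kappaChart φ p = ε.kappaChart ψ p := by
  have hp : p ∈ φ.tangent.source := hφ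
  have hy : φ.tangent.toFun p ∈ φ.tangent.overlap ψ.tangent :=
    φ.tangent.toFun_mem_overlap ψ.tangent hp hψ
  refine φ.tangent.eq_of_rep_eq hp ?_
  generalize φ.tangent.toFun p = y at hy
  have hTy : (φ.tangent.trans ψ.tangent y).1 ∈ ψ.img := ψ.tangent.map_source' hy.2
  rw [φ.tangent.rep_eq_pullback ψ.tangent (ε.kappaChart ψ) hy, (h.closedRep φ).rep_kappaChart hy.1,
    (h.closedRep ψ).rep_kappaChart hTy]
  refine alternating_one_ext fun w => ?_
  have e0 : ∀ (a : (Coord m × Coord m) [⋀^Fin 1]→L[ℝ] ℝ)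
      (f : Coord m × Coord m →L[ℝ] Coord m × Coord m),
      a.compContinuousLinearMap f ![w] = a ![f w] := fun a f => by
    refine congrArg a ?_
    funext i; fin_cases i; rfl
  rw [e0, (h.closedRep φ).lagrangianRep.fiberPotential_apply hy.1,
    (h.closedRep ψ).lagrangianRep.fiberPotential_apply hTy]
  refine intervalIntegral.integral_congr fun s _ => ?_
  have hy' : (y.1, s • y.2) ∈ φ.tangent.overlap ψ.tangent := hy
  have e1 : fderiv ℝ (φ.tangent.trans ψ.tangent) (y.1, s • y.2) (0, y.2) =
      (0, (φ.tangent.trans ψ.tangent y).2) := by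
    rw [φ.fderiv_tangent_trans ψ hy', φ.tangent_trans ψ hy, map_zero, map_zero]
    simp
  have e2 : φ.tangent.trans ψ.tangent (y.1, s • y.2) =
      ((φ.tangent.trans ψ.tangent y).1, s • (φ.tangent.trans ψ.tangent y).2) := by
    rw [φ.tangent_trans ψ hy', φ.tangent_trans ψ hy, map_smul]
  have e3 : (fderiv ℝ (φ.tangent.trans ψ.tangent) (y.1, s • y.2) (w.1, 0)).1 =
      (fderiv ℝ (φ.tangent.trans ψ.tangent) y w).1 := by
    rw [φ.fderiv_tangent_trans ψ hy, φ.fderiv_tangent_trans ψ hy']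
  change spatialPart _ _ _ = spatialPart _ _ _
  rw [φ.spatialPart_rep_apply ψ α hy', e1, e2, ← e3]
  exact (h.closedRep ψ).lagrangianRep.apply_vert_left (y := ((φ.tangent.trans ψ.tangent y).1,
    s • (φ.tangent.trans ψ.tangent y).2)) hTy _ _

/-- On `ℝ × TM` the transition is the identity on `ℝ` times that of `TM`, so it preserves `t` and
`∂/∂t`, hence also `t` times the contraction of `α` with `∂/∂t`. -/
lemma mu0Chart_eq (φ ψ : Chart m M) {q : ℝ × TM m M} (hφ : q.2.proj ∈ φ.dom)
    (hψ : q.2.proj ∈ ψ.dom) : ε.mu0Chart φ q = ε.mu0Chart ψ q := by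
  have hq : q ∈ φ.evolution.source := hφ
  have hz : φ.evolution.toFun q ∈ φ.evolution.overlap ψ.evolution :=
    φ.evolution.toFun_mem_overlap ψ.evolution hq hψ
  refine φ.evolution.eq_of_rep_eq hq ?_
  generalize φ.evolution.toFun q = z at hz
  have hTz : (φ.evolution.trans ψ.evolution z).2.1 ∈ ψ.img := ψ.evolution.map_source' hz.2
  rw [φ.evolution.rep_eq_pullback ψ.evolution (ε.mu0Chart ψ) hz,
    (h.closedRep φ).rep_mu0Chart hz.1, (h.closedRep ψ).rep_mu0Chart hTz]
  refine alternating_one_ext fun w => ?_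
  have e0 : ∀ (a : (ℝ × Coord m × Coord m) [⋀^Fin 1]→L[ℝ] ℝ)
      (f : ℝ × Coord m × Coord m →L[ℝ] ℝ × Coord m × Coord m),
      a.compContinuousLinearMap f ![w] = a ![f w] := fun a f => by
    refine congrArg a ?_
    funext i; fin_cases i; rfl
  rw [e0, timePotential_apply, timePotential_apply, timePart_apply, timePart_apply,
    φ.evolution_rep_apply ψ α hz, φ.fderiv_evolution_trans ψ hz]
  have e1 : fderiv ℝ (φ.tangent.trans ψ.tangent) z.2 (tVec : ℝ × Coord m × Coord m).2 = 0 :=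
    map_zero _
  rw [e1]
  rfl

end IsLepageEquivalent

end SourceForm

/-! ## The global decomposition -/

lemma Chart.isSmooth_of_tangent {k : ℕ} {θ : DForm (𝓡 m).tangent (TM m M) k}
    {a : Chart m M → Coord m × Coord m → (Coord m × Coord m) [⋀^Fin k]→L[ℝ] ℝ}
    (ha : ∀ φ, ContDiffOn ℝ ∞ (a φ) (Prod.fst ⁻¹' φ.img))
    (hθ : ∀ φ y, y.1 ∈ φ.img → φ.tangent.rep θ y = a φ y) : θ.IsSmooth :=
  SmoothCoord.isSmooth_of fun p => ⟨(Chart.at p.proj).tangent, mem_chart_source _ p.proj,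
    ((ha _).congr (hθ _)).contDiffAt ((Chart.at p.proj).tangent.open_target.mem_nhds
      ((Chart.at p.proj).tangent.map_source' (mem_chart_source _ p.proj)))⟩

lemma Chart.isSmooth_of_evolution {k : ℕ} {θ : DForm (RTMModel m) (ℝ × TM m M) k}
    {a : Chart m M → ℝ × Coord m × Coord m → (ℝ × Coord m × Coord m) [⋀^Fin k]→L[ℝ] ℝ}
    (ha : ∀ φ, ContDiffOn ℝ ∞ (a φ) (tube φ.img))
    (hθ : ∀ φ, ∀ z ∈ tube φ.img, φ.evolution.rep θ z = a φ z) : θ.IsSmooth :=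
  SmoothCoord.isSmooth_of fun q => ⟨(Chart.at q.2.proj).evolution, mem_chart_source _ q.2.proj,
    ((ha _).congr (hθ _)).contDiffAt ((Chart.at q.2.proj).evolution.open_target.mem_nhds
      ((Chart.at q.2.proj).evolution.map_source' (mem_chart_source _ q.2.proj)))⟩

namespace SourceForm

variable (ε : SourceForm m M)

/-- The form on `TM` with chart expressions `omegaChart`. -/
def omegaForm : DForm (𝓡 m).tangent (TM m M) 2 := fun p => ε.omegaChart (.at p.proj) p

/-- The form on `TM` with chart expressions `kappaChart`. -/
def kappaForm : DForm (𝓡 m).tangent (TM m M) 1 := fun p => ε.kappaChart (.at p.proj) p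

/-- The form on `ℝ × TM` with chart expressions `mu0Chart`. -/
def mu0Form : DForm (RTMModel m) (ℝ × TM m M) 1 := fun q => ε.mu0Chart (.at q.2.proj) q

namespace IsLepageEquivalent

variable {ε} {α : DForm (RTMModel m) (ℝ × TM m M) 2} (h : ε.IsLepageEquivalent α)
  (φ : Chart m M)

include h

lemma omegaForm_eq {p : TM m M} (hp : p.proj ∈ φ.dom) : ε.omegaForm p = ε.omegaChart φ p :=
  h.omegaChart_eq _ φ (mem_chart_source _ p.proj) hp

lemma kappaForm_eq {p : TM m M} (hp : p.proj ∈ φ.dom) : ε.kappaForm p = ε.kappaChart φ p :=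
  h.kappaChart_eq _ φ (mem_chart_source _ p.proj) hp

lemma mu0Form_eq {q : ℝ × TM m M} (hq : q.2.proj ∈ φ.dom) : ε.mu0Form q = ε.mu0Chart φ q :=
  h.mu0Chart_eq _ φ (mem_chart_source _ q.2.proj) hq

lemma rep_omegaForm {y : Coord m × Coord m} (hy : y.1 ∈ φ.img) :
    φ.tangent.rep ε.omegaForm y = zeroSectionPart (spatialPart (φ.evolution.rep α)) y := by
  rw [← (h.closedRep φ).rep_omegaChart hy, SmoothCoord.rep,
    h.omegaForm_eq φ (φ.tangent.map_target' hy)]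
  rfl

lemma rep_kappaForm {y : Coord m × Coord m} (hy : y.1 ∈ φ.img) :
    φ.tangent.rep ε.kappaForm y = fiberPotential (spatialPart (φ.evolution.rep α)) y := by
  rw [← (h.closedRep φ).rep_kappaChart hy, SmoothCoord.rep,
    h.kappaForm_eq φ (φ.tangent.map_target' hy)]
  rfl

lemma rep_mu0Form {z : ℝ × Coord m × Coord m} (hz : z ∈ tube φ.img) :
    φ.evolution.rep ε.mu0Form z = timePotential (φ.evolution.rep α) z := by
  rw [← (h.closedRep φ).rep_mu0Chart hz, SmoothCoord.rep,
    h.mu0Form_eq φ (φ.evolution.map_target' hz)]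
  rfl

lemma isSmooth_omegaForm : ε.omegaForm.IsSmooth :=
  Chart.isSmooth_of_tangent
    (fun φ => contDiffOn_zeroSectionPart (h.closedRep φ).smooth_spatialPart)
    fun φ _ hy => h.rep_omegaForm φ hy

lemma isSmooth_kappaForm : ε.kappaForm.IsSmooth :=
  Chart.isSmooth_of_tangent
    (fun φ => (h.closedRep φ).lagrangianRep.contDiffOn_fiberPotential)
    fun φ _ hy => h.rep_kappaForm φ hy

lemma isSmooth_mu0Form : ε.mu0Form.IsSmooth :=
  Chart.isSmooth_of_evolution (fun φ => (h.closedRep φ).smooth_timePotential)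
    fun φ _ hz => h.rep_mu0Form φ hz

/-- In coordinates this is exactly the fibre Poincaré lemma for the spatial part of `α`, which is
the expression of `α'`. -/
lemma omegaForm_add_d_kappaForm {p : TM m M} (hp : p.proj ∈ φ.dom) :
    (ε.omegaForm + ε.kappaForm.d) p = ε.alphaPrimeChart φ p := by
  have hps : p ∈ φ.tangent.source := hp
  have hl := (h.closedRep φ).lagrangianRep
  refine φ.tangent.eq_of_rep_eq hps ?_
  have hy : (φ.tangent.toFun p).1 ∈ φ.img := φ.tangent.map_source' hps
  generalize φ.tangent.toFun p = y at hy
  have h1 : φ.tangent.rep ε.kappaForm =ᶠ[𝓝 y]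
      fiberPotential (spatialPart (φ.evolution.rep α)) := by
    filter_upwards [hl.isOpen'.mem_nhds hy] with z hz using h.rep_kappaForm φ hz
  have h2 : DifferentiableAt ℝ (fiberPotential (spatialPart (φ.evolution.rep α))) y :=
    (hl.contDiffOn_fiberPotential.contDiffAt (hl.isOpen'.mem_nhds hy)).differentiableAt (by simp)
  rw [SmoothCoord.rep_add, φ.tangent.rep_d _ hy (h2.congr_of_eventuallyEq h1), h1.extDeriv_eq,
    h.rep_omegaForm φ hy, (h.closedRep φ).rep_alphaPrimeChart hy]
  refine alternating_two_ext fun w w' => ?_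
  rw [ContinuousAlternatingMap.add_apply, zeroSectionPart_apply, hl.extDeriv_fiberPotential hy]
  ring

/-- The Lepage equivalent is `ω + d(μ₀ + κ)`. -/
lemma eq_add_d : α = liftForm ε.omegaForm + (ε.mu0Form + liftForm ε.kappaForm).d := by
  funext q
  obtain ⟨φ, hφ⟩ : ∃ φ : Chart m M, q.2.proj ∈ φ.dom := ⟨.at _, mem_chart_source _ q.2.proj⟩
  have hq : q ∈ φ.evolution.source := hφ
  refine φ.evolution.eq_of_rep_eq hq ?_
  have hz : φ.evolution.toFun q ∈ tube φ.img := φ.evolution.map_source' hq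
  generalize φ.evolution.toFun q = z at hz
  have hc := h.closedRep φ
  have hl := hc.lagrangianRep
  have h1 : φ.evolution.rep (ε.mu0Form + liftForm ε.kappaForm) =ᶠ[𝓝 z] fun z =>
      timePotential (φ.evolution.rep α) z + (fiberPotential (spatialPart (φ.evolution.rep α)) z.2
        ).compContinuousLinearMap (.snd ℝ ℝ (Coord m × Coord m)) := by
    filter_upwards [hc.eventually_mem hz] with y hy
    rw [SmoothCoord.rep_add, h.rep_mu0Form φ hy, rep_liftForm φ _ hy, h.rep_kappaForm φ hy]
  have h2 : DifferentiableAt ℝ (fiberPotential (spatialPart (φ.evolution.rep α))) z.2 :=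
    (hl.contDiffOn_fiberPotential.contDiffAt (hl.isOpen'.mem_nhds hz)).differentiableAt (by simp)
  have h3 : DifferentiableAt ℝ (timePotential (φ.evolution.rep α)) z :=
    (hc.smooth_timePotential.contDiffAt ((isOpen_tube hc.isOpen).mem_nhds hz)).differentiableAt
      (by simp)
  have h4 := h3.add ((h2.comp (f := fun z : ℝ × Coord m × Coord m => z.2) z
      differentiableAt_snd).continuousAlternatingMapCompContinuousLinearMap
        (differentiableAt_const (.snd ℝ ℝ (Coord m × Coord m))))
  rw [SmoothCoord.rep_add, φ.evolution.rep_d _ hz (h4.congr_of_eventuallyEq h1), h1.extDeriv_eq,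
    rep_liftForm φ _ hz, h.rep_omegaForm φ hz]
  exact hc.eq_add_extDeriv hz

end IsLepageEquivalent

end SourceForm

end VarForms

end

theorem mainTheorem3 {m : ℕ} {M : Type*} [TopologicalSpace M]
    [ChartedSpace (EuclideanSpace ℝ (Fin m)) M] [IsManifold (𝓡 m) ∞ M]
    (ε : VarForms.SourceForm m M) (hε : ε.IsLocallyVariational) :
    -- in every chart, `εᵢ = Aᵢ + Bᵢⱼ ẍʲ`
    (∀ (φ : VarForms.Chart m M) (i : Fin m) (x v a : EuclideanSpace ℝ (Fin m)), x ∈ φ.img →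
      ε.coeff φ i (x, v, a) = ε.A φ i x v + ∑ j, ε.B φ i j x v * a j) ∧
    -- the chart expressions of `ω` and `κ` agree on chart overlaps
    (∀ (φ ψ : VarForms.Chart m M) (p : VarForms.TM m M), p.proj ∈ φ.dom → p.proj ∈ ψ.dom →
      ε.omegaChart φ p = ε.omegaChart ψ p ∧ ε.kappaChart φ p = ε.kappaChart ψ p) ∧
    -- they define global smooth forms on `TM`, and `μ₀` is a global smooth form on `ℝ × TM`
    ∃ (Ω : VarForms.DForm (𝓡 m).tangent (VarForms.TM m M) 2)
      (κ : VarForms.DForm (𝓡 m).tangent (VarForms.TM m M) 1)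
      (μ₀ : VarForms.DForm (VarForms.RTMModel m) (ℝ × VarForms.TM m M) 1),
      VarForms.DForm.IsSmooth Ω ∧ VarForms.DForm.IsSmooth κ ∧ VarForms.DForm.IsSmooth μ₀ ∧
      (∀ (φ : VarForms.Chart m M) (p : VarForms.TM m M), p.proj ∈ φ.dom →
        Ω p = ε.omegaChart φ p ∧ κ p = ε.kappaChart φ p ∧
        -- the global decomposition `α' = ω + dκ`
        (Ω + VarForms.DForm.d κ) p = ε.alphaPrimeChart φ p) ∧
      (∀ (φ : VarForms.Chart m M) (q : ℝ × VarForms.TM m M), q.2.proj ∈ φ.dom →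
        μ₀ q = ε.mu0Chart φ q) ∧
      -- the Lepage equivalent `α` of `ε` exists, is unique, and is `ω + d(μ₀ + κ)`
      ∃ α : VarForms.DForm (VarForms.RTMModel m) (ℝ × VarForms.TM m M) 2,
        ε.IsLepageEquivalent α ∧
        (∀ β : VarForms.DForm (VarForms.RTMModel m) (ℝ × VarForms.TM m M) 2,
          ε.IsLepageEquivalent β → β = α) ∧
        α = VarForms.liftForm Ω + VarForms.DForm.d (μ₀ + VarForms.liftForm κ) := by
  obtain ⟨α, hα⟩ := hε.exists_isLepageEquivalent
  -- The time `0` is arbitrary, as `A` and `B` do not involve `t`.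
  exact ⟨fun φ i x v a hx => (hα.closedRep φ).coeff_eq (z := (0, x, v)) hx a i,
    fun φ ψ _ hφ hψ => ⟨hα.omegaChart_eq φ ψ hφ hψ, hα.kappaChart_eq φ ψ hφ hψ⟩,
    ε.omegaForm, ε.kappaForm, ε.mu0Form, hα.isSmooth_omegaForm, hα.isSmooth_kappaForm,
    hα.isSmooth_mu0Form,
    fun φ _ hp => ⟨hα.omegaForm_eq φ hp, hα.kappaForm_eq φ hp, hα.omegaForm_add_d_kappaForm φ hp⟩,
    fun φ _ hq => hα.mu0Form_eq φ hq, α, hα, fun _ hβ => hα.unique hβ, hα.eq_add_d⟩
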